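/- Let $n\ge 0$ and let $\mathbf a=(a_S)_{S\subseteq[n]}\in\mathbb R^{2^n}$ with $a_\emptyset=1$. To any $\mathbf b=(b_S)_{S\subseteq [n]}\in\mathbb R^{2^n}$ associate the multiaffine polynomial $f_{\mathbf b}=\sum_{S\subseteq[n]}b_S\prod_{i\in[n]\setminus S}x_i\in\mathbb R[x_1,\dots,x_n]$. An element $\gamma=(g,\sigma)$ of $\mathrm{SL}_2(\mathbb R)^n\rtimes S_n$, with $g_i=\begin{pmatrix}p_i&q_i\\ r_i&s_i\end{pmatrix}$, acts on multiaffine polynomials by the substitution $$\gamma\cdot f=\prod_{i=1}^n(r_iy_i+s_i)\cdot f\Big(\frac{p_1y_1+q_1}{r_1y_1+s_1},\dots,\frac{p_ny_n+q_n}{r_ny_n+s_n}\Big),\qquad y_i=x_{\sigma^{-1}(i)},$$ and $\gamma\cdot\mathbf a$ is defined by $f_{\gamma\cdot\mathbf a}=\gamma\cdot f_{\mathbf a}$. Write $\Delta_{12}f=\frac{\partial f}{\partial x_1}\frac{\partial f}{\partial x_2}-f\,\frac{\partial^2 f}{\partial x_1\partial x_2}$. For $g=c_2x^2+c_1x+c_0$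 put $\mathrm{Discr}_x(g)=c_1^2-4c_0c_2$, and for $h=\sum_{j=0}^4 b_jx^j$ put $$B_x(h)=b_4b_1^2-b_3^2b_0,\quad C_x(h)=b_1^3-4b_0b_1b_2+8b_0^2b_3,\quad D_x(h)=b_1^2b_2-4b_0b_2^2+2b_0b_1b_3+16b_0^2b_4 .$$ Let $\mathrm{HypDet}$ be the $2\times2\times2$ hyperdeterminant $$\mathrm{HypDet}(\mathbf b)=(b_1b_{23}+b_2b_{13}-b_3b_{12}-b_\emptyset b_{123})^2-4(b_1b_2-b_\emptyset b_{12})(b_{13}b_{23}-b_3b_{123}).$$ Then there is a Hermitian matrix $A\in\mathbb C^{n\times n}$ whose principal minors are $\mathbf a$, that is, $\det\big((A_{ij})_{i,j\in S}\big)=a_S$ for all $S\subseteq[n]$, if and only if for every $\gamma\in\mathrm{SL}_2(\mathbb R)^n\rtimes S_n$ the vector $\mathbf b=\gamma\cdot\mathbf a$ satisfies (i) if $n\ge2$: $b_1b_2-b_\emptyset b_{12}\ge0$; (ii) if $n\ge3$: $\mathrm{HypDet}(\mathbf b)\le0$; (iii) if $n\ge4$: the three equations, of degree $12$ in $\mathbf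 b$, stating that $$B_{x_4}\big(\mathrm{Discr}_{x_3}(\Delta_{12}f_{\mathbf b})\big),\quad C_{x_4}\big(\mathrm{Discr}_{x_3}(\Delta_{12}f_{\mathbf b})\big),\quad D_{x_4}\big(\mathrm{Discr}_{x_3}(\Delta_{12}f_{\mathbf b})\big)$$ vanish when restricted to $x_5=\dots=x_n=0$. -/

import Mathlib

/-!
The index set `[n] = {1, …, n}` is `Fin n`, so the index `i` of the docstrings is `i - 1` in code.
A vector `a ∈ ℝ^{2^n}` is a function `Finset (Fin n) → ℝ`.
-/

namespace PrincipalMinors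

/-- The principal minor of `A` on the rows and columns indexed by `S`; it is `1` for `S = ∅`. -/
def principalMinor {n : ℕ} (A : Matrix (Fin n) (Fin n) ℂ) (S : Finset (Fin n)) : ℂ :=
  (A.submatrix (fun i : S => (i : Fin n)) (fun i : S => (i : Fin n))).det

/-- The multiaffine polynomial `f_a = ∑_S a_S ∏_{i ∉ S} x_i`. -/
noncomputable def multiaffine {n : ℕ} (a : Finset (Fin n) → ℝ) : MvPolynomial (Fin n) ℝ :=
  ∑ S : Finset (Fin n), MvPolynomial.C (a S) * ∏ i ∈ Sᶜ, MvPolynomial.X i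

/-- The semidirect product `SL₂(ℝ)ⁿ ⋊ Sₙ`, where `Sₙ` permutes the `n` factors:
`(σ • g) i = g (σ⁻¹ i)`. -/
abbrev SLPerm (n : ℕ) : Type :=
  (Fin n → Matrix.SpecialLinearGroup (Fin 2) ℝ) ⋊[mulAutArrow] (Equiv.Perm (Fin n))

/-- `γ · f_a` for `γ = (g, σ)` with `g_i = (p_i, q_i; r_i, s_i)`: the polynomial
`∏ i, (r_i y_i + s_i) · f_a ((p_1 y_1 + q_1) / (r_1 y_1 + s_1), …, (p_n y_n + q_n) / (r_n y_n + s_n))`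
with `y_i = x_{σ⁻¹ i}`, written with the denominators cleared. -/
noncomputable def actPoly {n : ℕ} (γ : SLPerm n) (a : Finset (Fin n) → ℝ) :
    MvPolynomial (Fin n) ℝ :=
  ∑ S : Finset (Fin n), MvPolynomial.C (a S) * ∏ i : Fin n,
    if i ∈ S then
      MvPolynomial.C (γ.left i 1 0) * MvPolynomial.X (γ.right⁻¹ i) + MvPolynomial.C (γ.left i 1 1)
    else
      MvPolynomial.C (γ.left i 0 0) * MvPolynomial.X (γ.right⁻¹ i) + MvPolynomial.C (γ.left i 0 1)

/-- The vector `γ · a`, that is, the vector with `f_{γ · a} = γ · f_a`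
(see `multiaffine_act`), in coordinates. -/
def act {n : ℕ} (γ : SLPerm n) (a : Finset (Fin n) → ℝ) : Finset (Fin n) → ℝ := fun T =>
  ∑ S : Finset (Fin n), a S * ∏ i : Fin n,
    γ.left i (if i ∈ S then 1 else 0) (if γ.right⁻¹ i ∈ T then 1 else 0)

/-- The coordinates `a_S` with `S ⊆ [k]`, of a vector indexed by the subsets of `[n]`, `k ≤ n`. -/
def firstCoords {k n : ℕ} (h : k ≤ n) (a : Finset (Fin n) → ℝ) : Finset (Fin k) → ℝ := fun S =>
  a (S.map (Fin.castLEEmb h))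

/-- The quadratic polynomial `a_1 a_2 - a_∅ a_{12}`. -/
def minorQuadric (a : Finset (Fin 2) → ℝ) : ℝ := a {0} * a {1} - a ∅ * a {0, 1}

/-- Cayley's `2 × 2 × 2` hyperdeterminant. -/
def hypDet (a : Finset (Fin 3) → ℝ) : ℝ :=
  (a {0} * a {1, 2} + a {1} * a {0, 2} - a {2} * a {0, 1} - a ∅ * a {0, 1, 2}) ^ 2
    - 4 * (a {0} * a {1} - a ∅ * a {0, 1}) * (a {0, 2} * a {1, 2} - a {2} * a {0, 1, 2})

/-- The Rayleigh difference `Δ_{ij}(f) = ∂_i f ∂_j f - f ∂_i ∂_j f`. -/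
noncomputable def rayleigh {n : ℕ} (i j : Fin n) (f : MvPolynomial (Fin n) ℝ) :
    MvPolynomial (Fin n) ℝ :=
  MvPolynomial.pderiv i f * MvPolynomial.pderiv j f
    - f * MvPolynomial.pderiv i (MvPolynomial.pderiv j f)

/-- `f` regarded as a univariate polynomial in `x_k` whose coefficients are polynomials in the
remaining variables. -/
noncomputable def asPolyIn {n : ℕ} (k : Fin n) (f : MvPolynomial (Fin n) ℝ) :
    Polynomial (MvPolynomial (Fin n) ℝ) :=
  MvPolynomial.aeval
    (fun i => if i = k then Polynomial.X else Polynomial.C (MvPolynomial.X i)) f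

/-- The discriminant `c_1² - 4 c_0 c_2` of `c_2 t² + c_1 t + c_0`
(a polynomial of degree at most two, the degree being formal). -/
noncomputable def discrQuadratic {R : Type*} [CommRing R] (p : Polynomial R) : R :=
  p.coeff 1 ^ 2 - 4 * p.coeff 0 * p.coeff 2

/-- `B(h) = b_4 b_1² - b_3² b_0` for a quartic `h = ∑ b_j t^j`. -/
noncomputable def quarticB {R : Type*} [CommRing R] (h : Polynomial R) : R :=
  h.coeff 4 * h.coeff 1 ^ 2 - h.coeff 3 ^ 2 * h.coeff 0

/-- `C(h) = b_1³ - 4 b_0 b_1 b_2 + 8 b_0² b_3` for a quartic `h = ∑ b_j t^j`. -/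
noncomputable def quarticC {R : Type*} [CommRing R] (h : Polynomial R) : R :=
  h.coeff 1 ^ 3 - 4 * h.coeff 0 * h.coeff 1 * h.coeff 2 + 8 * h.coeff 0 ^ 2 * h.coeff 3

/-- `D(h) = b_1² b_2 - 4 b_0 b_2² + 2 b_0 b_1 b_3 + 16 b_0² b_4` for a quartic
`h = ∑ b_j t^j`. -/
noncomputable def quarticD {R : Type*} [CommRing R] (h : Polynomial R) : R :=
  h.coeff 1 ^ 2 * h.coeff 2 - 4 * h.coeff 0 * h.coeff 2 ^ 2
    + 2 * h.coeff 0 * h.coeff 1 * h.coeff 3 + 16 * h.coeff 0 ^ 2 * h.coeff 4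

/-- The quartic in `x_4` obtained as `Discr_{x_3}(Δ_{12} f_a)`. -/
noncomputable def discrRayleigh {n : ℕ} (h : 4 ≤ n) (a : Finset (Fin n) → ℝ) :
    Polynomial (MvPolynomial (Fin n) ℝ) :=
  asPolyIn (Fin.castLE h 3) (discrQuadratic (asPolyIn (Fin.castLE h 2)
    (rayleigh (Fin.castLE h 0) (Fin.castLE h 1) (multiaffine a))))

/-- Restriction to `x_5 = ⋯ = x_n = 0`. -/
noncomputable def restrictFour {n : ℕ} (f : MvPolynomial (Fin n) ℝ) : MvPolynomial (Fin n) ℝ :=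
  MvPolynomial.aeval (fun i : Fin n => if (i : ℕ) < 4 then MvPolynomial.X i else 0) f

/-- The defining property of the action: `f_{γ · a} = γ · f_a`. -/
theorem multiaffine_act {n : ℕ} (γ : SLPerm n) (a : Finset (Fin n) → ℝ) :
    multiaffine (act γ a) = actPoly γ a := by
  classical
  have key : ∀ S : Finset (Fin n), (∏ i : Fin n,
      if i ∈ S then
        MvPolynomial.C (γ.left i 1 0) * MvPolynomial.X (γ.right⁻¹ i)
          + MvPolynomial.C (γ.left i 1 1)
      else
        MvPolynomial.C (γ.left i 0 0) * MvPolynomial.X (γ.right⁻¹ i)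
          + MvPolynomial.C (γ.left i 0 1)) =
      ∑ T : Finset (Fin n), MvPolynomial.C (∏ i : Fin n,
        γ.left i (if i ∈ S then 1 else 0) (if γ.right⁻¹ i ∈ T then 1 else 0)) *
          ∏ i ∈ Tᶜ, (MvPolynomial.X i : MvPolynomial (Fin n) ℝ) := by
    intro S
    rw [← Equiv.prod_comp γ.right]
    have e : ∀ T : Finset (Fin n), (∏ i : Fin n,
        γ.left i (if i ∈ S then 1 else 0) (if γ.right⁻¹ i ∈ T then 1 else 0)) =
        ∏ i : Fin n, γ.left (γ.right i) (if γ.right i ∈ S then 1 else 0)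
          (if i ∈ T then 1 else 0) := by
      intro T
      rw [← Equiv.prod_comp γ.right]
      simp
    have e2 : ∀ i : Fin n, (if γ.right i ∈ S then
        MvPolynomial.C (γ.left (γ.right i) 1 0) * MvPolynomial.X (γ.right⁻¹ (γ.right i))
          + MvPolynomial.C (γ.left (γ.right i) 1 1)
      else
        MvPolynomial.C (γ.left (γ.right i) 0 0) * MvPolynomial.X (γ.right⁻¹ (γ.right i))
          + MvPolynomial.C (γ.left (γ.right i) 0 1)) =
        MvPolynomial.C (γ.left (γ.right i) (if γ.right i ∈ S then 1 else 0) 1)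
        + MvPolynomial.C (γ.left (γ.right i) (if γ.right i ∈ S then 1 else 0) 0)
          * (MvPolynomial.X i : MvPolynomial (Fin n) ℝ) := by
      intro i
      split_ifs <;> simp [add_comm]
    simp_rw [e, e2]
    rw [Finset.prod_add, Finset.powerset_univ]
    refine Finset.sum_congr rfl fun T _ => ?_
    rw [Finset.prod_mul_distrib, ← mul_assoc, ← Finset.compl_eq_univ_sdiff, map_prod]
    congr 1
    rw [← Finset.prod_mul_prod_compl T]
    congr 1
    · exact Finset.prod_congr rfl fun i hi => by simp [hi]
    · exact Finset.prod_congr rfl fun i hi => by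
        simp [Finset.mem_compl.mp hi]
  unfold multiaffine act actPoly
  simp_rw [key, map_sum, Finset.sum_mul, Finset.mul_sum, map_mul, mul_assoc]
  exact Finset.sum_comm

end PrincipalMinors

open PrincipalMinors

/-! ### The group action in coordinates -/

namespace PrincipalMinors

open Finset

/-! Necessity. Every minor of `A` is a determinant whose rows are rows of `A` or of the identity, so
the group acts by mixing row `i` of `A` with row `i` of the identity. Up to a scalar the transformed
vector is again the vector of minors of a Hermitian matrix, a Möbius transform `Q P⁻¹` of `A`
(`hermitian_transform`), provided its coordinate at `∅` is nonzero. For minors of a Hermitian `K`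
the three conditions are identities: the quadric is `|K₀₁|²`, the hyperdeterminant is the square of
the difference of two conjugate 3-cycle products, and on a pencil it is the square of a quadratic in
the pencil variable (`localConditions_of_pminor`). The case where the coordinate at `∅` vanishes
follows by density, the conditions being closed (`orbitConditions_of_pminor`).

Sufficiency goes by induction on the index set, adding one index `w` to `V`. If `b` came from a
matrix with block `A₀` on `V`, border column `v` and corner `b_w`, then the orbit elements `shear w
t b` would restrict on `V` to the minors of `A₀ - t v v*`, which are affine in `t`. Conversely, the
induction hypothesis supplies, for each real `t`, some Hermitian `B t` with these minors, with no
control over its dependence on `t`. The task is to choose it polynomially in `t`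
(`exists_hermitian_polynomial`). Conjugating by a diagonal matrix read off from `B t` itself makes
each entry off the diagonal zero, a product `B j k * B k j`, or a 3-cycle product. A 3-cycle product
solves a quadratic equation whose discriminant is the hyperdeterminant along the shear; the
conditions make it minus a square of a polynomial (`OrbitConditions.exists_sq`), so the solutions
are polynomials.

The diagonal conjugation must then be undone over `ℂ[t]`: a Hermitian polynomial matrix `N` with
minors divisible by `∏ m_j` has to be written `N j k = G j * conj (G k) * β j k` with `G j * conj (G
j) = m_j` (`exists_hermitian_gauge`). At each point `z` this asks for an integral potential on a
weighted digraph of vanishing orders. By a minimum-mean-cycle argument (`exists_potential_or_perm`),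
the obstruction is a set `S` on which one term of the Leibniz expansion vanishes to strictly lower
order than all others and than `∏ m_j`, which contradicts the divisibility of the minor on `S`. The
local solutions are assembled symmetrically under conjugation; at real points, halving the even
order of `m_j` works.

Finally `β` has affine minors, hence affine entries `A₀ - t W`, and `W` is forced to be `v v*`;
bordering `A₀` by `v` finishes (`exists_bordered`). The diagonal conjugation needs the relation
"nonzero pair defect" to be transitive. This is arranged by an inner induction on the number of
vanishing pair defects: a generic shear lowers it, and shears can be undone by
`hermitian_transform`. -/

theorem act_act {n : ℕ} (γ γ' : SLPerm n) (a : Finset (Fin n) → ℝ) :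
    act γ' (act γ a) = act (γ * γ') a := by
  classical
  funext U
  simp only [act, Finset.sum_mul]
  rw [Finset.sum_comm]
  refine Finset.sum_congr rfl fun S _ => ?_
  simp only [mul_assoc]
  rw [← Finset.mul_sum]
  congr 1
  -- After reindexing by `γ.right`, the sum over the intermediate set `T` is the expansion of a
  -- product of binomials, one 2 × 2 matrix product per index.
  have e : ∀ T : Finset (Fin n),
      (∏ i, γ.left i (if i ∈ S then 1 else 0) (if γ.right⁻¹ i ∈ T then 1 else 0)) *
        ∏ i, γ'.left i (if i ∈ T then 1 else 0) (if γ'.right⁻¹ i ∈ U then 1 else 0) =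
      (∏ i ∈ T, γ.left (γ.right i) (if γ.right i ∈ S then 1 else 0) 1 *
        γ'.left i 1 (if γ'.right⁻¹ i ∈ U then 1 else 0)) *
      ∏ i ∈ univ \ T, γ.left (γ.right i) (if γ.right i ∈ S then 1 else 0) 0 *
        γ'.left i 0 (if γ'.right⁻¹ i ∈ U then 1 else 0) := by
    intro T
    rw [← Equiv.prod_comp γ.right, ← Finset.prod_mul_distrib, ← Finset.compl_eq_univ_sdiff,
      ← Finset.prod_mul_prod_compl T]
    congr 1
    · exact Finset.prod_congr rfl fun i hi => by simp [hi]
    · exact Finset.prod_congr rfl fun i hi => by simp [Finset.mem_compl.mp hi]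
  simp_rw [e]
  rw [← Finset.powerset_univ, ← Finset.prod_add]
  conv_rhs => rw [← Equiv.prod_comp γ.right]
  refine Finset.prod_congr rfl fun i _ => ?_
  have hl : (γ * γ').left (γ.right i) = γ.left (γ.right i) * γ'.left i := by
    change γ.left (γ.right i) * γ'.left (γ.right⁻¹ (γ.right i)) = _
    simp
  rw [hl]
  simp [Matrix.mul_apply, Fin.sum_univ_two, add_comm]

theorem act_one {n : ℕ} (a : Finset (Fin n) → ℝ) : act 1 a = a := by
  classical
  funext T
  rw [act, Finset.sum_eq_single T]
  · rw [Finset.prod_eq_one, mul_one]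
    intro i _
    by_cases h : i ∈ T <;> simp [h]
  · intro S _ hS
    obtain ⟨i, hi⟩ : ∃ i, ¬ (i ∈ S ↔ i ∈ T) := by
      by_contra! h
      exact hS (Finset.ext h)
    rw [Finset.prod_eq_zero (Finset.mem_univ i), mul_zero]
    by_cases h : i ∈ S <;> by_cases h' : i ∈ T <;> simp_all
  · simp

theorem act_inv_act {n : ℕ} (γ : SLPerm n) (a : Finset (Fin n) → ℝ) :
    act γ⁻¹ (act γ a) = a := by
  rw [act_act, mul_inv_cancel, act_one]

theorem act_perm {n : ℕ} (σ : Equiv.Perm (Fin n)) (a : Finset (Fin n) → ℝ)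
    (T : Finset (Fin n)) :
    act (SemidirectProduct.inr σ) a T = a (T.map σ.toEmbedding) := by
  classical
  have hm : ∀ i, i ∈ T.map σ.toEmbedding ↔ σ⁻¹ i ∈ T := by
    intro i
    rw [Finset.mem_map_equiv]
    rfl
  rw [act, Finset.sum_eq_single (T.map σ.toEmbedding)]
  · rw [Finset.prod_eq_one, mul_one]
    intro i _
    by_cases h : σ⁻¹ i ∈ T
    · simp only [SemidirectProduct.right_inr, SemidirectProduct.left_inr, hm, h]
      simp
    · simp only [SemidirectProduct.right_inr, SemidirectProduct.left_inr, hm, h]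
      simp
  · intro S _ hS
    obtain ⟨i, hi⟩ : ∃ i, ¬ (i ∈ S ↔ i ∈ T.map σ.toEmbedding) := by
      by_contra! h
      exact hS (Finset.ext h)
    rw [hm] at hi
    rw [Finset.prod_eq_zero (Finset.mem_univ i), mul_zero]
    simp only [SemidirectProduct.right_inr, SemidirectProduct.left_inr]
    by_cases h : i ∈ S <;> by_cases h' : σ⁻¹ i ∈ T
    · simp_all
    · rw [Equiv.Perm.inv_def] at h'; simp [h, h']
    · rw [Equiv.Perm.inv_def] at h'; simp [h, h']
    · simp_all
  · simp

theorem act_mulSingle {n : ℕ} (w : Fin n) (M : Matrix.SpecialLinearGroup (Fin 2) ℝ)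
    (a : Finset (Fin n) → ℝ) (T : Finset (Fin n)) :
    act (SemidirectProduct.inl (Pi.mulSingle w M)) a T =
      a (T.erase w) * M 0 (if w ∈ T then 1 else 0) +
        a (insert w T) * M 1 (if w ∈ T then 1 else 0) := by
  classical
  have hp : ∀ S : Finset (Fin n), (∀ i, i ≠ w → (i ∈ S ↔ i ∈ T)) →
      (∏ i, (Pi.mulSingle w M : Fin n → Matrix.SpecialLinearGroup (Fin 2) ℝ) i
        (if i ∈ S then 1 else 0) (if i ∈ T then 1 else 0)) =
        M (if w ∈ S then 1 else 0) (if w ∈ T then 1 else 0) := by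
    intro S h
    rw [Finset.prod_eq_single w]
    · simp
    · intro i _ hi
      rw [Pi.mulSingle_eq_of_ne hi]
      by_cases h' : i ∈ T
      · rw [if_pos h', if_pos ((h i hi).2 h')]; simp
      · rw [if_neg h', if_neg (fun h'' => h' ((h i hi).1 h''))]; simp
    · simp
  simp only [act, SemidirectProduct.right_inl, SemidirectProduct.left_inl, inv_one,
    Equiv.Perm.coe_one, id_eq]
  rw [Finset.sum_eq_add (T.erase w) (insert w T)]
  · rw [hp, hp]
    · simp
    · intro i hi; simp [hi]
    · intro i hi; simp [hi]
  · intro h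
    have : w ∈ T.erase w := h ▸ Finset.mem_insert_self w T
    simp at this
  · rintro S _ ⟨h1, h2⟩
    obtain ⟨i, hiw, hi⟩ : ∃ i, i ≠ w ∧ ¬ (i ∈ S ↔ i ∈ T) := by
      by_contra! h
      by_cases hw : w ∈ S
      · refine h2 (Finset.ext fun i => ?_)
        by_cases hi : i = w
        · simp [hi, hw]
        · simp [hi, h i hi]
      · refine h1 (Finset.ext fun i => ?_)
        by_cases hi : i = w
        · simp [hi, hw]
        · simp [hi, h i hi]
    rw [Finset.prod_eq_zero (Finset.mem_univ i), mul_zero]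
    rw [Pi.mulSingle_eq_of_ne hiw]
    by_cases h : i ∈ S <;> by_cases h' : i ∈ T <;> simp_all
  · simp
  · simp

end PrincipalMinors

/-! ### Möbius transforms of Hermitian matrices -/

namespace PrincipalMinors

open Finset Matrix

/-- The principal minor of a square matrix over a commutative ring. -/
def pminor {ι R : Type*} [DecidableEq ι] [CommRing R] (A : Matrix ι ι R) (S : Finset ι) : R :=
  (A.submatrix (fun i : S => (i : ι)) (fun i : S => (i : ι))).det

theorem det_eq_of_instances {m R : Type*} [CommRing R] (M : Matrix m m R)
    (i₁ i₂ : DecidableEq m) (j₁ j₂ : Fintype m) :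
    @Matrix.det m i₁ j₁ R _ M = @Matrix.det m i₂ j₂ R _ M := by
  obtain rfl : i₁ = i₂ := Subsingleton.elim _ _
  obtain rfl : j₁ = j₂ := Subsingleton.elim _ _
  rfl

/-- This makes all principal minors values of one multilinear function of the rows, so that sums
over subsets arise from multilinear expansion. -/
theorem pminor_eq_det_rows {ι R : Type*} [DecidableEq ι] [Fintype ι] [CommRing R]
    (A : Matrix ι ι R) (S : Finset ι) :
    pminor A S = (Matrix.of fun i => if i ∈ S then A i else (1 : Matrix ι ι R) i).det := by
  classical
  rw [Matrix.twoBlockTriangular_det _ (fun i => i ∈ S)]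
  · have h1 : (Matrix.of fun i => if i ∈ S then A i else (1 : Matrix ι ι R) i).toSquareBlockProp
        (fun i => i ∈ S) = A.submatrix (fun i : S => (i : ι)) (fun i : S => (i : ι)) := by
      ext i j
      simp [Matrix.toSquareBlockProp, i.2]
    have h2 : (Matrix.of fun i => if i ∈ S then A i else (1 : Matrix ι ι R) i).toSquareBlockProp
        (fun i => ¬ i ∈ S) = 1 := by
      ext i j
      simp [Matrix.toSquareBlockProp, i.2, Matrix.one_apply, Subtype.ext_iff]
    rw [h1, h2, Matrix.det_one, mul_one]
    exact det_eq_of_instances _ _ _ _ _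
  · intro i hi j hj
    have : i ≠ j := fun h => hi (h ▸ hj)
    simp [hi, this]

/-- If `a` is a multiple of the vector of principal minors of a Hermitian matrix, then so is every
vector in its orbit with nonzero coordinate at `∅`. -/
theorem hermitian_transform {n : ℕ} {A : Matrix (Fin n) (Fin n) ℂ} (hA : A.IsHermitian)
    {a : Finset (Fin n) → ℝ} {c : ℝ} (ha : ∀ S, (a S : ℂ) = c * pminor A S) (γ : SLPerm n)
    (h0 : act γ a ∅ ≠ 0) :
    ∃ H : Matrix (Fin n) (Fin n) ℂ, H.IsHermitian ∧
      ∀ S, (act γ a S : ℂ) = act γ a ∅ * pminor H S := by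
  classical
  set σ := γ.right with hσ
  let row : Fin n → Fin 2 → (Fin n → ℂ) := fun i e =>
    ((γ.left i 1 e : ℝ) : ℂ) • A i + ((γ.left i 0 e : ℝ) : ℂ) • (1 : Matrix (Fin n) (Fin n) ℂ) i
  have key : ∀ T, (act γ a T : ℂ) =
      c * (Matrix.of fun i => row i (if σ⁻¹ i ∈ T then 1 else 0)).det := by
    intro T
    have e1 : (Matrix.of fun i => row i (if σ⁻¹ i ∈ T then 1 else 0)).det =
        Matrix.detRowAlternating.toMultilinearMap
          ((fun i => ((γ.left i 1 (if σ⁻¹ i ∈ T then 1 else 0) : ℝ) : ℂ) • A i) +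
          (fun i => ((γ.left i 0 (if σ⁻¹ i ∈ T then 1 else 0) : ℝ) : ℂ) •
            (1 : Matrix (Fin n) (Fin n) ℂ) i)) := rfl
    rw [e1, MultilinearMap.map_add_univ, act, Complex.ofReal_sum, Finset.mul_sum]
    refine Finset.sum_congr rfl fun S _ => ?_
    have e2 : (S.piecewise
          (fun i => ((γ.left i 1 (if σ⁻¹ i ∈ T then 1 else 0) : ℝ) : ℂ) • A i)
          (fun i => ((γ.left i 0 (if σ⁻¹ i ∈ T then 1 else 0) : ℝ) : ℂ) •
            (1 : Matrix (Fin n) (Fin n) ℂ) i)) =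
        fun i => ((γ.left i (if i ∈ S then 1 else 0) (if σ⁻¹ i ∈ T then 1 else 0) : ℝ) : ℂ) •
          (if i ∈ S then A i else (1 : Matrix (Fin n) (Fin n) ℂ) i) := by
      funext i
      by_cases h : i ∈ S <;> simp [h]
    rw [e2, MultilinearMap.map_smul_univ, Complex.ofReal_mul, Complex.ofReal_prod, ha,
      pminor_eq_det_rows, smul_eq_mul]
    have e3 : (Matrix.detRowAlternating.toMultilinearMap fun i =>
      (if i ∈ S then A i else (1 : Matrix (Fin n) (Fin n) ℂ) i)) =
      (Matrix.of fun i => if i ∈ S then A i else (1 : Matrix (Fin n) (Fin n) ℂ) i).det := rfl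
    rw [e3]
    ring
  -- By `key`, the coordinate at `T` is `c` times the determinant with rows of `Q` on `T` (up to the
  -- permutation) and rows of `P` elsewhere. Dividing by `P` on the right leaves the principal minor
  -- of `Q P⁻¹`.
  set P : Matrix (Fin n) (Fin n) ℂ := Matrix.of fun i => row i 0 with hP
  set Q : Matrix (Fin n) (Fin n) ℂ := Matrix.of fun i => row i 1 with hQ
  have hb : (act γ a ∅ : ℂ) = c * P.det := by
    rw [key]; simp [hP]
  have hPd : P.det ≠ 0 := by
    intro h
    rw [h, mul_zero] at hb
    exact h0 (by exact_mod_cast hb)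
  have hPu : IsUnit P.det := isUnit_iff_ne_zero.2 hPd
  have hPe : P = diagonal (fun i => ((γ.left i 1 0 : ℝ) : ℂ)) * A +
      diagonal (fun i => ((γ.left i 0 0 : ℝ) : ℂ)) := by
    ext i j
    by_cases h : i = j <;> simp [hP, row, h]
  have hQe : Q = diagonal (fun i => ((γ.left i 1 1 : ℝ) : ℂ)) * A +
      diagonal (fun i => ((γ.left i 0 1 : ℝ) : ℂ)) := by
    ext i j
    by_cases h : i = j <;> simp [hQ, row, h]
  -- The pair `(1, A)` is isotropic for the skew form because `A` is Hermitian, and real 2 × 2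
  -- blocks of determinant one preserve that form. It is equivalent to `Q P⁻¹` being Hermitian.
  have hsymm : Pᴴ * Q = Qᴴ * P := by
    have hstar : ∀ d : Fin n → ℝ, (diagonal (fun i => (d i : ℂ)))ᴴ =
        diagonal (fun i => (d i : ℂ)) := by
      intro d
      rw [diagonal_conjTranspose]
      congr 1
      funext i
      simp
    rw [hPe, hQe, conjTranspose_add, conjTranspose_add, conjTranspose_mul, conjTranspose_mul,
      hstar, hstar, hstar, hstar, hA.eq]
    ext i j
    simp only [add_mul, mul_add, Matrix.add_apply, Matrix.mul_assoc]
    simp only [← Matrix.mul_assoc, Matrix.mul_diagonal, Matrix.diagonal_mul,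
      diagonal_mul_diagonal]
    have hdet := fun i => (γ.left i).2
    simp only [Matrix.det_fin_two] at hdet
    have hi : ((γ.left i 0 0 : ℝ) : ℂ) * ((γ.left i 1 1 : ℝ) : ℂ) -
        ((γ.left i 0 1 : ℝ) : ℂ) * ((γ.left i 1 0 : ℝ) : ℂ) = 1 := by exact_mod_cast hdet i
    have hj : ((γ.left j 0 0 : ℝ) : ℂ) * ((γ.left j 1 1 : ℝ) : ℂ) -
        ((γ.left j 0 1 : ℝ) : ℂ) * ((γ.left j 1 0 : ℝ) : ℂ) = 1 := by exact_mod_cast hdet j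
    have hd : ∀ x y : Fin n → ℂ, diagonal x i j * y j = diagonal y i j * x j := by
      intro x y
      by_cases h : i = j
      · subst h; simp [mul_comm]
      · simp [h]
    have hAA : ((A * diagonal fun i => ((γ.left i 1 0 : ℝ) : ℂ) * ((γ.left i 1 1 : ℝ) : ℂ)) * A) =
        ((A * diagonal fun i => ((γ.left i 1 1 : ℝ) : ℂ) * ((γ.left i 1 0 : ℝ) : ℂ)) * A) := by
      simp only [mul_comm]
    have hAA' := congrFun (congrFun hAA i) j
    have hD := hd (fun i => ((γ.left i 0 0 : ℝ) : ℂ)) (fun i => ((γ.left i 0 1 : ℝ) : ℂ))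
    linear_combination hAA' + hD + (A i j) * (hi - hj)
  have hLT : ∀ T : Finset (Fin n), (Matrix.of fun i => row i (if i ∈ T then 1 else 0)).det =
      P.det * pminor (Q * P⁻¹) T := by
    intro T
    rw [pminor_eq_det_rows, mul_comm, ← det_mul]
    congr 1
    ext i j
    rw [Matrix.mul_apply]
    by_cases h : i ∈ T
    · have : Q i j = ((Q * P⁻¹) * P) i j := by
        rw [Matrix.mul_assoc, Matrix.nonsing_inv_mul _ hPu, Matrix.mul_one]
      simp only [h, if_true, Matrix.of_apply]
      rw [← Matrix.mul_apply, ← this]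
      rfl
    · simp only [h, if_false, Matrix.of_apply]
      rw [← Matrix.mul_apply, Matrix.one_mul]
      rfl
  have hHerm : (Q * P⁻¹).IsHermitian := by
    have hPu' : IsUnit (Pᴴ).det := by
      rw [det_conjTranspose]; exact hPu.star
    rw [Matrix.IsHermitian, conjTranspose_mul, conjTranspose_nonsing_inv]
    have h1 : Qᴴ = Pᴴ * (Q * P⁻¹) := by
      rw [← Matrix.mul_assoc, hsymm, Matrix.mul_assoc, Matrix.mul_nonsing_inv _ hPu,
        Matrix.mul_one]
    rw [h1, ← Matrix.mul_assoc, Matrix.nonsing_inv_mul _ hPu', Matrix.one_mul]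
  refine ⟨(Q * P⁻¹).submatrix σ σ, hHerm.submatrix _, fun T => ?_⟩
  have hmem : ∀ i, σ⁻¹ i ∈ T ↔ i ∈ T.map σ.toEmbedding := by
    intro i
    rw [Finset.mem_map_equiv]
    rfl
  have hre : pminor ((Q * P⁻¹).submatrix σ σ) T = pminor (Q * P⁻¹) (T.map σ.toEmbedding) := by
    unfold pminor
    rw [← Matrix.det_submatrix_equiv_self (σ.subtypeEquiv
      (p := fun i => i ∈ T) (q := fun i => i ∈ T.map σ.toEmbedding) fun i => by simp)]
    rfl
  rw [key, hb, hre, mul_assoc, ← hLT]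
  simp only [hmem]

end PrincipalMinors

/-! ### Potentials on weighted digraphs and minimum mean cycles -/

namespace PrincipalMinors

open Finset Filter Topology

/-- The tension of a potential `d` on the complete digraph with weights `e`. -/
noncomputable def tension {ι : Type*} [Fintype ι] [Nonempty ι] (e : ι → ι → ℤ) (d : ι → ℝ) : ℝ :=
  (univ : Finset (ι × ι)).inf' univ_nonempty fun p => (e p.1 p.2 : ℝ) + d p.1 - d p.2

theorem tension_le {ι : Type*} [Fintype ι] [Nonempty ι] (e : ι → ι → ℤ) (d : ι → ℝ) (i j : ι) :
    tension e d ≤ e i j + d i - d j :=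
  Finset.inf'_le (fun p : ι × ι => (e p.1 p.2 : ℝ) + d p.1 - d p.2) (mem_univ (i, j))

theorem lt_tension {ι : Type*} [Fintype ι] [Nonempty ι] (e : ι → ι → ℤ) (d : ι → ℝ) {μ : ℝ}
    (h : ∀ i j, μ < e i j + d i - d j) : μ < tension e d := by
  rw [tension, Finset.lt_inf'_iff]
  exact fun p _ => h p.1 p.2

/-- Tension does not change when a constant is added to `d`, and potentials doing at least as well
as zero have differences bounded in terms of the weights, so the supremum is over a compact box. -/
theorem exists_max_tension {ι : Type*} [Fintype ι] [Nonempty ι] (e : ι → ι → ℤ) :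
    ∃ d, ∀ d', tension e d' ≤ tension e d := by
  classical
  have i₀ : ι := Classical.arbitrary ι
  have hcont : Continuous (tension e) := by
    refine Continuous.finset_inf'_apply _ fun p _ => ?_
    fun_prop
  set C : ℝ := ∑ i, ∑ j, |(e i j : ℝ)| with hC
  have hle : ∀ i j, |(e i j : ℝ)| ≤ C := by
    intro i j
    refine le_trans ?_ (Finset.single_le_sum (f := fun i => ∑ j, |(e i j : ℝ)|)
      (fun i _ => Finset.sum_nonneg fun j _ => abs_nonneg _) (mem_univ i))
    exact Finset.single_le_sum (f := fun j => |(e i j : ℝ)|) (fun j _ => abs_nonneg _) (mem_univ j)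
  have hC0 : 0 ≤ C := (abs_nonneg _).trans (hle i₀ i₀)
  have hK : IsCompact (Set.pi Set.univ fun _ : ι => Set.Icc (-(2 * C)) (2 * C)) :=
    isCompact_univ_pi fun _ => isCompact_Icc
  have h0 : (fun _ => 0 : ι → ℝ) ∈ Set.pi Set.univ fun _ : ι => Set.Icc (-(2 * C)) (2 * C) := by
    intro i _
    constructor <;> simp <;> linarith
  obtain ⟨d, hdK, hd⟩ := hK.exists_isMaxOn ⟨_, h0⟩ hcont.continuousOn
  refine ⟨d, fun d' => ?_⟩
  by_cases hlt : tension e d' ≤ tension e (fun _ => 0)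
  · exact hlt.trans (hd h0)
  push Not at hlt
  have hshift : tension e d' = tension e (fun i => d' i - d' i₀) := by
    unfold tension
    congr 1
    funext p
    ring
  rw [hshift]
  refine hd ?_
  have hμ : -C < tension e d' := by
    refine lt_of_le_of_lt ?_ hlt
    rw [tension, Finset.le_inf'_iff]
    intro p _
    have := hle p.1 p.2
    have := neg_abs_le (e p.1 p.2 : ℝ)
    linarith
  intro j _
  have h1 := tension_le e d' i₀ j
  have h2 := tension_le e d' j i₀
  have h3 := le_abs_self (e i₀ j : ℝ)
  have h4 := le_abs_self (e j i₀ : ℝ)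
  have h5 := hle i₀ j
  have h6 := hle j i₀
  constructor <;> simp only <;> linarith

/-- Otherwise the relation of tight edges is well-founded. Adding a small multiple of a height
function `h` that decreases along tight edges then makes every edge slack, which contradicts
maximality. -/
theorem exists_tight_set {ι : Type*} [Fintype ι] [Nonempty ι] (e : ι → ι → ℤ) {d : ι → ℝ}
    (hd : ∀ d', tension e d' ≤ tension e d) :
    ∃ S : Finset ι, S.Nonempty ∧ ∀ i ∈ S, ∃ j ∈ S, (e i j : ℝ) + d i - d j = tension e d := by
  classical
  by_contra! hcon
  let r : ι → ι → Prop := fun j i => (e i j : ℝ) + d i - d j = tension e d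
  have hwf : WellFounded r := by
    rw [WellFounded.wellFounded_iff_has_min]
    intro s hs
    obtain ⟨i, hi, h⟩ := hcon s.toFinite.toFinset (by simpa using hs)
    refine ⟨i, by simpa using hi, fun j hj => h j (by simpa using hj)⟩
  let h : ι → ℝ := fun i => ((univ.filter fun j => Relation.TransGen r j i).card : ℝ)
  have hh : ∀ i j, r j i → h j < h i := by
    intro i j hij
    simp only [h, Nat.cast_lt]
    refine Finset.card_lt_card ⟨fun k hk => ?_, fun hsub => ?_⟩
    · simp only [mem_filter, mem_univ, true_and] at hk ⊢
      exact hk.tail hij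
    · have : j ∈ univ.filter fun k => Relation.TransGen r k j :=
        hsub (by simpa using Relation.TransGen.single hij)
      simp only [mem_filter, mem_univ, true_and] at this
      exact hwf.transGen.irrefl.irrefl j this
  have hev : ∀ᶠ ε : ℝ in 𝓝[>] 0, ∀ i j,
      tension e d < e i j + (d i + ε * h i) - (d j + ε * h j) := by
    rw [eventually_all]; intro i
    rw [eventually_all]; intro j
    rcases (tension_le e d i j).lt_or_eq with hlt | heq
    · have hc : Continuous fun ε : ℝ => (e i j : ℝ) + (d i + ε * h i) - (d j + ε * h j) := by
        fun_prop
      have := (hc.tendsto 0).eventually (lt_mem_nhds (a := tension e d) (by simpa using hlt))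
      exact this.filter_mono nhdsWithin_le_nhds
    · filter_upwards [self_mem_nhdsWithin] with ε hε
      have h1 := hh i j heq.symm
      have : 0 < ε * (h i - h j) := mul_pos hε (by linarith)
      linarith
  obtain ⟨ε, hε⟩ := hev.exists
  exact absurd (hd fun i => d i + ε * h i) (not_le.2 (lt_tension e _ hε))

/-- In a minimal closed set every choice of successors is surjective, since its image is again
closed. A vertex with two successors would allow changing one value of a bijection, which destroys
injectivity. -/
theorem exists_unique_tight_perm {ι : Type*} [DecidableEq ι] (r : ι → ι → Prop)
    (h : ∃ S : Finset ι, S.Nonempty ∧ ∀ i ∈ S, ∃ j ∈ S, r i j) :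
    ∃ S : Finset ι, S.Nonempty ∧ ∃ f : Equiv.Perm S, (∀ i : S, r i (f i)) ∧
      ∀ i j : S, r i j → j = f i := by
  classical
  obtain ⟨S, ⟨hS, hout⟩, hmin⟩ := exists_minimalFor_of_wellFoundedLT
    (fun S : Finset ι => S.Nonempty ∧ ∀ i ∈ S, ∃ j ∈ S, r i j) Finset.card h
  have hsurj : ∀ g : S → S, (∀ i : S, r i (g i)) → Function.Bijective g := by
    intro g hg
    rw [← Finite.surjective_iff_bijective]
    by_contra hns
    have hne : (univ.image fun i => (g i : ι)).Nonempty := by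
      obtain ⟨i, hi⟩ := hS
      exact ⟨_, mem_image_of_mem _ (mem_univ (⟨i, hi⟩ : S))⟩
    have hsub : (univ.image fun i => (g i : ι)) ⊂ S := by
      refine ⟨fun x hx => ?_, fun hsub => hns fun y => ?_⟩
      · obtain ⟨i, _, rfl⟩ := mem_image.1 hx
        exact (g i).2
      · obtain ⟨i, _, hi⟩ := mem_image.1 (hsub y.2)
        exact ⟨i, Subtype.ext hi⟩
    have hlt := Finset.card_lt_card hsub
    refine absurd (hmin ⟨hne, fun x hx => ?_⟩ hlt.le) (not_le.2 hlt)
    obtain ⟨i, _, rfl⟩ := mem_image.1 hx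
    exact ⟨_, mem_image_of_mem _ (mem_univ (g i)), hg (g i)⟩
  choose f hf using fun i : S => (hout i i.2)
  let g : S → S := fun i => ⟨f i, (hf i).1⟩
  have hg : ∀ i : S, r i (g i) := fun i => (hf i).2
  have hgb := hsurj g hg
  refine ⟨S, hS, Equiv.ofBijective g hgb, hg, fun i j hij => ?_⟩
  change j = g i
  by_contra hne
  have hb := hsurj (Function.update g i j) fun k => by
    by_cases hk : k = i
    · subst hk; simpa using hij
    · simpa [hk] using hg k
  obtain ⟨k, hk⟩ := hb.2 (g i)
  by_cases hki : k = i
  · subst hki; simp at hk; exact hne hk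
  · rw [Function.update_of_ne hki] at hk
    exact hki (hgb.1 hk)

/-- Either a weighted complete digraph admits an integral potential, or there is a permutation of
negative weight of some set of vertices, lighter than all other permutations of that set. -/
theorem exists_potential_or_perm {ι : Type*} [Fintype ι] [DecidableEq ι] (e : ι → ι → ℤ)
    (he : ∀ i, 0 ≤ e i i) :
    (∃ d : ι → ℤ, ∀ i j, d j ≤ d i + e i j) ∨
    ∃ (S : Finset ι) (f : Equiv.Perm S), (∀ i, f i ≠ i) ∧ ∑ i : S, e i (f i) < 0 ∧
      ∀ σ : Equiv.Perm S, σ ≠ f → ∑ i : S, e i (f i) < ∑ i : S, e i (σ i) := by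
  classical
  rcases isEmpty_or_nonempty ι with hι | hι
  · exact Or.inl ⟨fun _ => 0, fun i => (hι.false i).elim⟩
  obtain ⟨d, hd⟩ := exists_max_tension e
  rcases le_or_gt 0 (tension e d) with h0 | h0
  · left
    -- Since the weights are integers, rounding down preserves the inequalities.
    refine ⟨fun i => ⌊d i⌋, fun i j => ?_⟩
    rw [← Int.floor_add_intCast]
    refine Int.floor_le_floor ?_
    have := tension_le e d i j
    linarith
  · right
    obtain ⟨S, hS, f, hf, huniq⟩ := exists_unique_tight_perm
      (fun i j => (e i j : ℝ) + d i - d j = tension e d) (exists_tight_set e hd)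
    -- The potential cancels along a permutation, so weights may be replaced by reduced weights,
    -- each at least the tension; `f` is the only permutation with equality everywhere.
    have hsum : ∀ σ : Equiv.Perm S, ((∑ i : S, e i (σ i) : ℤ) : ℝ) =
        ∑ i : S, ((e i (σ i) : ℝ) + d i - d (σ i)) := by
      intro σ
      rw [Finset.sum_sub_distrib, Finset.sum_add_distrib, Equiv.sum_comp σ fun i : S => d i]
      push_cast
      ring
    have hfs : ((∑ i : S, e i (f i) : ℤ) : ℝ) = ∑ i : S, tension e d := by
      rw [hsum]
      exact Finset.sum_congr rfl fun i _ => hf i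
    refine ⟨S, f, fun i hi => ?_, ?_, fun σ hσ => ?_⟩
    · have h1 := hf i
      rw [hi] at h1
      have : (0 : ℝ) ≤ e i i := by exact_mod_cast he i
      linarith
    · have : ((∑ i : S, e i (f i) : ℤ) : ℝ) < 0 := by
        rw [hfs]
        have : Nonempty S := hS.to_subtype
        exact Finset.sum_neg (fun _ _ => h0) univ_nonempty
      exact_mod_cast this
    · have : ((∑ i : S, e i (f i) : ℤ) : ℝ) < ((∑ i : S, e i (σ i) : ℤ) : ℝ) := by
        rw [hfs, hsum]
        obtain ⟨i, hi⟩ : ∃ i, σ i ≠ f i := by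
          by_contra! h
          exact hσ (Equiv.ext h)
        refine Finset.sum_lt_sum (fun i _ => tension_le e d i (σ i)) ⟨i, mem_univ i, ?_⟩
        exact lt_of_le_of_ne (tension_le e d i (σ i)) fun h => hi (huniq i (σ i) h.symm)
      exact_mod_cast this

end PrincipalMinors

/-! ### Local divisibility of the entries at a point -/

namespace PrincipalMinors

open Finset Polynomial

theorem rootMultiplicity_finset_prod {κ : Type*} (s : Finset κ) (p : κ → ℂ[X]) (z : ℂ)
    (hp : ∀ i ∈ s, p i ≠ 0) :
    rootMultiplicity z (∏ i ∈ s, p i) = ∑ i ∈ s, rootMultiplicity z (p i) := by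
  classical
  induction s using Finset.induction_on with
  | empty => simp [rootMultiplicity_eq_zero]
  | insert a s ha ih =>
    rw [prod_insert ha, sum_insert ha, rootMultiplicity_mul,
      ih fun i hi => hp i (mem_insert_of_mem hi)]
    exact mul_ne_zero (hp a (mem_insert_self a s))
      (prod_ne_zero_iff.2 fun i hi => hp i (mem_insert_of_mem hi))

/-- If the principal minors of a polynomial matrix `N` are divisible by the products of the `m j`,
then so are, locally at `z`, all entries of `N`, after a diagonal change of gauge `d`. -/
theorem exists_gauge_potential {ι : Type*} [Fintype ι] [DecidableEq ι] {V : Finset ι}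
    {N : Matrix ι ι ℂ[X]} {m : ι → ℂ[X]} {adj : ι → ι → Prop} {o : ι → ι}
    (hm : ∀ j, m j ≠ 0) (hN : ∀ S ⊆ V, (∏ j ∈ S, m j) ∣ pminor N S)
    (hadj : ∀ j k, j ≠ k → adj j k → N j k ≠ 0 ∧ j ∈ V ∧ k ∈ V)
    (hnon : ∀ j ∈ V, ∀ k ∈ V, j ≠ k → ¬ adj j k → N j k = 0)
    (hoadj : ∀ j k, adj j k → o j = o k) (hom : ∀ j, m (o j) = 1)
    (ho : ∀ j ∈ V, j ≠ o j → adj j (o j) ∧ adj (o j) j ∧ N j (o j) = m j ∧ N (o j) j = m j)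
    (z : ℂ) :
    ∃ d : ι → ℕ, (∀ j ∈ V, d j ≤ rootMultiplicity z (m j)) ∧
      ∀ j k, j ≠ k → adj j k →
        rootMultiplicity z (m j) + d k ≤ d j + rootMultiplicity z (N j k) := by
  classical
  set v : ι → ι → ℤ := fun j k => (rootMultiplicity z (N j k) : ℤ) - rootMultiplicity z (m j)
    with hv
  -- The weight of non-adjacent pairs exceeds the sum of all `|v j k|`, so that no permutation of
  -- negative weight can use such a pair.
  set K : ℤ := 1 + ∑ j, ∑ k, |v j k| with hK
  set e : ι → ι → ℤ := fun j k => if j = k then 0 else if adj j k then v j k else K with he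
  have hK0 : 0 ≤ ∑ j, ∑ k, |v j k| :=
    Finset.sum_nonneg fun j _ => Finset.sum_nonneg fun k _ => abs_nonneg _
  rcases exists_potential_or_perm e (by simp [he]) with ⟨d, hd⟩ | ⟨S, f, hfix, hneg, hlt⟩
  · have hd' : ∀ j k, j ≠ k → adj j k → d k ≤ d j + v j k := by
      intro j k hjk h
      have := hd j k
      simpa [he, hjk, h] using this
    have hm0 : ∀ j, rootMultiplicity z (m (o j)) = 0 := by
      intro j
      rw [hom]
      simp [rootMultiplicity_eq_zero]
    -- Normalising the potential to vanish at the representative `o j` gives the required bounds: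
    -- the edges between `j` and `o j` both carry the entry `m j`, and `m (o j) = 1`.
    have hpos : ∀ j ∈ V, 0 ≤ d j - d (o j) ∧ d j - d (o j) ≤ rootMultiplicity z (m j) := by
      intro j hj
      by_cases hjo : j = o j
      · rw [← hjo]; simp
      · obtain ⟨h1, h2, h3, h4⟩ := ho j hj hjo
        have h5 := hd' _ _ hjo h1
        have h6 := hd' _ _ (Ne.symm hjo) h2
        simp only [hv, h3, h4, hm0] at h5 h6
        constructor
        · linarith
        · push_cast at h6
          linarith
    refine ⟨fun j => (d j - d (o j)).toNat, fun j hj => ?_, fun j k hjk h => ?_⟩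
    · have := hpos j hj
      simp only
      omega
    · obtain ⟨_, hj, hk⟩ := hadj j k hjk h
      have h1 := hpos j hj
      have h2 := hpos k hk
      have h3 := hd' j k hjk h
      have h4 := hoadj j k h
      rw [h4] at h1
      simp only [hv] at h3
      simp only [h4]
      omega
  · exfalso
    have hfadj : ∀ i : S, adj i (f i) := by
      by_contra! hcon
      obtain ⟨i₀, hi₀⟩ := hcon
      have hne : (i₀ : ι) ≠ f i₀ := fun h => hfix i₀ (Subtype.ext h.symm)
      have h1 : e i₀ (f i₀) = K := by simp [he, hne, hi₀]
      have h2 : ∀ i : S, -|v i (f i)| ≤ e i (f i) := by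
        intro i
        simp only [he]
        split_ifs
        · have := abs_nonneg (v i (f i)); linarith
        · exact neg_abs_le _
        · have := abs_nonneg (v i (f i)); linarith
      have h3 : ∑ i : S, |v i (f i)| ≤ ∑ j, ∑ k, |v j k| := by
        rw [Finset.sum_coe_sort_eq_attach, ]
        calc ∑ i ∈ S.attach, |v i (f i)| ≤ ∑ i ∈ S.attach, ∑ k, |v i k| :=
              Finset.sum_le_sum fun i _ => Finset.single_le_sum (f := fun k => |v i k|)
                (fun k _ => abs_nonneg _) (mem_univ _)
          _ = ∑ i ∈ S, ∑ k, |v i k| := Finset.sum_attach S fun i => ∑ k, |v i k|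
          _ ≤ _ := Finset.sum_le_sum_of_subset_of_nonneg (subset_univ _)
              fun i _ _ => Finset.sum_nonneg fun k _ => abs_nonneg _
      have h4 : ∑ i : S, (e i (f i) + |v i (f i)|) ≥ e i₀ (f i₀) + |v i₀ (f i₀)| :=
        Finset.single_le_sum (f := fun i : S => e i (f i) + |v i (f i)|)
          (fun i _ => by have := h2 i; linarith) (mem_univ i₀)
      rw [Finset.sum_add_distrib] at h4
      have := abs_nonneg (v i₀ (f i₀))
      linarith
    have hne : ∀ i : S, (i : ι) ≠ f i := fun i h => hfix i (Subtype.ext h.symm)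
    have hSV : S ⊆ V := fun i hi => (hadj _ _ (hne ⟨i, hi⟩) (hfadj ⟨i, hi⟩)).2.1
    set k₀ : ℕ := ∑ i : S, rootMultiplicity z (N i (f i)) with hk₀
    set M : ℕ := ∑ i : S, rootMultiplicity z (m i) with hM
    have hef : ∑ i : S, e i (f i) = (k₀ : ℤ) - M := by
      rw [hk₀, hM]
      push_cast
      rw [← Finset.sum_sub_distrib]
      refine Finset.sum_congr rfl fun i _ => ?_
      simp [he, hne i, hfadj i, hv]
    -- Negative weight means that the term of `f` vanishes to order `k₀` smaller than the order of
    -- `∏ m i`, whereas the minor is divisible by that product.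
    have hdvdm : (X - C z) ^ (k₀ + 1) ∣ pminor N S := by
      refine dvd_trans ?_ (hN S hSV)
      rw [← Finset.prod_coe_sort, ← le_rootMultiplicity_iff (p := ∏ i : S, m i)
        (prod_ne_zero_iff.2 fun i _ => hm i), rootMultiplicity_finset_prod univ
        (fun i : S => m i) z (fun i _ => hm i)]
      rw [hef] at hneg
      omega
    -- The other Leibniz terms vanish to order above `k₀`, because `f` is strictly lightest. A fixed
    -- point `i` contributes at least the order of `m i`, by the divisibility of the 1 × 1 minor,
    -- which is why diagonal edges have weight zero.
    have hother : ∀ σ : Equiv.Perm S, σ ≠ f → (X - C z) ^ (k₀ + 1) ∣ ∏ i : S, N i (σ i) := by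
      intro σ hσ
      by_cases hz : ∃ i : S, (i : ι) ≠ σ i ∧ ¬ adj i (σ i)
      · obtain ⟨i, h1, h2⟩ := hz
        rw [Finset.prod_eq_zero (mem_univ i) (hnon _ (hSV i.2) _ (hSV (σ i).2) h1 h2)]
        exact dvd_zero _
      push Not at hz
      let w : S → ℕ := fun i => if (i : ι) = σ i then rootMultiplicity z (m i)
        else rootMultiplicity z (N i (σ i))
      have hw : (∑ i, (w i : ℤ)) - M = ∑ i : S, e i (σ i) := by
        rw [hM]
        push_cast
        rw [← Finset.sum_sub_distrib]
        refine Finset.sum_congr rfl fun i _ => ?_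
        by_cases h : (i : ι) = σ i
        · rw [show w i = _ from if_pos h]
          simp [he, ← h]
        · rw [show w i = _ from if_neg h]
          simp [he, h, hz i h, hv]
      have hk : k₀ + 1 ≤ ∑ i, w i := by
        have := hlt σ hσ
        rw [← hw, hef] at this
        have h' : (k₀ : ℤ) < ∑ i, (w i : ℤ) := by linarith
        exact_mod_cast h'
      refine (pow_dvd_pow _ hk).trans ?_
      rw [← Finset.prod_pow_eq_pow_sum]
      refine Finset.prod_dvd_prod_of_dvd _ _ fun i _ => ?_
      by_cases h : (i : ι) = σ i
      · simp only [w, ← h, if_true]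
        refine (pow_rootMultiplicity_dvd _ _).trans ?_
        have := hN {(i : ι)} (by simpa using hSV i.2)
        rw [prod_singleton] at this
        refine this.trans (dvd_of_eq ?_)
        simp [pminor, Matrix.det_unique]
      · simp only [w, h, if_false]
        exact pow_rootMultiplicity_dvd _ _
    -- Hence the term of `f` alone would have to vanish to order `k₀ + 1`, although its order is
    -- exactly `k₀`.
    have hfdvd : (X - C z) ^ (k₀ + 1) ∣ ∏ i : S, N i (f i) := by
      rw [pminor, ← Matrix.det_transpose, Matrix.det_apply,
        ← Finset.add_sum_erase _ _ (mem_univ f)] at hdvdm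
      have h1 := (dvd_add_left (Finset.dvd_sum fun σ hσ => ?_)).1 hdvdm
      · simp only [Matrix.transpose_apply, Matrix.submatrix_apply] at h1
        rcases Int.units_eq_one_or (Equiv.Perm.sign f) with h | h <;> rw [h] at h1 <;>
          simpa using h1
      · have h2 := hother σ (ne_of_mem_erase hσ)
        simp only [Matrix.transpose_apply, Matrix.submatrix_apply]
        rcases Int.units_eq_one_or (Equiv.Perm.sign σ) with h | h <;> rw [h] <;>
          simpa using h2
    have hNne : ∀ i ∈ (univ : Finset S), N i (f i) ≠ 0 :=
      fun i _ => (hadj _ _ (hne i) (hfadj i)).1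
    rw [← le_rootMultiplicity_iff (prod_ne_zero_iff.2 hNne),
      rootMultiplicity_finset_prod univ (fun i : S => N i (f i)) z hNne] at hfdvd
    omega

end PrincipalMinors

/-! ### Factorisation of Hermitian polynomial matrices -/

namespace PrincipalMinors

open Finset Polynomial Filter Topology

/-- Complex conjugation of the coefficients of a polynomial. -/
noncomputable def conjPoly (p : ℂ[X]) : ℂ[X] := p.map (starRingEnd ℂ)

/-- A real polynomial regarded as a complex one. -/
noncomputable def ofRealPoly (p : ℝ[X]) : ℂ[X] := p.map Complex.ofRealHom

theorem conjPoly_conjPoly (p : ℂ[X]) : conjPoly (conjPoly p) = p := by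
  ext n; simp [conjPoly]

theorem conjPoly_mul (p q : ℂ[X]) : conjPoly (p * q) = conjPoly p * conjPoly q := by
  simp [conjPoly]

theorem conjPoly_ofRealPoly (p : ℝ[X]) : conjPoly (ofRealPoly p) = ofRealPoly p := by
  ext n; simp [conjPoly, ofRealPoly]

theorem conjPoly_eq_zero {p : ℂ[X]} : conjPoly p = 0 ↔ p = 0 :=
  Polynomial.map_eq_zero_iff (starRingEnd ℂ).injective

theorem rootMultiplicity_conjPoly (p : ℂ[X]) (z : ℂ) :
    rootMultiplicity z (conjPoly p) = rootMultiplicity ((starRingEnd ℂ) z) p := by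
  rw [eq_rootMultiplicity_map (starRingEnd ℂ).injective]
  exact congrArg _ (conjPoly_conjPoly p)

theorem eval_conjPoly_ofReal (p : ℂ[X]) (t : ℝ) :
    (conjPoly p).eval (t : ℂ) = (starRingEnd ℂ) (p.eval (t : ℂ)) := by
  have h := Polynomial.eval_map_apply (f := starRingEnd ℂ) (p := p) (t : ℂ)
  rw [Complex.conj_ofReal] at h
  exact h

theorem eval_ofRealPoly (p : ℝ[X]) (t : ℝ) :
    (ofRealPoly p).eval (t : ℂ) = ((p.eval t : ℝ) : ℂ) :=
  Polynomial.eval_map_apply (f := Complex.ofRealHom) (p := p) t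

theorem ofRealPoly_eq_zero {p : ℝ[X]} : ofRealPoly p = 0 ↔ p = 0 :=
  Polynomial.map_eq_zero_iff Complex.ofRealHom.injective

/-- At a root of odd order the sign would change, as seen by comparing one-sided limits of the
cofactor. -/
theorem even_rootMultiplicity_of_nonneg {p : ℝ[X]} (hp : ∀ t, 0 ≤ p.eval t) (r : ℝ) :
    Even (rootMultiplicity r p) := by
  by_cases h0 : p = 0
  · simp [h0]
  obtain ⟨q, hq, hqr⟩ := exists_eq_pow_rootMultiplicity_mul_and_not_dvd p h0 r
  rw [dvd_iff_isRoot, IsRoot.def] at hqr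
  by_contra hodd
  rw [Nat.not_even_iff_odd] at hodd
  have hev : ∀ x : ℝ, 0 ≤ x ^ rootMultiplicity r p * q.eval (r + x) := by
    intro x
    have := hp (r + x)
    rw [hq] at this
    simpa using this
  have hc : Continuous fun x : ℝ => q.eval (r + x) := by
    exact q.continuous.comp (by fun_prop)
  have h1 : 0 ≤ q.eval r := by
    refine ge_of_tendsto (x := 𝓝[>] (0 : ℝ)) (f := fun x : ℝ => q.eval (r + x)) ?_ ?_
    · have := hc.tendsto 0
      simp only [add_zero] at this
      exact this.mono_left nhdsWithin_le_nhds
    · filter_upwards [self_mem_nhdsWithin] with x hx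
      exact nonneg_of_mul_nonneg_right (hev x) (pow_pos hx _)
  have h2 : q.eval r ≤ 0 := by
    refine le_of_tendsto (x := 𝓝[<] (0 : ℝ)) (f := fun x : ℝ => q.eval (r + x)) ?_ ?_
    · have := hc.tendsto 0
      simp only [add_zero] at this
      exact this.mono_left nhdsWithin_le_nhds
    · filter_upwards [self_mem_nhdsWithin] with x hx
      have h3 := hev x
      have h4 : x ^ rootMultiplicity r p < 0 := hodd.pow_neg hx
      by_contra! h5
      nlinarith
  exact hqr (le_antisymm h2 h1)

theorem rootMultiplicity_prod_X_sub_C_pow (s : Finset ℂ) (g : ℂ → ℕ) (hg : ∀ z, z ∉ s → g z = 0)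
    (z : ℂ) : rootMultiplicity z (∏ w ∈ s, (X - C w) ^ g w) = g z := by
  classical
  rw [rootMultiplicity_finset_prod _ _ _ fun w _ => pow_ne_zero _ (X_sub_C_ne_zero w)]
  have h1 : ∀ w, rootMultiplicity z ((X - C w) ^ g w) = if w = z then g z else 0 := by
    intro w
    by_cases h : w = z
    · subst h; simp [rootMultiplicity_X_sub_C_pow]
    · rw [if_neg h, rootMultiplicity_eq_zero]
      simp only [IsRoot.def, eval_pow, eval_sub, eval_X, eval_C]
      exact pow_ne_zero _ (sub_ne_zero.2 (Ne.symm h))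
  simp_rw [h1, Finset.sum_ite_eq']
  split_ifs with h
  · rfl
  · exact (hg z h).symm

theorem dvd_of_rootMultiplicity_le {p q : ℂ[X]} (hp : p ≠ 0) (hq : q ≠ 0)
    (h : ∀ z, rootMultiplicity z p ≤ rootMultiplicity z q) : p ∣ q := by
  classical
  rw [IsAlgClosed.dvd_iff_roots_le_roots hp hq, Multiset.le_iff_count]
  simpa using h

/-- A Hermitian polynomial matrix `N` with the divisibility properties of a matrix of the form
`G β Gᴴ` is of this form. -/
theorem exists_hermitian_gauge {ι : Type*} [Fintype ι] [DecidableEq ι] {V : Finset ι}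
    {N : Matrix ι ι ℂ[X]} {m : ι → ℝ[X]} {adj : ι → ι → Prop} {o : ι → ι}
    (hm : ∀ j, m j ≠ 0) (hmnn : ∀ j t, 0 ≤ (m j).eval t)
    (hherm : ∀ j ∈ V, ∀ k ∈ V, conjPoly (N j k) = N k j)
    (hN : ∀ S ⊆ V, (∏ j ∈ S, ofRealPoly (m j)) ∣ pminor N S)
    (hadj : ∀ j k, j ≠ k → adj j k → N j k ≠ 0 ∧ j ∈ V ∧ k ∈ V)
    (hsymm : ∀ j k, adj j k → adj k j)
    (hnon : ∀ j ∈ V, ∀ k ∈ V, j ≠ k → ¬ adj j k → N j k = 0)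
    (hoadj : ∀ j k, adj j k → o j = o k) (hom : ∀ j, m (o j) = 1)
    (ho : ∀ j ∈ V, j ≠ o j →
      adj j (o j) ∧ N j (o j) = ofRealPoly (m j) ∧ N (o j) j = ofRealPoly (m j)) :
    ∃ (G : ι → ℂ[X]) (β : Matrix ι ι ℂ[X]),
      (∀ j ∈ V, G j * conjPoly (G j) = ofRealPoly (m j)) ∧
      ∀ j ∈ V, ∀ k ∈ V, N j k = G j * conjPoly (G k) * β j k := by
  classical
  have hm' : ∀ j, ofRealPoly (m j) ≠ 0 := fun j => ofRealPoly_eq_zero.not.2 (hm j)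
  choose D hDle hD using fun z => exists_gauge_potential (z := z) hm' hN hadj hnon hoadj
    (fun j => by rw [hom]; simp [ofRealPoly])
    (fun j hj h => ⟨(ho j hj h).1, hsymm _ _ (ho j hj h).1, (ho j hj h).2⟩)
  set M : ι → ℂ → ℕ := fun j z => rootMultiplicity z (ofRealPoly (m j)) with hM
  have hMconj : ∀ j z, M j ((starRingEnd ℂ) z) = M j z := by
    intro j z
    simp only [hM]
    rw [← rootMultiplicity_conjPoly, conjPoly_ofRealPoly]
  -- The prescribed vanishing order of `G j` at `z`. The local potential is chosen in the upper half
  -- plane and transported by conjugation to the lower one, so that orders at `z` and its conjugate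
  -- add up to that of `m j`; at real points the order of `m j` is halved.
  set g : ι → ℂ → ℕ := fun j z => if 0 < z.im then M j z - D z j
    else if z.im < 0 then D ((starRingEnd ℂ) z) j else M j z / 2 with hg
  have hgle : ∀ j ∈ V, ∀ z, g j z ≤ M j z := by
    intro j hj z
    simp only [hg]
    split_ifs with h1 h2
    · omega
    · rw [← hMconj]; exact hDle _ j hj
    · omega
  have hgadd : ∀ j ∈ V, ∀ z, g j z + g j ((starRingEnd ℂ) z) = M j z := by
    intro j hj z
    have h3 := hDle z j hj
    have h4 := hDle ((starRingEnd ℂ) z) j hj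
    have h5 := hMconj j z
    simp only [hg, Complex.conj_im, Complex.conj_conj]
    rcases lt_trichotomy z.im 0 with h | h | h
    · rw [if_neg (by linarith), if_pos h, if_pos (by linarith), h5]
      change D _ j ≤ M j _ at h4
      omega
    · have hz : ((z.re : ℝ) : ℂ) = z := Complex.ext (by simp) (by simp [h])
      have hev : Even (M j z) := by
        rw [← hz]
        have := even_rootMultiplicity_of_nonneg (hmnn j) z.re
        rw [eq_rootMultiplicity_map Complex.ofRealHom.injective] at this
        exact this
      rw [if_neg (by linarith), if_neg (by linarith), if_neg (by linarith), if_neg (by linarith),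
        h5]
      obtain ⟨c, hc⟩ := hev
      omega
    · rw [if_pos h, if_neg (by linarith), if_pos (by linarith)]
      change D _ j ≤ M j _ at h3
      omega
  have hgN : ∀ j k, j ≠ k → adj j k → ∀ z,
      g j z + g k ((starRingEnd ℂ) z) ≤ rootMultiplicity z (N j k) := by
    intro j k hjk h z
    obtain ⟨_, hj, hk⟩ := hadj j k hjk h
    have hv : rootMultiplicity ((starRingEnd ℂ) z) (N k j) = rootMultiplicity z (N j k) := by
      rw [← rootMultiplicity_conjPoly, hherm k hk j hj]
    have h1 := hD z j k hjk h
    have h2 := hD ((starRingEnd ℂ) z) k j hjk.symm (hsymm j k h)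
    have h2' := hD z k j hjk.symm (hsymm j k h)
    have h3 := hDle z j hj
    have h4 := hDle ((starRingEnd ℂ) z) k hk
    change M j z + _ ≤ _ at h1
    change M k _ + _ ≤ _ at h2
    change M k z + _ ≤ _ at h2'
    change _ ≤ M j z at h3
    change _ ≤ M k _ at h4
    rw [hv] at h2
    have h5 := hMconj k z
    simp only [hg, Complex.conj_im, Complex.conj_conj]
    rcases lt_trichotomy z.im 0 with h' | h' | h'
    · rw [if_neg (by linarith), if_pos h', if_pos (by linarith)]
      omega
    · have hz : (starRingEnd ℂ) z = z := Complex.conj_eq_iff_im.2 h'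
      rw [if_neg (by linarith), if_neg (by linarith), if_neg (by linarith), if_neg (by linarith),
        h5]
      rw [hz] at hv
      omega
    · rw [if_pos h', if_neg (by linarith), if_pos (by linarith)]
      omega
  set G₀ : ι → ℂ[X] := fun j =>
    ∏ w ∈ (ofRealPoly (m j)).roots.toFinset, (X - C w) ^ g j w with hG₀
  have hG₀ne : ∀ j, G₀ j ≠ 0 := fun j =>
    prod_ne_zero_iff.2 fun w _ => pow_ne_zero _ (X_sub_C_ne_zero w)
  have hvG : ∀ j ∈ V, ∀ z, rootMultiplicity z (G₀ j) = g j z := by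
    intro j hj z
    refine rootMultiplicity_prod_X_sub_C_pow _ _ (fun w hw => ?_) z
    have : M j w = 0 := by
      simp only [Multiset.mem_toFinset, mem_roots (hm' j)] at hw
      exact rootMultiplicity_eq_zero hw
    have := hgle j hj w
    omega
  -- Equality of all vanishing orders leaves a constant. It is positive, as evaluation at a real
  -- point with `m j` nonzero compares a positive number with a squared modulus.
  have hκ : ∀ j ∈ V, ∃ κ : ℝ, 0 < κ ∧
      ofRealPoly (m j) = C (κ : ℂ) * (G₀ j * conjPoly (G₀ j)) := by
    intro j hj
    have hne : G₀ j * conjPoly (G₀ j) ≠ 0 :=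
      mul_ne_zero (hG₀ne j) (conjPoly_eq_zero.not.2 (hG₀ne j))
    have hass : Associated (G₀ j * conjPoly (G₀ j)) (ofRealPoly (m j)) := by
      rw [IsAlgClosed.associated_iff_roots_eq_roots hne (hm' j)]
      ext z
      rw [count_roots, count_roots, rootMultiplicity_mul hne, rootMultiplicity_conjPoly,
        hvG j hj, hvG j hj]
      exact hgadd j hj z
    obtain ⟨u, hu⟩ := hass
    obtain ⟨c, hc, huc⟩ := Polynomial.isUnit_iff.1 u.isUnit
    rw [← huc] at hu
    obtain ⟨t, ht⟩ : ∃ t : ℝ, (m j).eval t ≠ 0 := by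
      by_contra! h
      exact hm j (Polynomial.funext fun t => by simp [h t])
    have he : (((m j).eval t : ℝ) : ℂ) = ((Complex.normSq ((G₀ j).eval (t : ℂ)) : ℝ) : ℂ) * c := by
      rw [← eval_ofRealPoly, ← hu, eval_mul, eval_mul, eval_conjPoly_ofReal, Complex.mul_conj,
        eval_C]
    have hpos : 0 < (m j).eval t := lt_of_le_of_ne (hmnn j t) ht.symm
    have hns : Complex.normSq ((G₀ j).eval (t : ℂ)) ≠ 0 := by
      intro h
      rw [h] at he
      simp at he
      exact ht he
    have hns' : 0 < Complex.normSq ((G₀ j).eval (t : ℂ)) :=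
      lt_of_le_of_ne (Complex.normSq_nonneg _) hns.symm
    refine ⟨(m j).eval t / Complex.normSq ((G₀ j).eval (t : ℂ)), div_pos hpos hns', ?_⟩
    rw [← hu, mul_comm]
    congr 2
    push_cast
    rw [he]
    field_simp [show ((Complex.normSq ((G₀ j).eval (t : ℂ)) : ℝ) : ℂ) ≠ 0 by exact_mod_cast hns]
  choose! κ hκpos hκ using hκ
  set G : ι → ℂ[X] := fun j => C ((Real.sqrt (κ j) : ℝ) : ℂ) * G₀ j with hG
  have hsq : ∀ j ∈ V, ((Real.sqrt (κ j) : ℝ) : ℂ) ≠ 0 := fun j hj => by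
    exact_mod_cast (Real.sqrt_pos.2 (hκpos j hj)).ne'
  have hGne : ∀ j ∈ V, G j ≠ 0 := fun j hj => mul_ne_zero (C_ne_zero.2 (hsq j hj)) (hG₀ne j)
  have hGv : ∀ j ∈ V, ∀ z, rootMultiplicity z (G j) = g j z := by
    intro j hj z
    rw [hG]
    simp only
    rw [rootMultiplicity_mul (hGne j hj), rootMultiplicity_C, zero_add, hvG j hj]
  have hGG : ∀ j ∈ V, G j * conjPoly (G j) = ofRealPoly (m j) := by
    intro j hj
    rw [hκ j hj, hG]
    simp only
    rw [conjPoly_mul, show conjPoly (C ((Real.sqrt (κ j) : ℝ) : ℂ)) = C ((Real.sqrt (κ j) : ℝ) : ℂ)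
      by simp [conjPoly]]
    have : C ((Real.sqrt (κ j) : ℝ) : ℂ) * C ((Real.sqrt (κ j) : ℝ) : ℂ) = C ((κ j : ℝ) : ℂ) := by
      rw [← C_mul, ← Complex.ofReal_mul, Real.mul_self_sqrt (hκpos j hj).le]
    rw [← this]
    ring
  have hdvd : ∀ j ∈ V, ∀ k ∈ V, G j * conjPoly (G k) ∣ N j k := by
    intro j hj k hk
    by_cases hjk : j = k
    · subst hjk
      rw [hGG j hj]
      have := hN {j} (by simpa using hj)
      rw [prod_singleton] at this
      exact this.trans (dvd_of_eq (by simp [pminor, Matrix.det_unique]))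
    · by_cases ha : adj j k
      · have hne : G j * conjPoly (G k) ≠ 0 :=
          mul_ne_zero (hGne j hj) (conjPoly_eq_zero.not.2 (hGne k hk))
        refine dvd_of_rootMultiplicity_le hne (hadj j k hjk ha).1 fun z => ?_
        rw [rootMultiplicity_mul hne, rootMultiplicity_conjPoly, hGv j hj, hGv k hk]
        exact hgN j k hjk ha z
      · rw [hnon j hj k hk hjk ha]
        exact dvd_zero _
  choose! β hβ using hdvd
  exact ⟨G, β, hGG, hβ⟩

end PrincipalMinors

/-! ### Principal minors of size at most three -/

namespace PrincipalMinors

open Finset Polynomial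

section Minors

variable {ι R : Type*} [DecidableEq ι] [CommRing R]

theorem pminor_eq_det_of_equiv {κ : Type*} [Fintype κ] [DecidableEq κ] (A : Matrix ι ι R)
    {S : Finset ι} (e : κ ≃ S) :
    pminor A S = (A.submatrix (fun i => (e i : ι)) (fun i => (e i : ι))).det :=
  (Matrix.det_submatrix_equiv_self e _).symm

theorem pminor_image {κ : Type*} [Fintype κ] [DecidableEq κ] (A : Matrix ι ι R) (f : κ → ι)
    (hf : Function.Injective f) : pminor A (univ.image f) = (A.submatrix f f).det :=
  pminor_eq_det_of_equiv A (Equiv.ofBijective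
    (fun i : κ => (⟨f i, mem_image_of_mem f (mem_univ i)⟩ : univ.image f))
    ⟨fun i j h => hf (congrArg Subtype.val h), fun ⟨x, hx⟩ => by
      obtain ⟨i, _, rfl⟩ := mem_image.1 hx
      exact ⟨i, rfl⟩⟩)

theorem pminor_singleton (A : Matrix ι ι R) (i : ι) : pminor A {i} = A i i := by
  simp [pminor, Matrix.det_unique]

theorem pminor_empty (A : Matrix ι ι R) : pminor A ∅ = 1 := by
  simp [pminor]

theorem pminor_pair (A : Matrix ι ι R) {i j : ι} (h : i ≠ j) :
    pminor A {i, j} = A i i * A j j - A i j * A j i := by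
  have h1 : ({i, j} : Finset ι) = univ.image ![i, j] := by
    ext x; simp [Fin.exists_fin_two, eq_comm]
  rw [h1, pminor_image _ _ (by
    intro x y hxy
    fin_cases x <;> fin_cases y <;> simp_all)]
  rw [Matrix.det_fin_two]
  rfl

theorem pminor_triple (A : Matrix ι ι R) {i j k : ι} (hij : i ≠ j) (hjk : j ≠ k) (hik : i ≠ k) :
    pminor A {i, j, k} = A i i * A j j * A k k - A i i * (A j k * A k j) - A j j * (A i k * A k i)
      - A k k * (A i j * A j i) + A i j * A j k * A k i + A i k * A k j * A j i := by
  have h1 : ({i, j, k} : Finset ι) = univ.image ![i, j, k] := by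
    ext x; simp [Fin.exists_fin_succ, eq_comm]
  rw [h1, pminor_image _ _ (by
    intro x y hxy
    fin_cases x <;> fin_cases y <;> simp_all)]
  rw [Matrix.det_fin_three]
  change A i i * A j j * A k k - A i i * A j k * A k j - A i j * A j i * A k k
    + A i j * A j k * A k i + A i k * A j i * A k j - A i k * A j j * A k i = _
  ring

theorem map_pminor {R' : Type*} [CommRing R'] (f : R →+* R') (A : Matrix ι ι R) (S : Finset ι) :
    f (pminor A S) = pminor (A.map f) S := by
  rw [pminor, RingHom.map_det]
  rfl

theorem pminor_congr {A B : Matrix ι ι R} {S : Finset ι} (h : ∀ j ∈ S, ∀ k ∈ S, A j k = B j k) :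
    pminor A S = pminor B S := by
  unfold pminor
  congr 1
  ext j k
  exact h j j.2 k k.2

theorem pminor_of_gauge {A B : Matrix ι ι R} {S : Finset ι} {x y : ι → R}
    (h : ∀ j ∈ S, ∀ k ∈ S, A j k = x j * y k * B j k) :
    pminor A S = (∏ j ∈ S, x j * y j) * pminor B S := by
  unfold pminor
  have h1 : A.submatrix (fun i : S => (i : ι)) (fun i : S => (i : ι)) =
      Matrix.of fun i j : S => x i * (Matrix.of fun i j : S => y j *
        B.submatrix (fun i : S => (i : ι)) (fun i : S => (i : ι)) i j) i j := by
    ext j k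
    simp [h j j.2 k k.2, mul_assoc]
  rw [h1, Matrix.det_mul_column, Matrix.det_mul_row, ← mul_assoc, ← Finset.prod_mul_distrib,
    Finset.prod_coe_sort S fun j => x j * y j]

/-- The product of the two entries `(i, j)` and `(j, i)` in terms of principal minors. -/
def pairDefect (a : Finset ι → R) (i j : ι) : R := a {i} * a {j} - a {i, j}

/-- The sum of the two products along the `3`-cycles on `i, j, k` in terms of principal minors. -/
def tripleDefect (a : Finset ι → R) (i j k : ι) : R :=
  a {i, j, k} - a {i} * a {j} * a {k} + a {i} * pairDefect a j k + a {j} * pairDefect a i k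
    + a {k} * pairDefect a i j

theorem pairDefect_comm (a : Finset ι → R) (i j : ι) : pairDefect a i j = pairDefect a j i := by
  rw [pairDefect, pairDefect, mul_comm, pair_comm]

theorem pairDefect_pminor (A : Matrix ι ι R) {i j : ι} (h : i ≠ j) :
    pairDefect (pminor A) i j = A i j * A j i := by
  rw [pairDefect, pminor_singleton, pminor_singleton, pminor_pair A h]
  ring

theorem tripleDefect_pminor (A : Matrix ι ι R) {i j k : ι} (hij : i ≠ j) (hjk : j ≠ k)
    (hik : i ≠ k) :
    tripleDefect (pminor A) i j k = A i j * A j k * A k i + A i k * A k j * A j i := by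
  rw [tripleDefect, pairDefect_pminor A hij, pairDefect_pminor A hjk, pairDefect_pminor A hik,
    pminor_singleton, pminor_singleton, pminor_singleton, pminor_triple A hij hjk hik]
  ring

theorem map_pairDefect {R' : Type*} [CommRing R'] (f : R →+* R') (a : Finset ι → R) (i j : ι) :
    f (pairDefect a i j) = pairDefect (fun S => f (a S)) i j := by
  simp [pairDefect]

theorem map_tripleDefect {R' : Type*} [CommRing R'] (f : R →+* R') (a : Finset ι → R)
    (i j k : ι) : f (tripleDefect a i j k) = tripleDefect (fun S => f (a S)) i j k := by
  simp [tripleDefect, map_pairDefect]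

theorem pairDefect_congr {a b : Finset ι → R} {V : Finset ι} (h : ∀ S ⊆ V, a S = b S) {i j : ι}
    (hi : i ∈ V) (hj : j ∈ V) : pairDefect a i j = pairDefect b i j := by
  rw [pairDefect, pairDefect, h {i} (by simpa using hi), h {j} (by simpa using hj),
    h {i, j} (by intro x; simp; rintro (rfl | rfl) <;> assumption)]

theorem tripleDefect_congr {a b : Finset ι → R} {V : Finset ι} (h : ∀ S ⊆ V, a S = b S)
    {i j k : ι} (hi : i ∈ V) (hj : j ∈ V) (hk : k ∈ V) :
    tripleDefect a i j k = tripleDefect b i j k := by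
  rw [tripleDefect, tripleDefect, h {i} (by simpa using hi), h {j} (by simpa using hj),
    h {k} (by simpa using hk), pairDefect_congr h hi hj, pairDefect_congr h hi hk,
    pairDefect_congr h hj hk,
    h {i, j, k} (by intro x; simp; rintro (rfl | rfl | rfl) <;> assumption)]

end Minors

theorem eq_of_eval_ofReal_eq {p q : ℂ[X]} {E : Set ℝ} (hE : E.Infinite)
    (h : ∀ t ∈ E, p.eval (t : ℂ) = q.eval (t : ℂ)) : p = q := by
  refine Polynomial.eq_of_infinite_eval_eq p q ((hE.image
    (Complex.ofReal_injective.injOn)).mono ?_)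
  rintro _ ⟨t, ht, rfl⟩
  exact h t ht

theorem eval_pminor {ι : Type*} [DecidableEq ι] (N : Matrix ι ι ℂ[X]) (S : Finset ι) (z : ℂ) :
    (pminor N S).eval z = pminor (Matrix.of fun j k => (N j k).eval z) S :=
  map_pminor (evalRingHom z) N S

end PrincipalMinors

/-! ### From pointwise Hermitian matrices to a polynomial one -/

namespace PrincipalMinors

open Finset Polynomial

theorem isHermitian_apply' {ι : Type*} {B : Matrix ι ι ℂ} (hB : B.IsHermitian) (j k : ι) :
    (starRingEnd ℂ) (B j k) = B k j := hB.apply k j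

/-- The equivalence relation on the indices generated by the nonvanishing pair defects, provided
that these are transitive. -/
def defectSetoid {ι R : Type*} [DecidableEq ι] [CommRing R] (V : Finset ι) (α : Finset ι → R)
    (htrans : ∀ i ∈ V, ∀ j ∈ V, ∀ k ∈ V, i ≠ j → j ≠ k → i ≠ k → pairDefect α i j ≠ 0 →
      pairDefect α j k ≠ 0 → pairDefect α i k ≠ 0) : Setoid ι where
  r i j := i = j ∨ (i ∈ V ∧ j ∈ V ∧ i ≠ j ∧ pairDefect α i j ≠ 0)
  iseqv :=
    { refl := fun _ => Or.inl rfl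
      symm := by
        rintro i j (rfl | ⟨hi, hj, hij, h⟩)
        · exact Or.inl rfl
        · exact Or.inr ⟨hj, hi, hij.symm, by rwa [pairDefect_comm]⟩
      trans := by
        rintro i j k (rfl | ⟨hi, hj, hij, h⟩) (rfl | ⟨hj', hk, hjk, h'⟩)
        · exact Or.inl rfl
        · exact Or.inr ⟨hj', hk, hjk, h'⟩
        · exact Or.inr ⟨hi, hj, hij, h⟩
        · by_cases hik : i = k
          · exact Or.inl hik
          · exact Or.inr ⟨hi, hk, hik, htrans i hi j hj k hk hij hjk hik h h'⟩ }

/-- A family of Hermitian matrices `B t` whose principal minors are polynomials in `t` can, under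
a condition on the triples of indices, be replaced by a polynomial matrix which is Hermitian for
real `t`. -/
theorem exists_hermitian_polynomial {ι : Type*} [Fintype ι] [DecidableEq ι] {V : Finset ι}
    {α : Finset ι → ℝ[X]}
    (hB : ∀ t : ℝ, ∃ B : Matrix ι ι ℂ, B.IsHermitian ∧
      ∀ S ⊆ V, pminor B S = (((α S).eval t : ℝ) : ℂ))
    (htrans : ∀ i ∈ V, ∀ j ∈ V, ∀ k ∈ V, i ≠ j → j ≠ k → i ≠ k → pairDefect α i j ≠ 0 →
      pairDefect α j k ≠ 0 → pairDefect α i k ≠ 0)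
    (hsq : ∀ i ∈ V, ∀ j ∈ V, ∀ k ∈ V, i ≠ j → j ≠ k → i ≠ k → ∃ s : ℝ[X],
      4 * (pairDefect α i j * pairDefect α j k * pairDefect α i k) - tripleDefect α i j k ^ 2 =
        s ^ 2) :
    ∃ β : Matrix ι ι ℂ[X], (∀ j ∈ V, ∀ k ∈ V, conjPoly (β j k) = β k j) ∧
      ∀ S ⊆ V, pminor β S = ofRealPoly (α S) := by
  classical
  choose B hBh hBm using hB
  have hBconj : ∀ t j k, (starRingEnd ℂ) (B t j k) = B t k j := fun t => isHermitian_apply' (hBh t)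
  have hBq : ∀ t, ∀ j ∈ V, ∀ k ∈ V, j ≠ k →
      B t j k * B t k j = (((pairDefect α j k).eval t : ℝ) : ℂ) := by
    intro t j hj k hk hjk
    rw [← pairDefect_pminor _ hjk, pairDefect_congr (hBm t) hj hk]
    exact ((map_pairDefect ((Complex.ofRealHom).comp (evalRingHom t)) α j k)).symm
  have hBT : ∀ t, ∀ i ∈ V, ∀ j ∈ V, ∀ k ∈ V, i ≠ j → j ≠ k → i ≠ k →
      B t i j * B t j k * B t k i + B t i k * B t k j * B t j i =
        (((tripleDefect α i j k).eval t : ℝ) : ℂ) := by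
    intro t i hi j hj k hk hij hjk hik
    rw [← tripleDefect_pminor _ hij hjk hik, tripleDefect_congr (hBm t) hi hj hk]
    exact ((map_tripleDefect ((Complex.ofRealHom).comp (evalRingHom t)) α i j k)).symm
  have hBd : ∀ t, ∀ j ∈ V, B t j j = (((α {j}).eval t : ℝ) : ℂ) := by
    intro t j hj
    rw [← pminor_singleton (B t) j, hBm t _ (by simpa using hj)]
  let st := defectSetoid V α htrans
  let adj : ι → ι → Prop := fun i j => i ∈ V ∧ j ∈ V ∧ i ≠ j ∧ pairDefect α i j ≠ 0
  -- A representative of each class. By transitivity every other member of the class is directly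
  -- adjacent to it.
  let o : ι → ι := fun i => (Quotient.mk st i).out
  have hor : ∀ i, i ≠ o i → adj (o i) i := by
    intro i hi
    have h : st.r (o i) i := Quotient.mk_out (s := st) i
    rcases h with h | h
    · exact absurd h.symm hi
    · exact h
  have hoadj : ∀ i j, adj i j → o i = o j := by
    intro i j h
    have : Quotient.mk st i = Quotient.mk st j := Quotient.sound (Or.inr h)
    exact congrArg Quotient.out this
  have hoo : ∀ i, o (o i) = o i := by
    intro i
    by_cases h : i = o i
    · rw [← h]; exact h.symm
    · exact hoadj _ _ (hor i h)
  have hsymm : ∀ i j, adj i j → adj j i :=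
    fun i j ⟨hi, hj, hij, h⟩ => ⟨hj, hi, hij.symm, by rwa [pairDefect_comm]⟩
  -- Conjugation by `D` turns the entry `(j, k)` into a product along the closed walk `o j → j → k →
  -- o j`, which is independent of the phases in `B t`.
  let D : ℝ → ι → ℂ := fun t j => if j = o j then 1 else B t (o j) j
  let m : ι → ℝ[X] := fun j => if j = o j then 1 else pairDefect α (o j) j
  have hDo : ∀ t j, j = o j → D t j = 1 := fun t j h => if_pos h
  have hDn : ∀ t j, j ≠ o j → D t j = B t (o j) j := fun t j h => if_neg h
  have hmo : ∀ j, j = o j → m j = 1 := fun j h => if_pos h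
  have hmn : ∀ j, j ≠ o j → m j = pairDefect α (o j) j := fun j h => if_neg h
  have hDm : ∀ t j, D t j * (starRingEnd ℂ) (D t j) = (((m j).eval t : ℝ) : ℂ) := by
    intro t j
    by_cases h : j = o j
    · simp [hDo t j h, hmo j h]
    · obtain ⟨h1, h2, h3, h4⟩ := hor j h
      rw [hDn t j h, hmn j h, hBconj, hBq t _ h1 _ h2 h3]
  -- For each `t` separately the conjugated entry is one of two fixed polynomials evaluated at `t`;
  -- the Boolean records the sign of the square root.
  have hP : ∀ j k, ∃ P : Bool → ℂ[X], j ∈ V → k ∈ V → ∀ t, ∃ b,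
      D t j * B t j k * (starRingEnd ℂ) (D t k) = (P b).eval (t : ℂ) := by
    intro j k
    by_cases hjk : j = k
    · subst hjk
      refine ⟨fun _ => ofRealPoly (m j * α {j}), fun hj _ t => ⟨true, ?_⟩⟩
      rw [eval_ofRealPoly, eval_mul, Complex.ofReal_mul, ← hDm, hBd t j hj]
      ring
    by_cases ha : adj j k
    · obtain ⟨hj, hk, -, hq⟩ := id ha
      by_cases hjo : j = o j
      · refine ⟨fun _ => ofRealPoly (pairDefect α j k), fun _ _ t => ⟨true, ?_⟩⟩
        have hk' : k ≠ o k := by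
          rw [← hoadj j k ha, ← hjo]; exact Ne.symm hjk
        rw [hDo t j hjo, hDn t k hk', hBconj, ← hoadj j k ha, ← hjo, eval_ofRealPoly, one_mul,
          hBq t j hj k hk hjk]
      by_cases hko : k = o k
      · refine ⟨fun _ => ofRealPoly (pairDefect α j k), fun _ _ t => ⟨true, ?_⟩⟩
        rw [hDo t k hko, hDn t j hjo, hoadj j k ha, ← hko, eval_ofRealPoly, map_one, mul_one,
          mul_comm, hBq t j hj k hk hjk]
      · obtain ⟨h1, -, h3, h4⟩ := hor j hjo
        obtain ⟨-, -, h5, h6⟩ := hor k hko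
        rw [← hoadj j k ha] at h5 h6
        -- The two orientations of the 3-cycle have sum `tripleDefect` and product the three pair
        -- defects, so their difference squares to `-s²` and is `± i s`.
        obtain ⟨s, hs⟩ := hsq _ h1 j hj k hk h3 hjk h5
        refine ⟨fun b => C (1 / 2 : ℂ) * (ofRealPoly (tripleDefect α (o j) j k) +
          C (if b then Complex.I else -Complex.I) * ofRealPoly s), fun _ _ t => ?_⟩
        rw [hDn t j hjo, hDn t k hko, hBconj, ← hoadj j k ha]
        have e1 := hBT t _ h1 j hj k hk h3 hjk h5
        have e2 := hBq t _ h1 j hj h3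
        have e3 := hBq t j hj k hk hjk
        have e4 := hBq t _ h1 k hk h5
        have e5 := congrArg (fun p : ℝ[X] => ((p.eval t : ℝ) : ℂ)) hs
        simp only [eval_sub, eval_mul, eval_pow, Complex.ofReal_sub, Complex.ofReal_mul,
          Complex.ofReal_pow] at e5
        rw [← e1, ← e2, ← e3, ← e4] at e5
        simp only [eval_ofNat, Complex.ofReal_ofNat] at e5
        set T := B t (o j) j * B t j k * B t k (o j) with hT
        set T' := B t (o j) k * B t k j * B t j (o j) with hT'
        have e6 : (T - T' - Complex.I * ((s.eval t : ℝ) : ℂ)) *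
            (T - T' + Complex.I * ((s.eval t : ℝ) : ℂ)) = 0 := by
          have e7 : (B t (o j) j * B t j (o j) * (B t j k * B t k j) *
            (B t (o j) k * B t k (o j))) = T * T' := by rw [hT, hT']; ring
          rw [e7] at e5
          linear_combination -e5 - ((s.eval t : ℝ) : ℂ) ^ 2 * Complex.I_sq
        rcases mul_eq_zero.1 e6 with e | e
        · refine ⟨true, ?_⟩
          simp only [eval_mul, eval_add, eval_C, eval_ofRealPoly, if_true]
          rw [← e1]
          linear_combination e / 2
        · refine ⟨false, ?_⟩
          simp only [eval_mul, eval_add, eval_C, eval_ofRealPoly]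
          rw [← e1]
          simp only [Bool.false_eq_true, if_false]
          linear_combination e / 2
    · refine ⟨fun _ => 0, fun hj hk t => ⟨true, ?_⟩⟩
      have hq : pairDefect α j k = 0 := by
        by_contra h
        exact ha ⟨hj, hk, hjk, h⟩
      have h1 := hBq t j hj k hk hjk
      rw [hq, ← hBconj t j k, Complex.mul_conj] at h1
      have h2 : B t j k = 0 := by
        rw [← Complex.normSq_eq_zero]
        simpa using h1
      simp [h2]
  choose P hP using hP
  have hb : ∀ t, ∃ b : ι → ι → Bool, ∀ j ∈ V, ∀ k ∈ V,
      D t j * B t j k * (starRingEnd ℂ) (D t k) = (P j k (b j k)).eval (t : ℂ) := by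
    intro t
    have : ∀ j k, ∃ b, j ∈ V → k ∈ V →
        D t j * B t j k * (starRingEnd ℂ) (D t k) = (P j k b).eval (t : ℂ) := by
      intro j k
      by_cases hj : j ∈ V
      · by_cases hk : k ∈ V
        · obtain ⟨b, hb⟩ := hP j k hj hk t
          exact ⟨b, fun _ _ => hb⟩
        · exact ⟨true, fun _ h => absurd h hk⟩
      · exact ⟨true, fun h => absurd h hj⟩
    choose b hb using this
    exact ⟨b, fun j hj k hk => hb j k hj hk⟩
  choose b hb using hb
  -- There are finitely many sign patterns and infinitely many `t`, so one pattern occurs infinitely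
  -- often. Polynomial identities need only be checked on that set.
  obtain ⟨ε, hε⟩ := Finite.exists_infinite_fiber b
  have hE : (b ⁻¹' {ε}).Infinite := Set.infinite_coe_iff.1 hε
  let N : Matrix ι ι ℂ[X] := Matrix.of fun j k => P j k (ε j k)
  have hNe : ∀ t ∈ b ⁻¹' {ε}, ∀ j ∈ V, ∀ k ∈ V,
      (N j k).eval (t : ℂ) = D t j * (starRingEnd ℂ) (D t k) * B t j k := by
    intro t ht j hj k hk
    have := hb t j hj k hk
    rw [show b t = ε from ht] at this
    rw [show N j k = P j k (ε j k) from rfl, ← this]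
    ring
  have hherm : ∀ j ∈ V, ∀ k ∈ V, conjPoly (N j k) = N k j := by
    intro j hj k hk
    refine eq_of_eval_ofReal_eq hE fun t ht => ?_
    rw [eval_conjPoly_ofReal, hNe t ht j hj k hk, hNe t ht k hk j hj, map_mul, map_mul,
      Complex.conj_conj, hBconj]
    ring
  have hminor : ∀ S ⊆ V, pminor N S = (∏ j ∈ S, ofRealPoly (m j)) * ofRealPoly (α S) := by
    intro S hS
    refine eq_of_eval_ofReal_eq hE fun t ht => ?_
    rw [eval_pminor, eval_mul, eval_prod, eval_ofRealPoly, ← hBm t S hS,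
      pminor_of_gauge (A := Matrix.of fun j k => (N j k).eval (t : ℂ)) (x := D t)
        (y := fun k => (starRingEnd ℂ) (D t k)) (B := B t)
      fun j hj k hk => hNe t ht j (hS hj) k (hS hk)]
    congr 1
    exact Finset.prod_congr rfl fun j _ => by rw [hDm, eval_ofRealPoly]
  have hm : ∀ j, m j ≠ 0 := by
    intro j
    by_cases h : j = o j
    · simp [hmo j h]
    · rw [hmn j h]; exact (hor j h).2.2.2
  have hmnn : ∀ j t, 0 ≤ (m j).eval t := by
    intro j t
    have := hDm t j
    rw [Complex.mul_conj] at this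
    have h2 : Complex.normSq (D t j) = (m j).eval t := by exact_mod_cast this
    rw [← h2]
    exact Complex.normSq_nonneg _
  have hadj : ∀ j k, j ≠ k → adj j k → N j k ≠ 0 ∧ j ∈ V ∧ k ∈ V := by
    rintro j k - ⟨hj, hk, hjk, hq⟩
    refine ⟨fun h0 => ?_, hj, hk⟩
    have h1 : N j k * N k j = ofRealPoly (m j * m k * pairDefect α j k) := by
      refine eq_of_eval_ofReal_eq hE fun t ht => ?_
      rw [eval_mul, hNe t ht j hj k hk, hNe t ht k hk j hj, eval_ofRealPoly, eval_mul, eval_mul,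
        Complex.ofReal_mul, Complex.ofReal_mul, ← hDm, ← hDm, ← hBq t j hj k hk hjk]
      ring
    rw [h0, zero_mul, eq_comm, ofRealPoly_eq_zero] at h1
    exact mul_ne_zero (mul_ne_zero (hm j) (hm k)) hq h1
  have hnon : ∀ j ∈ V, ∀ k ∈ V, j ≠ k → ¬ adj j k → N j k = 0 := by
    intro j hj k hk hjk ha
    have hq : pairDefect α j k = 0 := by
      by_contra h
      exact ha ⟨hj, hk, hjk, h⟩
    refine eq_of_eval_ofReal_eq hE fun t ht => ?_
    have h1 := hBq t j hj k hk hjk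
    rw [hq, ← hBconj t j k, Complex.mul_conj] at h1
    have h2 : B t j k = 0 := by
      rw [← Complex.normSq_eq_zero]
      simpa using h1
    rw [hNe t ht j hj k hk, h2]
    simp
  have ho : ∀ j ∈ V, j ≠ o j →
      adj j (o j) ∧ N j (o j) = ofRealPoly (m j) ∧ N (o j) j = ofRealPoly (m j) := by
    intro j hj hjo
    obtain ⟨h1, h2, h3, h4⟩ := hor j hjo
    refine ⟨hsymm _ _ (hor j hjo), ?_, ?_⟩ <;> refine eq_of_eval_ofReal_eq hE fun t ht => ?_
    · rw [hNe t ht j hj _ h1, hDo t (o j) (hoo j).symm, hDn t j hjo, map_one, mul_one,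
        eval_ofRealPoly, hmn j hjo, hBq t _ h1 j hj h3]
    · rw [hNe t ht _ h1 j hj, hDo t (o j) (hoo j).symm, hDn t j hjo, one_mul, hBconj,
        eval_ofRealPoly, hmn j hjo, mul_comm, hBq t _ h1 j hj h3]
  obtain ⟨G, β, hG, hβ⟩ := exists_hermitian_gauge hm hmnn hherm
    (fun S hS => Dvd.intro _ (hminor S hS).symm) hadj hsymm hnon hoadj
    (fun j => hmo _ (hoo j).symm) ho
  have hGne : ∀ j ∈ V, G j ≠ 0 ∧ conjPoly (G j) ≠ 0 := by
    intro j hj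
    have := ofRealPoly_eq_zero.not.2 (hm j)
    rw [← hG j hj] at this
    exact ⟨left_ne_zero_of_mul this, right_ne_zero_of_mul this⟩
  refine ⟨β, fun j hj k hk => ?_, fun S hS => ?_⟩
  · have h1 := hherm j hj k hk
    rw [hβ j hj k hk, hβ k hk j hj, conjPoly_mul, conjPoly_mul, conjPoly_conjPoly,
      mul_comm (conjPoly (G j))] at h1
    exact mul_left_cancel₀ (mul_ne_zero (hGne k hk).1 (hGne j hj).2) h1
  · have h1 := hminor S hS
    rw [pminor_of_gauge (x := G) (y := fun k => conjPoly (G k)) (B := β)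
      fun j hj k hk => hβ j (hS hj) k (hS hk),
      Finset.prod_congr rfl fun j hj => hG j (hS hj)] at h1
    exact mul_left_cancel₀ (prod_ne_zero_iff.2 fun j _ => ofRealPoly_eq_zero.not.2 (hm j)) h1

end PrincipalMinors

/-! ### Bordering by a rank-one term -/

namespace PrincipalMinors

open Finset Polynomial

/-- If the corner were `1`, Schur complementation would give the minor of the rank-one update
exactly; the excess `A w w - 1` contributes linearly. No division is needed, so it holds over any
commutative ring. -/
theorem pminor_insert {ι R : Type*} [Fintype ι] [DecidableEq ι] [CommRing R] (A : Matrix ι ι R)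
    {T : Finset ι} {w : ι} (hw : w ∉ T) :
    pminor A (insert w T) = (A w w - 1) * pminor A T +
      pminor (Matrix.of fun j k => A j k - A j w * A w k) T := by
  classical
  set M : Matrix ι ι R := Matrix.of fun i => if i ∈ T then A i else (1 : Matrix ι ι R) i with hM
  -- Row `w` with its diagonal entry replaced by `1`, so that it can serve as a pivot for clearing
  -- column `w`.
  set R₁ : ι → R := A w + (1 - A w w) • (1 : Matrix ι ι R) w with hR₁
  have hR₁w : R₁ w = 1 := by simp [hR₁]
  have h1 : pminor A (insert w T) = (M.updateRow w (A w)).det := by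
    rw [pminor_eq_det_rows]
    congr 1
    ext i j
    by_cases h : i = w
    · subst h; simp
    · simp [h, hM]
  have h2 : (M.updateRow w ((1 : Matrix ι ι R) w)).det = pminor A T := by
    rw [pminor_eq_det_rows]
    congr 1
    ext i j
    by_cases h : i = w
    · subst h; simp [hw]
    · simp [h, hM]
  have h3 : A w = R₁ + (A w w - 1) • (1 : Matrix ι ι R) w := by
    rw [hR₁]; module
  have h4 : (M.updateRow w R₁).det =
      pminor (Matrix.of fun j k => A j k - A j w * A w k) T := by
    set c : ι → R := fun i => if i ∈ T then A i w else 0 with hc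
    let B : Matrix ι ι R := Matrix.of fun i j =>
      if i = w then R₁ j else if i ∈ T then A i j - A i w * R₁ j else (1 : Matrix ι ι R) i j
    have hB : pminor (Matrix.of fun j k => A j k - A j w * A w k) T =
        pminor (Matrix.of fun j k => A j k - A j w * R₁ k) T := by
      refine pminor_congr fun j _ k hk => ?_
      have : w ≠ k := fun h => hw (h ▸ hk)
      simp [hR₁, this]
    rw [hB, Matrix.det_eq_of_forall_row_eq_smul_add_const (B := B) c w (by simp [hc, hw])]
    · rw [pminor_eq_det_rows, ← Matrix.det_transpose, ← Matrix.det_transpose (Matrix.of _)]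
      refine Matrix.det_eq_of_forall_row_eq_smul_add_const
        (fun j => if j = w then 0 else R₁ j) w (by simp) fun j i => ?_
      simp only [Matrix.transpose_apply]
      by_cases hi : i = w
      · subst hi
        by_cases hj : j = i
        · subst hj; simp [B, hw, hR₁w]
        · simp [B, hw, hj, Ne.symm hj]
      · by_cases hiT : i ∈ T
        · simp [B, hi, hiT, hR₁w]
        · simp [B, hi, hiT]
    · intro i j
      by_cases hi : i = w
      · subst hi; simp [B, hc, hw]
      · by_cases hiT : i ∈ T
        · simp [B, hc, hi, hiT, hM]
        · simp [B, hc, hi, hiT, hM]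
  have h5 : M.updateRow w (A w) = M.updateRow w (R₁ + (A w w - 1) • (1 : Matrix ι ι R) w) := by
    rw [← h3]
  rw [h1, h5, Matrix.det_updateRow_add, Matrix.det_updateRow_smul, h2, h4]
  ring

theorem natDegree_le_one_of_mul_conjPoly {p : ℂ[X]} (h : (p * conjPoly p).natDegree ≤ 2) :
    p.natDegree ≤ 1 := by
  by_cases h0 : p = 0
  · simp [h0]
  · rw [natDegree_mul h0 (conjPoly_eq_zero.not.2 h0), conjPoly, natDegree_map] at h
    omega

/-- A Hermitian matrix all of whose `2 × 2` and `3 × 3` principal minors vanish, with nonnegative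
diagonal, has rank at most one. -/
theorem exists_vector_of_pminor_eq_zero {ι : Type*} [DecidableEq ι] {V : Finset ι}
    {W : Matrix ι ι ℂ} (hW : W.IsHermitian) (hdiag : ∀ j ∈ V, ∃ x : ℝ, 0 ≤ x ∧ W j j = x)
    (h2 : ∀ j ∈ V, ∀ k ∈ V, j ≠ k → pminor W {j, k} = 0)
    (h3 : ∀ i ∈ V, ∀ j ∈ V, ∀ k ∈ V, i ≠ j → j ≠ k → i ≠ k → pminor W {i, j, k} = 0) :
    ∃ v : ι → ℂ, ∀ j ∈ V, ∀ k ∈ V, W j k = v j * (starRingEnd ℂ) (v k) := by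
  have hconj := isHermitian_apply' hW
  choose! x hx0 hx using hdiag
  have hpair : ∀ j ∈ V, ∀ k ∈ V, W j k * W k j = x j * x k := by
    intro j hj k hk
    by_cases hjk : j = k
    · subst hjk; rw [hx j hj]
    · have := h2 j hj k hk hjk
      rw [pminor_pair _ hjk, hx j hj, hx k hk] at this
      linear_combination -this
  have hzero : ∀ j ∈ V, ∀ k ∈ V, x j = 0 → W j k = 0 := by
    intro j hj k hk h
    have := hpair j hj k hk
    rw [h, ← hconj j k, Complex.mul_conj] at this
    rw [← Complex.normSq_eq_zero]
    simpa using this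
  by_cases hall : ∀ j ∈ V, x j = 0
  · exact ⟨fun _ => 0, fun j hj k hk => by simp [hzero j hj k hk (hall j hj)]⟩
  push Not at hall
  obtain ⟨o, ho, hxo⟩ := hall
  have hxo' : 0 < x o := lt_of_le_of_ne (hx0 o ho) hxo.symm
  have hxoc : (x o : ℂ) ≠ 0 := by exact_mod_cast hxo
  -- Rank one in the form of vanishing 2 × 2 minors with pivot `x o`.
  have key : ∀ j ∈ V, ∀ k ∈ V, W j k * x o = W j o * W o k := by
    intro j hj k hk
    by_cases hjo : j = o
    · subst hjo; rw [hx j hj]; ring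
    by_cases hko : k = o
    · subst hko; rw [hx k hk]
    by_cases hjk : j = k
    · subst hjk; rw [hpair j hj o ho, hx j hj]
    by_cases hxj : x j = 0
    · rw [hzero j hj k hk hxj, hzero j hj o ho hxj]; ring
    by_cases hxk : x k = 0
    · rw [← hconj k j, ← hconj k o, hzero k hk j hj hxk, hzero k hk o ho hxk]; simp
    have e1 := h3 o ho j hj k hk (Ne.symm hjo) hjk (Ne.symm hko)
    rw [pminor_triple _ (Ne.symm hjo) hjk (Ne.symm hko), hpair j hj k hk, hpair o ho k hk,
      hpair o ho j hj, hx o ho, hx j hj, hx k hk] at e1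
    -- Vanishing of the minors prescribes both the sum and the product of `P` and its conjugate.
    -- With `x = x o * x j * x k` these are `2 x` and `x²`, whence `|P - x|² = 0`.
    set P := W o j * W j k * W k o with hP
    have hP' : W o k * W k j * W j o = (starRingEnd ℂ) P := by
      rw [hP, map_mul, map_mul, hconj, hconj, hconj]; ring
    rw [hP'] at e1
    have e2 : P * (starRingEnd ℂ) P = ((x o * x j * x k : ℝ) : ℂ) ^ 2 := by
      rw [← hP', hP]
      push_cast
      linear_combination (W j k * W k j * (W k o * W o k)) * hpair o ho j hj +
        (x o * x j : ℂ) * (W k o * W o k) * hpair j hj k hk +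
        (x o * x j : ℂ) * (x j * x k : ℂ) * hpair k hk o ho
    have e3 : (P - ((x o * x j * x k : ℝ) : ℂ)) *
        (starRingEnd ℂ) (P - ((x o * x j * x k : ℝ) : ℂ)) = 0 := by
      rw [map_sub, Complex.conj_ofReal]
      push_cast at e2 ⊢
      linear_combination e2 - (x o * x j * x k : ℂ) * e1
    have e4 : P = x o * x j * x k := by
      rw [Complex.mul_conj, Complex.ofReal_eq_zero, Complex.normSq_eq_zero, sub_eq_zero] at e3
      rw [e3]; push_cast; ring
    have hne : (x o * x j * x k : ℂ) ≠ 0 := by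
      refine mul_ne_zero (mul_ne_zero hxoc ?_) ?_ <;> exact_mod_cast (by assumption)
    refine mul_left_cancel₀ hne ?_
    rw [hP] at e4
    linear_combination (W j o * W o k) * e4 - (W j k * (W k o * W o k)) * hpair o ho j hj -
      (W j k * (x o * x j : ℂ)) * hpair k hk o ho
  refine ⟨fun j => W j o / (Real.sqrt (x o) : ℂ), fun j hj k hk => ?_⟩
  have hs : (Real.sqrt (x o) : ℂ) * (Real.sqrt (x o) : ℂ) = x o := by
    rw [← Complex.ofReal_mul, Real.mul_self_sqrt hxo'.le]
  have hs0 : (Real.sqrt (x o) : ℂ) ≠ 0 := by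
    exact_mod_cast (Real.sqrt_pos.2 hxo').ne'
  rw [map_div₀, hconj, Complex.conj_ofReal, div_mul_div_comm, hs, ← key j hj k hk,
    mul_div_cancel_right₀ _ hxoc]

/-- A Hermitian polynomial matrix with principal minors `b S + t (b (S ∪ w) - b w * b S)` gives
rise to a Hermitian matrix with principal minors `b S`, bordered by the index `w`. -/
theorem exists_bordered {ι : Type*} [Fintype ι] [DecidableEq ι] {V : Finset ι} {w : ι}
    (hw : w ∉ V) {b : Finset ι → ℝ} {β : Matrix ι ι ℂ[X]}
    (hβ : ∀ j ∈ V, ∀ k ∈ V, conjPoly (β j k) = β k j)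
    (hm : ∀ S ⊆ V, pminor β S =
      ofRealPoly (C (b S) + C (b (insert w S) - b {w} * b S) * X))
    (hneg : ∀ j ∈ V, b (insert w {j}) - b {w} * b {j} ≤ 0) :
    ∃ A : Matrix ι ι ℂ, A.IsHermitian ∧ ∀ S ⊆ insert w V, pminor A S = b S := by
  have hdiag : ∀ j ∈ V, β j j = ofRealPoly (C (b {j}) + C (b (insert w {j}) - b {w} * b {j}) * X) :=
    fun j hj => by rw [← pminor_singleton β j, hm _ (by simpa using hj)]
  have hdeg1 : ∀ x y : ℝ, (ofRealPoly (C x + C y * X)).natDegree ≤ 1 := by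
    intro x y
    rw [ofRealPoly, natDegree_map, add_comm]
    exact natDegree_linear_le
  -- The diagonal entries and the 2 × 2 minors are affine, so `β j k` times its conjugate has degree
  -- at most two.
  have hdeg : ∀ j ∈ V, ∀ k ∈ V, (β j k).natDegree ≤ 1 := by
    intro j hj k hk
    by_cases hjk : j = k
    · subst hjk; rw [hdiag j hj]; exact hdeg1 _ _
    · refine natDegree_le_one_of_mul_conjPoly ?_
      have h1 := hm {j, k} (by intro x; simp; rintro (rfl | rfl) <;> assumption)
      rw [pminor_pair _ hjk] at h1
      have h2 : β j k * conjPoly (β j k) = β j j * β k k - ofRealPoly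
          (C (b {j, k}) + C (b (insert w {j, k}) - b {w} * b {j, k}) * X) := by
        rw [hβ j hj k hk, ← h1]; ring
      rw [h2]
      refine (natDegree_sub_le _ _).trans (max_le ?_ ((hdeg1 _ _).trans (by norm_num)))
      refine natDegree_mul_le.trans ?_
      rw [hdiag j hj, hdiag k hk]
      have := hdeg1 (b {j}) (b (insert w {j}) - b {w} * b {j})
      have := hdeg1 (b {k}) (b (insert w {k}) - b {w} * b {k})
      omega
  set A₀ : Matrix ι ι ℂ := Matrix.of fun j k =>
    if j ∈ V ∧ k ∈ V then (β j k).coeff 0 else 0 with hA₀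
  set W : Matrix ι ι ℂ := Matrix.of fun j k =>
    if j ∈ V ∧ k ∈ V then -(β j k).coeff 1 else 0 with hW
  have hcoeff : ∀ j ∈ V, ∀ k ∈ V, ∀ n, (starRingEnd ℂ) ((β j k).coeff n) = (β k j).coeff n := by
    intro j hj k hk n
    rw [← hβ j hj k hk, conjPoly, coeff_map]
  have hA₀h : A₀.IsHermitian := by
    ext j k
    simp only [Matrix.conjTranspose_apply, hA₀, Matrix.of_apply]
    by_cases h : j ∈ V ∧ k ∈ V
    · rw [if_pos h, if_pos h.symm]; exact hcoeff k h.2 j h.1 0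
    · rw [if_neg h, if_neg fun h' => h h'.symm]; simp
  have hWh : W.IsHermitian := by
    ext j k
    simp only [Matrix.conjTranspose_apply, hW, Matrix.of_apply]
    by_cases h : j ∈ V ∧ k ∈ V
    · rw [if_pos h, if_pos h.symm, star_neg]; exact congrArg _ (hcoeff k h.2 j h.1 1)
    · rw [if_neg h, if_neg fun h' => h h'.symm]; simp
  have heval : ∀ j ∈ V, ∀ k ∈ V, ∀ z : ℂ, (β j k).eval z = A₀ j k - z * W j k := by
    intro j hj k hk z
    rw [eval_eq_sum_range' (n := 2) (by have := hdeg j hj k hk; omega), sum_range_succ,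
      sum_range_one]
    simp only [hA₀, hW, Matrix.of_apply, hj, hk, and_self, if_true]
    ring
  have hAW : ∀ S ⊆ V, ∀ z : ℂ, pminor (Matrix.of fun j k => A₀ j k - z * W j k) S =
      b S + (b (insert w S) - b {w} * b S) * z := by
    intro S hS z
    have h1 := congrArg (eval z) (hm S hS)
    rw [eval_pminor] at h1
    rw [pminor_congr (A := Matrix.of fun j k => A₀ j k - z * W j k)
      (B := Matrix.of fun j k => (β j k).eval z)
      fun j hj k hk => (heval j (hS hj) k (hS hk) z).symm, h1]
    simp [ofRealPoly]
  have hWd : ∀ j ∈ V, ∃ x : ℝ, 0 ≤ x ∧ W j j = x := by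
    intro j hj
    refine ⟨-(b (insert w {j}) - b {w} * b {j}), by have := hneg j hj; linarith, ?_⟩
    have h1 := hAW {j} (by simpa using hj) 1
    have h0 := hAW {j} (by simpa using hj) 0
    simp only [pminor_singleton, Matrix.of_apply] at h0 h1
    push_cast
    linear_combination h0 - h1
  have hW2 : ∀ j ∈ V, ∀ k ∈ V, j ≠ k → pminor W {j, k} = 0 := by
    intro j hj k hk hjk
    have hs : ({j, k} : Finset ι) ⊆ V := by
      intro x; simp; rintro (rfl | rfl) <;> assumption
    have h0 := hAW _ hs 0
    have h1 := hAW _ hs 1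
    have h2 := hAW _ hs (-1)
    rw [pminor_pair _ hjk] at h0 h1 h2 ⊢
    simp only [Matrix.of_apply] at h0 h1 h2
    -- The minor of `W` is the quadratic coefficient of the pencil, obtained as a second difference,
    -- which vanishes because the right-hand side is affine.
    linear_combination (h1 + h2) / 2 - h0
  have hW3 : ∀ i ∈ V, ∀ j ∈ V, ∀ k ∈ V, i ≠ j → j ≠ k → i ≠ k → pminor W {i, j, k} = 0 := by
    intro i hi j hj k hk hij hjk hik
    have hs : ({i, j, k} : Finset ι) ⊆ V := by
      intro x; simp; rintro (rfl | rfl | rfl) <;> assumption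
    have h0 := hAW _ hs 0
    have h1 := hAW _ hs 1
    have h2 := hAW _ hs (-1)
    have h3 := hAW _ hs 2
    rw [pminor_triple _ hij hjk hik] at h0 h1 h2 h3 ⊢
    simp only [Matrix.of_apply] at h0 h1 h2 h3
    -- The third difference at `-1, 0, 1, 2` is six times the cubic coefficient, which is minus the
    -- minor of `W`.
    linear_combination (-1 / 6 : ℂ) * (h3 - 3 * h1 + 3 * h0 - h2)
  obtain ⟨v, hv⟩ := exists_vector_of_pminor_eq_zero hWh hWd hW2 hW3
  set A : Matrix ι ι ℂ := Matrix.of fun j k =>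
    if j = w then (if k = w then (b {w} : ℂ) else (starRingEnd ℂ) (v k))
      else if k = w then v j else A₀ j k with hA
  refine ⟨A, ?_, fun S hS => ?_⟩
  · ext j k
    simp only [Matrix.conjTranspose_apply, hA, Matrix.of_apply]
    by_cases hj : j = w <;> by_cases hk : k = w
    · simp [hj, hk]
    · simp [hj, hk]
    · simp [hj, hk]
    · simp only [hj, hk, if_false]; exact hA₀h.apply j k
  · have hAT : ∀ T ⊆ V, pminor A T = b T := by
      intro T hT
      have h0 := hAW T hT 0
      rw [pminor_congr (A := Matrix.of fun j k => A₀ j k - 0 * W j k) (B := A)] at h0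
      · rw [h0]; simp
      · intro j hj k hk
        have hjw : j ≠ w := fun h => hw (h ▸ hT hj)
        have hkw : k ≠ w := fun h => hw (h ▸ hT hk)
        simp [hA, hjw, hkw]
    by_cases hwS : w ∈ S
    · obtain ⟨T, hwT, rfl⟩ : ∃ T, w ∉ T ∧ S = insert w T :=
        ⟨S.erase w, notMem_erase w S, (insert_erase hwS).symm⟩
      have hT : T ⊆ V := by
        intro x hx
        rcases mem_insert.1 (hS (mem_insert_of_mem hx)) with h | h
        · exact absurd (h ▸ hx) hwT
        · exact h
      have h1 := hAW T hT 1
      rw [pminor_congr (A := Matrix.of fun j k => A₀ j k - 1 * W j k)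
        (B := Matrix.of fun j k => A j k - A j w * A w k)] at h1
      · rw [pminor_insert A hwT, h1, hAT T hT]
        simp only [hA, Matrix.of_apply, if_true]
        ring
      · intro j hj k hk
        have hjw : j ≠ w := fun h => hw (h ▸ hT hj)
        have hkw : k ≠ w := fun h => hw (h ▸ hT hk)
        simp [hA, hjw, hkw, hv j (hT hj) k (hT hk)]
    · refine hAT S fun x hx => ?_
      rcases mem_insert.1 (hS hx) with h | h
      · exact absurd (h ▸ hx) hwS
      · exact h

end PrincipalMinors

/-! ### The quartic as the hyperdeterminant of a pencil -/

namespace PrincipalMinors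

open Finset

theorem map_asPolyIn_eval {n : ℕ} (k : Fin n) (f : MvPolynomial (Fin n) ℝ) (y : Fin n → ℝ)
    (t : ℝ) : ((asPolyIn k f).map (MvPolynomial.eval y)).eval t =
      MvPolynomial.eval (Function.update y k t) f := by
  induction f using MvPolynomial.induction_on with
  | C r => simp [asPolyIn, MvPolynomial.algebraMap_eq]
  | add p q hp hq =>
    unfold asPolyIn at hp hq ⊢
    rw [map_add, Polynomial.map_add, Polynomial.eval_add, hp, hq, map_add]
  | mul_X p i hp =>
    unfold asPolyIn at hp ⊢
    rw [map_mul, Polynomial.map_mul, Polynomial.eval_mul, hp, map_mul]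
    congr 1
    by_cases h : i = k
    · subst h; simp
    · simp [h]

theorem eval_pderiv {n : ℕ} (k : Fin n) (f : MvPolynomial (Fin n) ℝ) (y : Fin n → ℝ) :
    MvPolynomial.eval y (MvPolynomial.pderiv k f) =
      ((asPolyIn k f).map (MvPolynomial.eval y)).derivative.eval (y k) := by
  induction f using MvPolynomial.induction_on with
  | C r => simp [asPolyIn, MvPolynomial.algebraMap_eq]
  | add p q hp hq =>
    unfold asPolyIn at hp hq ⊢
    simp only [map_add, Polynomial.map_add, Polynomial.eval_add, hp, hq]
  | mul_X p i hp =>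
    have h1 := map_asPolyIn_eval k p y (y k)
    unfold asPolyIn at h1 hp ⊢
    rw [Function.update_eq_self] at h1
    rw [Derivation.leibniz, map_mul, Polynomial.map_mul, Polynomial.derivative_mul]
    simp only [smul_eq_mul, map_add, map_mul, Polynomial.eval_add, Polynomial.eval_mul, hp, h1]
    by_cases h : i = k
    · subst h; simp; ring
    · simp [h, MvPolynomial.pderiv_X_of_ne h]; ring

theorem eval_restrictFour {n : ℕ} (f : MvPolynomial (Fin n) ℝ) (y : Fin n → ℝ) :
    MvPolynomial.eval y (restrictFour f) =
      MvPolynomial.eval (fun i : Fin n => if (i : ℕ) < 4 then y i else 0) f := by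
  rw [restrictFour, MvPolynomial.aeval_def, ← MvPolynomial.coe_eval₂Hom]
  have : (MvPolynomial.eval y).comp (MvPolynomial.eval₂Hom
      (algebraMap ℝ (MvPolynomial (Fin n) ℝ))
      (fun i : Fin n => if (i : ℕ) < 4 then MvPolynomial.X i else 0)) =
      MvPolynomial.eval (fun i : Fin n => if (i : ℕ) < 4 then y i else 0) := by
    ext i
    · simp [MvPolynomial.algebraMap_eq]
    · by_cases h : (i : ℕ) < 4 <;> simp [h]
  exact congrArg (fun φ : MvPolynomial (Fin n) ℝ →+* ℝ => φ f) this

/-- Cayley's hyperdeterminant over a commutative ring. -/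
def hyperdet {R : Type*} [CommRing R] (a : Finset (Fin 3) → R) : R :=
  (a {0} * a {1, 2} + a {1} * a {0, 2} - a {2} * a {0, 1} - a ∅ * a {0, 1, 2}) ^ 2
    - 4 * (a {0} * a {1} - a ∅ * a {0, 1}) * (a {0, 2} * a {1, 2} - a {2} * a {0, 1, 2})

/-- The pencil of vectors indexed by the subsets of `[3]` given by a vector indexed by the subsets
of `[4]`. -/
noncomputable def pencil (c : Finset (Fin 4) → ℝ) (U : Finset (Fin 3)) : Polynomial ℝ :=
  Polynomial.C (c (U.map Fin.castSuccEmb)) * Polynomial.X +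
    Polynomial.C (c (insert 3 (U.map Fin.castSuccEmb)))

/-- The coordinates `b_S` with `S ⊇ {5, …, n}`. -/
def tailCoords {n : ℕ} (h : 4 ≤ n) (b : Finset (Fin n) → ℝ) : Finset (Fin 4) → ℝ := fun U =>
  b (U.map (Fin.castLEEmb h) ∪ univ.filter fun i => 4 ≤ (i : ℕ))

/-- The monomial of `S` runs over the complement of `S`, so setting the tail variables to zero
retains the sets containing the whole tail, not those avoiding it. -/
theorem eval_multiaffine {n : ℕ} (h : 4 ≤ n) (b : Finset (Fin n) → ℝ) (y : Fin n → ℝ)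
    (hy : ∀ i : Fin n, 4 ≤ (i : ℕ) → y i = 0) :
    MvPolynomial.eval y (multiaffine b) =
      ∑ U : Finset (Fin 4), tailCoords h b U * ∏ i ∈ Uᶜ, y (Fin.castLE h i) := by
  rw [multiaffine, map_sum]
  symm
  have hinj : Function.Injective fun U : Finset (Fin 4) =>
      U.map (Fin.castLEEmb h) ∪ univ.filter fun i : Fin n => 4 ≤ (i : ℕ) := by
    intro U U' hU
    ext i
    have := Finset.ext_iff.1 hU (Fin.castLE h i)
    have hm : ∀ W : Finset (Fin 4), Fin.castLE h i ∈ W.map (Fin.castLEEmb h) ∪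
        univ.filter (fun i : Fin n => 4 ≤ (i : ℕ)) ↔ i ∈ W := by
      intro W
      rw [mem_union, mem_filter, ← Fin.castLEEmb_apply h, mem_map']
      have hi := i.2
      simp only [mem_univ, true_and, Fin.castLEEmb_apply, Fin.val_castLE, or_iff_left_iff_imp]
      omega
    rwa [hm, hm] at this
  refine Finset.sum_of_injOn _ hinj.injOn (fun _ _ => mem_coe.2 (mem_univ _)) ?_ ?_
  · intro S _ hS
    have : ∃ i : Fin n, 4 ≤ (i : ℕ) ∧ i ∉ S := by
      by_contra! hcon
      refine hS ⟨univ.filter fun i => Fin.castLE h i ∈ S, by simp, ?_⟩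
      ext i
      simp only [mem_union, mem_map, mem_filter, mem_univ, true_and, Fin.castLEEmb_apply]
      constructor
      · rintro (⟨j, hj, rfl⟩ | hi)
        · exact hj
        · exact hcon i hi
      · intro hi
        by_cases h4 : 4 ≤ (i : ℕ)
        · exact Or.inr h4
        · exact Or.inl ⟨⟨i, by omega⟩, hi, rfl⟩
    obtain ⟨i, hi, hiS⟩ := this
    rw [map_mul, map_prod, Finset.prod_eq_zero (mem_compl.2 hiS), mul_zero]
    simp [hy i hi]
  · intro U _
    rw [map_mul, MvPolynomial.eval_C, map_prod, tailCoords]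
    congr 1
    have hc : (U.map (Fin.castLEEmb h) ∪ univ.filter fun i : Fin n => 4 ≤ (i : ℕ))ᶜ =
        Uᶜ.map (Fin.castLEEmb h) := by
      ext i
      simp only [mem_compl, mem_union, mem_map, mem_filter, mem_univ, true_and,
        Fin.castLEEmb_apply, not_or]
      constructor
      · rintro ⟨h1, h2⟩
        refine ⟨⟨i, by omega⟩, fun hU => h1 ⟨_, hU, rfl⟩, rfl⟩
      · rintro ⟨j, hj, rfl⟩
        refine ⟨?_, by simp⟩
        rintro ⟨k, hk, hkj⟩
        rw [Fin.castLE_inj] at hkj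
        exact hj (hkj ▸ hk)
    rw [hc, Finset.prod_map]
    simp

theorem eval_multiaffine_eq {n : ℕ} (h : 4 ≤ n) (b : Finset (Fin n) → ℝ) (y : Fin n → ℝ)
    (hy : ∀ i : Fin n, 4 ≤ (i : ℕ) → y i = 0) {κ : Finset (Fin 3) → ℝ}
    (hκ : κ = fun U => (pencil (tailCoords h b) U).eval (y (Fin.castLE h 3))) :
    MvPolynomial.eval y (multiaffine b) =
      κ ∅ * y (Fin.castLE h 0) * y (Fin.castLE h 1) * y (Fin.castLE h 2)
      + κ {0} * y (Fin.castLE h 1) * y (Fin.castLE h 2)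
      + κ {1} * y (Fin.castLE h 0) * y (Fin.castLE h 2)
      + κ {2} * y (Fin.castLE h 0) * y (Fin.castLE h 1)
      + κ {0, 1} * y (Fin.castLE h 2) + κ {0, 2} * y (Fin.castLE h 1)
      + κ {1, 2} * y (Fin.castLE h 0) + κ {0, 1, 2} := by
  rw [eval_multiaffine h b y hy]
  set c := tailCoords h b
  have hprod : ∀ U : Finset (Fin 4), ∏ i ∈ Uᶜ, y (Fin.castLE h i) =
      ∏ i : Fin 4, if i ∈ U then 1 else y (Fin.castLE h i) := by
    intro U
    rw [Finset.prod_ite, Finset.prod_const_one, one_mul]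
    congr 1
    ext i; simp
  simp_rw [hprod, Fin.prod_univ_four]
  rw [show (univ : Finset (Finset (Fin 4))) = {∅, {0}, {1}, {2}, {0, 1}, {0, 2}, {1, 2}, {0, 1, 2},
    {3}, {0, 3}, {1, 3}, {2, 3}, {0, 1, 3}, {0, 2, 3}, {1, 2, 3}, {0, 1, 2, 3}} by decide]
  repeat rw [Finset.sum_insert (by decide)]
  rw [Finset.sum_singleton]
  have k0 : κ ∅ = c ∅ * y (Fin.castLE h 3) + c {3} := by
    rw [hκ]; simp [pencil]
  have k1 : κ {0} = c {0} * y (Fin.castLE h 3) + c {0, 3} := by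
    rw [hκ]; simp [pencil, show ({3, 0} : Finset (Fin 4)) = {0, 3} by decide]
  have k2 : κ {1} = c {1} * y (Fin.castLE h 3) + c {1, 3} := by
    rw [hκ]; simp [pencil, show ({3, 1} : Finset (Fin 4)) = {1, 3} by decide]
  have k3 : κ {2} = c {2} * y (Fin.castLE h 3) + c {2, 3} := by
    rw [hκ]; simp [pencil, show ({3, 2} : Finset (Fin 4)) = {2, 3} by decide]
  have k4 : κ {0, 1} = c {0, 1} * y (Fin.castLE h 3) + c {0, 1, 3} := by
    rw [hκ]; simp [pencil, show ({3, 0, 1} : Finset (Fin 4)) = {0, 1, 3} by decide]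
  have k5 : κ {0, 2} = c {0, 2} * y (Fin.castLE h 3) + c {0, 2, 3} := by
    rw [hκ]; simp [pencil, show ({3, 0, 2} : Finset (Fin 4)) = {0, 2, 3} by decide]
  have k6 : κ {1, 2} = c {1, 2} * y (Fin.castLE h 3) + c {1, 2, 3} := by
    rw [hκ]; simp [pencil, show ({3, 1, 2} : Finset (Fin 4)) = {1, 2, 3} by decide]
  have k7 : κ {0, 1, 2} = c {0, 1, 2} * y (Fin.castLE h 3) + c {0, 1, 2, 3} := by
    rw [hκ]; simp [pencil, show ({3, 0, 1, 2} : Finset (Fin 4)) = {0, 1, 2, 3} by decide]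
  rw [k0, k1, k2, k3, k4, k5, k6, k7]
  simp only [show ∀ U : Finset (Fin 4), ∀ i, (if i ∈ U then (1 : ℝ) else y (Fin.castLE h i)) =
    if decide (i ∈ U) = true then (1 : ℝ) else y (Fin.castLE h i) from fun U i => by simp]
  simp
  ring

theorem quarticB_map {R R' : Type*} [CommRing R] [CommRing R'] (f : R →+* R')
    (p : Polynomial R) : quarticB (p.map f) = f (quarticB p) := by
  simp [quarticB]

theorem quarticC_map {R R' : Type*} [CommRing R] [CommRing R'] (f : R →+* R')
    (p : Polynomial R) : quarticC (p.map f) = f (quarticC p) := by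
  simp [quarticC, map_ofNat]

theorem quarticD_map {R R' : Type*} [CommRing R] [CommRing R'] (f : R →+* R')
    (p : Polynomial R) : quarticD (p.map f) = f (quarticD p) := by
  simp [quarticD, map_ofNat]

theorem eval_hyperdet (a : Finset (Fin 3) → Polynomial ℝ) (t : ℝ) :
    (hyperdet a).eval t = hyperdet fun U => (a U).eval t := by
  simp [hyperdet]

theorem eval_pderiv_of_affine {n : ℕ} (k : Fin n) (f : MvPolynomial (Fin n) ℝ) (y : Fin n → ℝ)
    (u v : ℝ) (h : ∀ s, MvPolynomial.eval (Function.update y k s) f = u + v * s) :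
    MvPolynomial.eval y (MvPolynomial.pderiv k f) = v := by
  have : (asPolyIn k f).map (MvPolynomial.eval y) =
      Polynomial.C u + Polynomial.C v * Polynomial.X := by
    refine Polynomial.funext fun s => ?_
    rw [map_asPolyIn_eval, h]
    simp
  rw [eval_pderiv, this]
  simp

theorem map_discrRayleigh {n : ℕ} (h : 4 ≤ n) (b : Finset (Fin n) → ℝ) (y : Fin n → ℝ)
    (hy : ∀ i : Fin n, 4 ≤ (i : ℕ) → y i = 0) :
    (discrRayleigh h b).map (MvPolynomial.eval y) = hyperdet (pencil (tailCoords h b)) := by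
  refine Polynomial.funext fun t => ?_
  rw [discrRayleigh, map_asPolyIn_eval, eval_hyperdet]
  set κ : Finset (Fin 3) → ℝ := fun U => (pencil (tailCoords h b) U).eval t with hκ
  have n01 : Fin.castLE h 0 ≠ Fin.castLE h 1 := by simp [Fin.ext_iff]
  have n02 : Fin.castLE h 0 ≠ Fin.castLE h 2 := by simp [Fin.ext_iff]
  have n03 : Fin.castLE h 0 ≠ Fin.castLE h 3 := by simp [Fin.ext_iff]
  have n12 : Fin.castLE h 1 ≠ Fin.castLE h 2 := by simp [Fin.ext_iff]
  have n13 : Fin.castLE h 1 ≠ Fin.castLE h 3 := by simp [Fin.ext_iff]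
  have n23 : Fin.castLE h 2 ≠ Fin.castLE h 3 := by simp [Fin.ext_iff]
  have hf : ∀ x : Fin n → ℝ, (∀ i : Fin n, 4 ≤ (i : ℕ) → x i = 0) → x (Fin.castLE h 3) = t →
      MvPolynomial.eval x (multiaffine b) = _ := fun x hx hxt =>
    eval_multiaffine_eq h b x hx (κ := κ) (by rw [hκ, hxt])
  have hup : ∀ (x : Fin n → ℝ) (j : Fin 4) (s : ℝ), (∀ i : Fin n, 4 ≤ (i : ℕ) → x i = 0) →
      ∀ i : Fin n, 4 ≤ (i : ℕ) → Function.update x (Fin.castLE h j) s i = 0 := by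
    intro x j s hx i hi
    rw [Function.update_of_ne, hx i hi]
    rintro rfl
    have := j.2
    simp at hi
    omega
  have h0 : ∀ x : Fin n → ℝ, (∀ i : Fin n, 4 ≤ (i : ℕ) → x i = 0) → x (Fin.castLE h 3) = t →
      MvPolynomial.eval x (MvPolynomial.pderiv (Fin.castLE h 0) (multiaffine b)) =
        κ ∅ * x (Fin.castLE h 1) * x (Fin.castLE h 2) + κ {1} * x (Fin.castLE h 2)
          + κ {2} * x (Fin.castLE h 1) + κ {1, 2} := by
    intro x hx hxt
    refine eval_pderiv_of_affine _ _ _ (κ {0} * x (Fin.castLE h 1) * x (Fin.castLE h 2)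
      + κ {0, 1} * x (Fin.castLE h 2) + κ {0, 2} * x (Fin.castLE h 1) + κ {0, 1, 2}) _ fun s => ?_
    rw [hf _ (hup x 0 s hx) (by rw [Function.update_of_ne n03.symm, hxt])]
    simp only [Function.update_self, Function.update_of_ne n01.symm,
      Function.update_of_ne n02.symm]
    ring
  have h1 : ∀ x : Fin n → ℝ, (∀ i : Fin n, 4 ≤ (i : ℕ) → x i = 0) → x (Fin.castLE h 3) = t →
      MvPolynomial.eval x (MvPolynomial.pderiv (Fin.castLE h 1) (multiaffine b)) =
        κ ∅ * x (Fin.castLE h 0) * x (Fin.castLE h 2) + κ {0} * x (Fin.castLE h 2)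
          + κ {2} * x (Fin.castLE h 0) + κ {0, 2} := by
    intro x hx hxt
    refine eval_pderiv_of_affine _ _ _ (κ {1} * x (Fin.castLE h 0) * x (Fin.castLE h 2)
      + κ {0, 1} * x (Fin.castLE h 2) + κ {1, 2} * x (Fin.castLE h 0) + κ {0, 1, 2}) _ fun s => ?_
    rw [hf _ (hup x 1 s hx) (by rw [Function.update_of_ne n13.symm, hxt])]
    simp only [Function.update_self, Function.update_of_ne n01,
      Function.update_of_ne n12.symm]
    ring
  have h01 : ∀ x : Fin n → ℝ, (∀ i : Fin n, 4 ≤ (i : ℕ) → x i = 0) → x (Fin.castLE h 3) = t →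
      MvPolynomial.eval x (MvPolynomial.pderiv (Fin.castLE h 0)
        (MvPolynomial.pderiv (Fin.castLE h 1) (multiaffine b))) =
        κ ∅ * x (Fin.castLE h 2) + κ {2} := by
    intro x hx hxt
    refine eval_pderiv_of_affine _ _ _ (κ {0} * x (Fin.castLE h 2) + κ {0, 2}) _ fun s => ?_
    rw [h1 _ (hup x 0 s hx) (by rw [Function.update_of_ne n03.symm, hxt])]
    simp only [Function.update_self, Function.update_of_ne n02.symm]
    ring
  have hq : (asPolyIn (Fin.castLE h 2) (rayleigh (Fin.castLE h 0) (Fin.castLE h 1)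
      (multiaffine b))).map (MvPolynomial.eval (Function.update y (Fin.castLE h 3) t)) =
      Polynomial.C (κ {0, 2} * κ {1, 2} - κ {2} * κ {0, 1, 2})
      + Polynomial.C (κ {0} * κ {1, 2} + κ {1} * κ {0, 2} - κ {2} * κ {0, 1}
        - κ ∅ * κ {0, 1, 2}) * Polynomial.X
      + Polynomial.C (κ {0} * κ {1} - κ ∅ * κ {0, 1}) * Polynomial.X ^ 2 := by
    refine Polynomial.funext fun s => ?_
    have hx := hup _ 2 s (hup y 3 t hy)
    have hxt : Function.update (Function.update y (Fin.castLE h 3) t) (Fin.castLE h 2) s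
      (Fin.castLE h 3) = t := by
      rw [Function.update_of_ne n23.symm, Function.update_self]
    rw [map_asPolyIn_eval, rayleigh, map_sub, map_mul, map_mul, h0 _ hx hxt, h1 _ hx hxt,
      h01 _ hx hxt, hf _ hx hxt]
    simp only [Function.update_self, Polynomial.eval_add, Polynomial.eval_mul,
      Polynomial.eval_pow, Polynomial.eval_C, Polynomial.eval_X]
    ring
  have hd : MvPolynomial.eval (Function.update y (Fin.castLE h 3) t) (discrQuadratic
      (asPolyIn (Fin.castLE h 2) (rayleigh (Fin.castLE h 0) (Fin.castLE h 1) (multiaffine b)))) =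
      discrQuadratic ((asPolyIn (Fin.castLE h 2) (rayleigh (Fin.castLE h 0) (Fin.castLE h 1)
      (multiaffine b))).map (MvPolynomial.eval (Function.update y (Fin.castLE h 3) t))) := by
    simp [discrQuadratic]
  rw [hd, hq, discrQuadratic, hyperdet]
  simp only [Polynomial.coeff_add, Polynomial.coeff_C_mul, Polynomial.coeff_X_pow,
    Polynomial.coeff_C, Polynomial.coeff_X]
  norm_num
  ring

/-- The vanishing conditions on the quartic `Discr_{x_3}(Δ_{12} f_b)` in terms of the
hyperdeterminant of a pencil. -/
theorem restrictFour_quartic {n : ℕ} (h : 4 ≤ n) (b : Finset (Fin n) → ℝ) :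
    (restrictFour (quarticB (discrRayleigh h b)) = 0 ↔
      quarticB (hyperdet (pencil (tailCoords h b))) = 0) ∧
    (restrictFour (quarticC (discrRayleigh h b)) = 0 ↔
      quarticC (hyperdet (pencil (tailCoords h b))) = 0) ∧
    (restrictFour (quarticD (discrRayleigh h b)) = 0 ↔
      quarticD (hyperdet (pencil (tailCoords h b))) = 0) := by
  have key : ∀ (f : MvPolynomial (Fin n) ℝ) (r : ℝ), (∀ y : Fin n → ℝ,
      (∀ i : Fin n, 4 ≤ (i : ℕ) → y i = 0) → MvPolynomial.eval y f = r) →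
      (restrictFour f = 0 ↔ r = 0) := by
    intro f r hf
    have : restrictFour f = MvPolynomial.C r := by
      refine MvPolynomial.funext fun y => ?_
      rw [eval_restrictFour, MvPolynomial.eval_C]
      exact hf _ fun i hi => if_neg (by omega)
    rw [this, map_eq_zero_iff _ (MvPolynomial.C_injective _ _)]
  refine ⟨key _ _ fun y hy => ?_, key _ _ fun y hy => ?_, key _ _ fun y hy => ?_⟩
  · rw [← map_discrRayleigh h b y hy, quarticB_map]
  · rw [← map_discrRayleigh h b y hy, quarticC_map]
  · rw [← map_discrRayleigh h b y hy, quarticD_map]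

/-- The element exchanging the roles of `0` and `∞` in the coordinates `5, …, n`. -/
noncomputable def tailSwap (n : ℕ) : SLPerm n :=
  SemidirectProduct.inl fun i =>
    if (i : ℕ) < 4 then 1 else ⟨!![0, -1; 1, 0], by simp [Matrix.det_fin_two]⟩

/-- A quarter turn in each tail coordinate exchanges containing and avoiding that index. The entry
`-1` affects only sets that meet the tail, which do not occur here. -/
theorem firstCoords_act_tailSwap {n : ℕ} (h : 4 ≤ n) (b : Finset (Fin n) → ℝ) :
    firstCoords h (act (tailSwap n) b) = tailCoords h b := by
  classical
  funext U
  have hU : ∀ i : Fin n, i ∈ U.map (Fin.castLEEmb h) → (i : ℕ) < 4 := by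
    intro i hi
    obtain ⟨j, _, rfl⟩ := mem_map.1 hi
    exact j.2
  set T := U.map (Fin.castLEEmb h) with hT
  rw [firstCoords, tailCoords, act, Finset.sum_eq_single
    (T ∪ univ.filter fun i : Fin n => 4 ≤ (i : ℕ))]
  · rw [Finset.prod_eq_one, mul_one]
    intro i _
    simp only [tailSwap, SemidirectProduct.left_inl, SemidirectProduct.right_inl]
    by_cases h4 : (i : ℕ) < 4
    · have : ¬ 4 ≤ (i : ℕ) := by omega
      by_cases hi : i ∈ T <;> simp [h4, this, hi, ← hT]
    · have hi : i ∉ T := fun hi => h4 (hU i hi)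
      have : 4 ≤ (i : ℕ) := by omega
      simp [h4, this, hi, ← hT]
  · intro S _ hS
    obtain ⟨i, hi⟩ : ∃ i, ¬ (i ∈ S ↔ i ∈ T ∪ univ.filter fun i : Fin n => 4 ≤ (i : ℕ)) := by
      by_contra! hcon
      exact hS (Finset.ext hcon)
    rw [Finset.prod_eq_zero (mem_univ i), mul_zero]
    simp only [tailSwap, SemidirectProduct.left_inl, SemidirectProduct.right_inl]
    simp only [mem_union, mem_filter, mem_univ, true_and] at hi
    by_cases h4 : (i : ℕ) < 4
    · have h4' : ¬ 4 ≤ (i : ℕ) := by omega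
      by_cases hiT : i ∈ T <;> by_cases hiS : i ∈ S
      · exact absurd ⟨fun _ => Or.inl hiT, fun _ => hiS⟩ hi
      · simp [h4, hiT, hiS, ← hT]
      · simp [h4, hiT, hiS, ← hT]
      · simp_all
    · have hiT : i ∉ T := fun hi => h4 (hU i hi)
      have h4' : 4 ≤ (i : ℕ) := by omega
      have hiS : i ∉ S := fun hiS => hi ⟨fun _ => Or.inr h4', fun _ => hiS⟩
      simp [h4, hiT, hiS, ← hT]
  · simp

end PrincipalMinors

/-! ### Orbit conditions, shears and squares -/

namespace PrincipalMinors

open Finset Polynomial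

/-- The conditions of the theorem on a single vector, in terms of its first coordinates. -/
structure LocalConditions {n : ℕ} (b : Finset (Fin n) → ℝ) : Prop where
  minorQuadric_nonneg : ∀ h : 2 ≤ n, 0 ≤ minorQuadric (firstCoords h b)
  hypDet_nonpos : ∀ h : 3 ≤ n, hypDet (firstCoords h b) ≤ 0
  quartic : ∀ h : 4 ≤ n, quarticB (hyperdet (pencil (firstCoords h b))) = 0 ∧
    quarticC (hyperdet (pencil (firstCoords h b))) = 0 ∧
    quarticD (hyperdet (pencil (firstCoords h b))) = 0

/-- The conditions hold on the whole orbit of `b`. -/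
def OrbitConditions {n : ℕ} (b : Finset (Fin n) → ℝ) : Prop := ∀ γ, LocalConditions (act γ b)

theorem OrbitConditions.act {n : ℕ} {b : Finset (Fin n) → ℝ} (hb : OrbitConditions b)
    (γ : SLPerm n) : OrbitConditions (act γ b) := fun γ' => by
  rw [act_act]; exact hb _

theorem orbitConditions_iff {n : ℕ} (a : Finset (Fin n) → ℝ) :
    OrbitConditions a ↔ ∀ γ : SLPerm n,
      (∀ h : 2 ≤ n, 0 ≤ minorQuadric (firstCoords h (PrincipalMinors.act γ a))) ∧
      (∀ h : 3 ≤ n, hypDet (firstCoords h (PrincipalMinors.act γ a)) ≤ 0) ∧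
      (∀ h : 4 ≤ n,
        restrictFour (quarticB (discrRayleigh h (PrincipalMinors.act γ a))) = 0 ∧
        restrictFour (quarticC (discrRayleigh h (PrincipalMinors.act γ a))) = 0 ∧
        restrictFour (quarticD (discrRayleigh h (PrincipalMinors.act γ a))) = 0) := by
  constructor
  · intro ha γ
    refine ⟨(ha γ).1, (ha γ).2, fun h => ?_⟩
    obtain ⟨h1, h2, h3⟩ := restrictFour_quartic h (PrincipalMinors.act γ a)
    rw [h1, h2, h3, ← firstCoords_act_tailSwap, act_act]
    exact (ha _).3 h
  · intro ha γ
    refine ⟨(ha γ).1, (ha γ).2.1, fun h => ?_⟩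
    -- Conditions on tail coordinates over the whole orbit amount to conditions on first
    -- coordinates: it suffices to move `γ` by the swap.
    obtain ⟨h1, h2, h3⟩ := restrictFour_quartic h (PrincipalMinors.act (γ * (tailSwap n)⁻¹) a)
    have h4 := (ha (γ * (tailSwap n)⁻¹)).2.2 h
    rw [h1, h2, h3, ← firstCoords_act_tailSwap, act_act, inv_mul_cancel_right] at h4
    exact h4

theorem exists_perm_castLE {k n : ℕ} (h : k ≤ n) (f : Fin k → Fin n)
    (hf : Function.Injective f) : ∃ σ : Equiv.Perm (Fin n), ∀ x, σ (Fin.castLE h x) = f x := by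
  classical
  let e : {x // x ∈ Set.range (Fin.castLE h)} ≃ {x // x ∈ Set.range f} :=
    (Equiv.ofInjective _ (Fin.castLE_injective h)).symm.trans (Equiv.ofInjective f hf)
  refine ⟨e.extendSubtype, fun x => ?_⟩
  rw [Equiv.extendSubtype_apply_of_mem e _ ⟨x, rfl⟩]
  have : (Equiv.ofInjective _ (Fin.castLE_injective h)).symm
      ⟨Fin.castLE h x, ⟨x, rfl⟩⟩ = x := by
    rw [Equiv.symm_apply_eq]; rfl
  simp [e, this]

theorem firstCoords_act_perm {k n : ℕ} (h : k ≤ n) {σ : Equiv.Perm (Fin n)} {f : Fin k → Fin n}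
    (hσ : ∀ x, σ (Fin.castLE h x) = f x) (b : Finset (Fin n) → ℝ) (U : Finset (Fin k)) :
    firstCoords h (act (SemidirectProduct.inr σ) b) U = b (U.image f) := by
  rw [firstCoords, act_perm]
  congr 1
  ext i
  simp only [mem_map, mem_image, exists_exists_and_eq_and, Fin.castLEEmb_apply,
    Equiv.coe_toEmbedding, hσ]

theorem OrbitConditions.pairDefect_nonneg {n : ℕ} {b : Finset (Fin n) → ℝ}
    (hb : OrbitConditions b) (h0 : b ∅ = 1) {i j : Fin n} (hij : i ≠ j) :
    0 ≤ pairDefect b i j := by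
  have h2 : 2 ≤ n := by
    have := Fintype.one_lt_card_iff.2 ⟨i, j, hij⟩
    rwa [Fintype.card_fin] at this
  obtain ⟨σ, hσ⟩ := exists_perm_castLE h2 ![i, j] (by
    intro x y hxy
    fin_cases x <;> fin_cases y <;> simp_all)
  have h := (hb (SemidirectProduct.inr σ)).1 h2
  rw [minorQuadric, firstCoords_act_perm h2 hσ, firstCoords_act_perm h2 hσ,
    firstCoords_act_perm h2 hσ, firstCoords_act_perm h2 hσ] at h
  simpa [pairDefect, h0, image_insert] using h

/-- The derivative at `t = 0` of the restriction to subsets not containing `w` of `shear w t b`. -/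
def shearSlope {n : ℕ} (w : Fin n) (b : Finset (Fin n) → ℝ) (T : Finset (Fin n)) : ℝ :=
  b (insert w T) - b {w} * b T

/-- The element of `SL₂` with the given entries. -/
def specialLinearOfEntries (p q r s : ℝ) (h : p * s - q * r = 1) :
    Matrix.SpecialLinearGroup (Fin 2) ℝ :=
  ⟨!![p, q; r, s], by rw [Matrix.det_fin_two]; exact h⟩

theorem act_specialLinearOfEntries_of_notMem {n : ℕ} {w : Fin n} {T : Finset (Fin n)} (hw : w ∉ T)
    {p q r s : ℝ} (h : p * s - q * r = 1) (b : Finset (Fin n) → ℝ) :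
    act (SemidirectProduct.inl (Pi.mulSingle w (specialLinearOfEntries p q r s h))) b T =
      b T * p + b (insert w T) * r := by
  rw [act_mulSingle, erase_eq_of_notMem hw, if_neg hw]
  rfl

theorem act_specialLinearOfEntries_insert {n : ℕ} {w : Fin n} {T : Finset (Fin n)} (hw : w ∉ T)
    {p q r s : ℝ} (h : p * s - q * r = 1) (b : Finset (Fin n) → ℝ) :
    act (SemidirectProduct.inl (Pi.mulSingle w (specialLinearOfEntries p q r s h))) b
      (insert w T) = b T * q + b (insert w T) * s := by
  rw [act_mulSingle, erase_insert hw, insert_idem, if_pos (mem_insert_self w T)]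
  rfl

/-- A family of elements of the orbit of `b`, with the same coordinate at `∅`. -/
noncomputable def shear {n : ℕ} (w : Fin n) (t : ℝ) (b : Finset (Fin n) → ℝ) :
    Finset (Fin n) → ℝ :=
  act (SemidirectProduct.inl (Pi.mulSingle w
    (specialLinearOfEntries (1 - t * b {w}) (-b {w}) t 1 (by ring)))) b

/-- For the minors of a Hermitian matrix with block `A₀` and border `v` at `w`, these are the minors
of `A₀ - t v v*`. This affine family is what the induction hypothesis is applied to. -/
theorem shear_of_notMem {n : ℕ} {w : Fin n} (t : ℝ) (b : Finset (Fin n) → ℝ)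
    {T : Finset (Fin n)} (hw : w ∉ T) : shear w t b T = b T + t * shearSlope w b T := by
  rw [shear, act_specialLinearOfEntries_of_notMem hw, shearSlope]
  ring

theorem shear_insert {n : ℕ} {w : Fin n} (t : ℝ) (b : Finset (Fin n) → ℝ)
    {T : Finset (Fin n)} (hw : w ∉ T) : shear w t b (insert w T) = shearSlope w b T := by
  rw [shear, act_specialLinearOfEntries_insert hw, shearSlope]
  ring

/-- The composition of `shear w u` with the inversion of the coordinate `w`. -/
noncomputable def reverseShear {n : ℕ} (w : Fin n) (u : ℝ) (b : Finset (Fin n) → ℝ) :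
    Finset (Fin n) → ℝ :=
  act (SemidirectProduct.inl (Pi.mulSingle w
    (specialLinearOfEntries (b {w}) (1 - u * b {w}) (-1) u (by ring)))) b

/-- Together with the coordinates on sets containing `w`, this makes the pencil of `reverseShear w u
b` equal to the shear polynomials at `u - X`. Its constant coefficient is thus the value at `u`,
which can be chosen away from a zero. -/
theorem reverseShear_of_notMem {n : ℕ} {w : Fin n} (u : ℝ) (b : Finset (Fin n) → ℝ)
    {T : Finset (Fin n)} (hw : w ∉ T) : reverseShear w u b T = -shearSlope w b T := by
  rw [reverseShear, act_specialLinearOfEntries_of_notMem hw, shearSlope]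
  ring

theorem reverseShear_insert {n : ℕ} {w : Fin n} (u : ℝ) (b : Finset (Fin n) → ℝ)
    {T : Finset (Fin n)} (hw : w ∉ T) :
    reverseShear w u b (insert w T) = b T + u * shearSlope w b T := by
  rw [reverseShear, act_specialLinearOfEntries_insert hw, shearSlope]
  ring

theorem OrbitConditions.shear {n : ℕ} {b : Finset (Fin n) → ℝ} (hb : OrbitConditions b)
    (w : Fin n) (t : ℝ) : OrbitConditions (shear w t b) := hb.act _

theorem OrbitConditions.reverseShear {n : ℕ} {b : Finset (Fin n) → ℝ} (hb : OrbitConditions b)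
    (w : Fin n) (t : ℝ) : OrbitConditions (reverseShear w t b) := hb.act _

theorem shearSlope_empty {n : ℕ} {w : Fin n} {b : Finset (Fin n) → ℝ} (h0 : b ∅ = 1) :
    shearSlope w b ∅ = 0 := by
  simp [shearSlope, h0]

theorem shear_empty {n : ℕ} (w : Fin n) (t : ℝ) {b : Finset (Fin n) → ℝ} (h0 : b ∅ = 1) :
    shear w t b ∅ = 1 := by
  rw [shear_of_notMem t b (notMem_empty w), shearSlope_empty h0, h0]
  simp

/-- The coordinates of `shear w t b` as polynomials in `t`. -/
noncomputable def shearPoly {n : ℕ} (w : Fin n) (b : Finset (Fin n) → ℝ) (T : Finset (Fin n)) :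
    ℝ[X] := C (b T) + C (shearSlope w b T) * X

theorem eval_shearPoly {n : ℕ} {w : Fin n} (t : ℝ) (b : Finset (Fin n) → ℝ)
    {T : Finset (Fin n)} (hw : w ∉ T) : (shearPoly w b T).eval t = shear w t b T := by
  rw [shear_of_notMem t b hw, shearPoly]
  simp
  ring

/-- With nonzero constant term the first three coefficients determine the candidate `1 + βX + κX²`.
The vanishing of `C` and of `D` then says precisely that the cubic and the quartic coefficients
agree; `B` is not needed. -/
theorem quartic_eq_mul_sq {p : ℝ[X]} (hdeg : p.natDegree ≤ 4) (h0 : p.coeff 0 ≠ 0)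
    (hC : quarticC p = 0) (hD : quarticD p = 0) : ∃ r : ℝ[X], p = C (p.coeff 0) * r ^ 2 := by
  have hp : p = C (p.coeff 0) + C (p.coeff 1) * X + C (p.coeff 2) * X ^ 2 + C (p.coeff 3) * X ^ 3
      + C (p.coeff 4) * X ^ 4 := by
    conv_lhs => rw [p.as_sum_range_C_mul_X_pow' (n := 5) (by omega)]
    simp [Finset.sum_range_succ]
  unfold quarticC at hC
  unfold quarticD at hD
  generalize p.coeff 0 = b0 at *
  generalize p.coeff 1 = b1 at *
  generalize p.coeff 2 = b2 at *
  generalize p.coeff 3 = b3 at *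
  generalize p.coeff 4 = b4 at *
  obtain ⟨β, rfl⟩ : ∃ β, b1 = b0 * (2 * β) := ⟨b1 / (2 * b0), by field_simp⟩
  obtain ⟨κ, rfl⟩ : ∃ κ, b2 = b0 * (β ^ 2 + 2 * κ) :=
    ⟨(b2 / b0 - β ^ 2) / 2, by field_simp; ring⟩
  have h3 : b3 = b0 * (2 * β * κ) := by
    have : 8 * b0 ^ 2 * (b3 - b0 * (2 * β * κ)) = 0 := by linear_combination hC
    rcases mul_eq_zero.1 this with h | h
    · exact absurd h (by positivity)
    · linarith
  subst h3
  have h4 : b4 = b0 * κ ^ 2 := by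
    have : 16 * b0 ^ 2 * (b4 - b0 * κ ^ 2) = 0 := by linear_combination hD
    rcases mul_eq_zero.1 this with h | h
    · exact absurd h (by positivity)
    · linarith
  subst h4
  refine ⟨1 + C β * X + C κ * X ^ 2, ?_⟩
  rw [hp]
  simp only [C_mul, C_add, C_pow, map_ofNat]
  ring

theorem natDegree_hyperdet_le {a : Finset (Fin 3) → ℝ[X]} (ha : ∀ U, (a U).natDegree ≤ 1) :
    (hyperdet a).natDegree ≤ 4 := by
  have h2 : ∀ U U', (a U * a U').natDegree ≤ 2 := fun U U' => by
    refine natDegree_mul_le.trans ?_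
    have := ha U
    have := ha U'
    omega
  have hs : ∀ {p q : ℝ[X]} {d : ℕ}, p.natDegree ≤ d → q.natDegree ≤ d → (p - q).natDegree ≤ d :=
    fun hp hq => (natDegree_sub_le _ _).trans (max_le hp hq)
  have hadd : ∀ {p q : ℝ[X]} {d : ℕ}, p.natDegree ≤ d → q.natDegree ≤ d →
      (p + q).natDegree ≤ d := fun hp hq => (natDegree_add_le _ _).trans (max_le hp hq)
  unfold hyperdet
  refine hs ?_ ?_
  · refine natDegree_pow_le.trans ?_
    have := hs (hs (hadd (h2 {0} {1, 2}) (h2 {1} {0, 2})) (h2 {2} {0, 1})) (h2 ∅ {0, 1, 2})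
    omega
  · refine natDegree_mul_le.trans ?_
    have h3 : (4 * (a {0} * a {1} - a ∅ * a {0, 1})).natDegree ≤ 2 := by
      refine natDegree_mul_le.trans ?_
      have := hs (h2 {0} {1}) (h2 ∅ {0, 1})
      rw [natDegree_ofNat]
      omega
    have := hs (h2 {0, 2} {1, 2}) (h2 {2} {0, 1, 2})
    omega

theorem hyperdet_comp (a : Finset (Fin 3) → ℝ[X]) (q : ℝ[X]) :
    (hyperdet a).comp q = hyperdet fun U => (a U).comp q := by
  simp [hyperdet]

/-- For a vector whose orbit satisfies the conditions, the discriminants of the triples are squares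
along shears. -/
theorem OrbitConditions.exists_sq {n : ℕ} {b : Finset (Fin n) → ℝ}
    (hb : OrbitConditions b) (h0 : b ∅ = 1) {i j k w : Fin n} (hij : i ≠ j) (hjk : j ≠ k)
    (hik : i ≠ k) (hiw : i ≠ w) (hjw : j ≠ w) (hkw : k ≠ w) :
    ∃ s : ℝ[X], 4 * (pairDefect (shearPoly w b) i j * pairDefect (shearPoly w b) j k *
      pairDefect (shearPoly w b) i k) - tripleDefect (shearPoly w b) i j k ^ 2 = s ^ 2 := by
  classical
  have hinj4 : Function.Injective ![i, j, k, w] := by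
    intro x y hxy
    fin_cases x <;> fin_cases y <;> simp_all
  have hinj3 : Function.Injective ![i, j, k] := by
    intro x y hxy
    fin_cases x <;> fin_cases y <;> simp_all
  have h4 : 4 ≤ n := by simpa using Fintype.card_le_of_injective _ hinj4
  have h3 : 3 ≤ n := by omega
  obtain ⟨σ₄, hσ₄⟩ := exists_perm_castLE h4 _ hinj4
  obtain ⟨σ₃, hσ₃⟩ := exists_perm_castLE h3 _ hinj3
  set H : ℝ[X] := hyperdet fun U => shearPoly w b (U.image ![i, j, k]) with hH
  have hwU : ∀ U : Finset (Fin 3), w ∉ U.image ![i, j, k] := by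
    intro U hU
    obtain ⟨x, _, hx⟩ := mem_image.1 hU
    fin_cases x <;> simp_all
  have hHle : ∀ u, H.eval u ≤ 0 := by
    intro u
    have := (hb.shear w u (SemidirectProduct.inr σ₃)).2 h3
    rw [hH, eval_hyperdet]
    simp_rw [eval_shearPoly u b (hwU _)]
    convert this using 1
    change _ = hyperdet _
    congr 1
    funext U
    rw [firstCoords_act_perm h3 hσ₃]
  have hHdeg : H.natDegree ≤ 4 := natDegree_hyperdet_le fun U => by
    rw [shearPoly, add_comm]; exact natDegree_linear_le
  -- The quartic condition is applied to all translates of `H`, each realised in the orbit by a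
  -- reversed shear.
  have hpencil : ∀ u : ℝ, quarticC (H.comp (C u - X)) = 0 ∧ quarticD (H.comp (C u - X)) = 0 := by
    intro u
    have := (hb.reverseShear w u (SemidirectProduct.inr σ₄)).3 h4
    convert this.2 using 3 <;> rw [hH, hyperdet_comp] <;> congr 1 <;> funext U
    all_goals
      have e1 : (U.map Fin.castSuccEmb).image ![i, j, k, w] = U.image ![i, j, k] := by
        ext x
        simp only [mem_image, mem_map, Fin.castSuccEmb_apply, exists_exists_and_eq_and]
        refine exists_congr fun y => and_congr_right fun _ => ?_
        fin_cases y <;> rfl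
      have e2 : (insert 3 (U.map Fin.castSuccEmb)).image ![i, j, k, w] =
          insert w (U.image ![i, j, k]) := by
        rw [image_insert, e1]; rfl
      rw [pencil, firstCoords_act_perm h4 hσ₄, firstCoords_act_perm h4 hσ₄, e1, e2,
        reverseShear_of_notMem u b (hwU U), reverseShear_insert u b (hwU U), shearPoly]
      simp only [add_comp, C_comp, mul_comp, X_comp, C_add, C_mul, C_neg]
      ring
  have hmain : ∃ s : ℝ[X], -H = s ^ 2 := by
    by_cases hH0 : H = 0
    · exact ⟨0, by simp [hH0]⟩
    obtain ⟨u, hu⟩ : ∃ u, H.eval u ≠ 0 := by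
      by_contra! h
      exact hH0 (Polynomial.funext fun t => by simp [h t])
    have hc0 : (H.comp (C u - X)).coeff 0 = H.eval u := by
      rw [coeff_zero_eq_eval_zero, eval_comp]; simp
    have hdeg : (H.comp (C u - X)).natDegree ≤ 4 := by
      refine natDegree_comp_le.trans ?_
      have : (C u - X : ℝ[X]).natDegree ≤ 1 := by
        refine (natDegree_sub_le _ _).trans ?_
        simp
      nlinarith
    obtain ⟨r, hr⟩ := quartic_eq_mul_sq hdeg (by rwa [hc0]) (hpencil u).1 (hpencil u).2
    rw [hc0] at hr
    refine ⟨C (Real.sqrt (-H.eval u)) * r.comp (C u - X), ?_⟩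
    have h5 := congrArg (fun p : ℝ[X] => p.comp (C u - X)) hr
    have h6 : (C u - X : ℝ[X]).comp (C u - X) = X := by simp
    simp only [comp_assoc, h6, comp_X, mul_comp, C_comp, pow_comp] at h5
    -- Nonpositivity of the hyperdeterminant makes `-H.eval u` a real square, so that the scalar
    -- factor is absorbed.
    rw [mul_pow, ← C_pow, Real.sq_sqrt (by have := hHle u; linarith)]
    conv_lhs => rw [h5]
    rw [C_neg]
    ring
  obtain ⟨s, hs⟩ := hmain
  refine ⟨s, ?_⟩
  rw [← hs, hH, hyperdet]
  have e0 : shearPoly w b ∅ = 1 := by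
    rw [shearPoly, shearSlope_empty h0, h0]; simp
  simp [image_insert, e0, pairDefect, tripleDefect]
  ring

end PrincipalMinors

/-! ### Induction on the index set -/

namespace PrincipalMinors

open Finset Polynomial

/-- The coordinates of `b` indexed by subsets of `V` are the principal minors of a Hermitian
matrix. -/
def IsMinorVectorOn {n : ℕ} (V : Finset (Fin n)) (b : Finset (Fin n) → ℝ) : Prop :=
  ∃ A : Matrix (Fin n) (Fin n) ℂ, A.IsHermitian ∧ ∀ S ⊆ V, pminor A S = b S

theorem ofReal_re_pminor {ι : Type*} [DecidableEq ι] {A : Matrix ι ι ℂ} (hA : A.IsHermitian)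
    (S : Finset ι) : (((pminor A S).re : ℝ) : ℂ) = pminor A S := by
  refine Complex.conj_eq_iff_re.1 ?_
  rw [pminor, starRingEnd_apply, ← Matrix.det_conjTranspose, Matrix.conjTranspose_submatrix, hA.eq]

/-- The inverse shear at `w ∈ V` involves only subsets of `V`. It can therefore be applied to the
full minor vector of the given matrix, whose coordinates on other sets are uncontrolled. -/
theorem IsMinorVectorOn.of_shear {n : ℕ} {V : Finset (Fin n)} {w : Fin n} (hw : w ∈ V) {t : ℝ}
    {b : Finset (Fin n) → ℝ} (h0 : b ∅ = 1) (hb : IsMinorVectorOn V (shear w t b)) :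
    IsMinorVectorOn V b := by
  obtain ⟨A, hA, hAS⟩ := hb
  set M := specialLinearOfEntries (1 - t * b {w}) (-b {w}) t 1 (by ring) with hM
  set a : Finset (Fin n) → ℝ := fun S => (pminor A S).re with ha
  have haS : ∀ S ⊆ V, a S = shear w t b S := fun S hS => by
    rw [ha]; simp only [hAS S hS, Complex.ofReal_re]
  have hinv : ∀ S ⊆ V, act (SemidirectProduct.inl (Pi.mulSingle w M⁻¹)) a S = b S := by
    intro S hS
    rw [act_mulSingle, haS _ ((erase_subset _ _).trans hS), haS _ (insert_subset hw hS),
      ← act_mulSingle, Pi.mulSingle_inv, map_inv, shear, act_inv_act]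
  have hempty := hinv ∅ (empty_subset V)
  rw [h0] at hempty
  obtain ⟨H, hH, hHS⟩ := hermitian_transform (a := a) (c := 1) hA
    (fun S => by rw [Complex.ofReal_one, one_mul]; exact ofReal_re_pminor hA S)
    (SemidirectProduct.inl (Pi.mulSingle w M⁻¹)) (by rw [hempty]; exact one_ne_zero)
  refine ⟨H, hH, fun S hS => ?_⟩
  rw [← hinv S hS, hHS S, hempty, Complex.ofReal_one, one_mul]

theorem pairDefect_shear {n : ℕ} {v i k : Fin n} (hi : i ≠ v) (hk : k ≠ v) (τ : ℝ)
    (b : Finset (Fin n) → ℝ) :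
    pairDefect (shear v τ b) i k = (pairDefect (shearPoly v b) i k).eval τ := by
  have h := map_pairDefect (evalRingHom τ) (shearPoly v b) i k
  rw [coe_evalRingHom] at h
  rw [h, pairDefect, pairDefect, eval_shearPoly τ b (by simpa using hi.symm),
    eval_shearPoly τ b (by simpa using hk.symm),
    eval_shearPoly τ b (by simpa using ⟨hi.symm, hk.symm⟩)]

/-- A shear at `v` cannot change which pairs containing `v` have vanishing defect. -/
theorem pairDefect_shear_self {n : ℕ} {v i : Fin n} (hi : i ≠ v) (τ : ℝ)
    {b : Finset (Fin n) → ℝ} (h0 : b ∅ = 1) :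
    pairDefect (shear v τ b) v i = pairDefect b v i := by
  have h1 : shear v τ b {v} = 0 := by
    rw [← insert_empty_eq, shear_insert τ b (notMem_empty v), shearSlope_empty h0]
  rw [pairDefect, h1, shear_insert τ b (by simpa using hi.symm), shearSlope, pairDefect]
  ring

theorem eval_zero_pairDefect_shearPoly {n : ℕ} {v i k : Fin n}
    (b : Finset (Fin n) → ℝ) : (pairDefect (shearPoly v b) i k).eval 0 = pairDefect b i k := by
  simp [pairDefect, shearPoly]

/-- The number of pairs in `V` with vanishing defect. -/
noncomputable def zeroPairs {n : ℕ} (V : Finset (Fin n)) (b : Finset (Fin n) → ℝ) : ℕ :=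
  #{p ∈ V.offDiag | pairDefect b p.1 p.2 = 0}

/-- A generic `τ` avoids the zeros of all the nonzero defect polynomials at once. No new vanishing
pair arises, and `(i, k)` ceases to vanish. -/
theorem exists_zeroPairs_lt {n : ℕ} {V : Finset (Fin n)} {v i k : Fin n} (hiV : i ∈ V)
    (hkV : k ∈ V) (hik : i ≠ k) (hi : i ≠ v) (hk : k ≠ v) {b : Finset (Fin n) → ℝ} (h0 : b ∅ = 1)
    (hb : pairDefect b i k = 0) (hne : pairDefect (shearPoly v b) i k ≠ 0) :
    ∃ τ, zeroPairs V (shear v τ b) < zeroPairs V b := by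
  classical
  have hP : ∏ p ∈ V.offDiag with pairDefect (shearPoly v b) p.1 p.2 ≠ 0,
      pairDefect (shearPoly v b) p.1 p.2 ≠ 0 :=
    prod_ne_zero_iff.2 fun p hp => (mem_filter.1 hp).2
  obtain ⟨τ, hτ⟩ : ∃ τ, (∏ p ∈ V.offDiag with pairDefect (shearPoly v b) p.1 p.2 ≠ 0,
      pairDefect (shearPoly v b) p.1 p.2).eval τ ≠ 0 := by
    by_contra! h
    exact hP (Polynomial.funext fun t => by simp [h t])
  rw [eval_prod, prod_ne_zero_iff] at hτ
  refine ⟨τ, card_lt_card ((ssubset_iff_of_subset ?_).2 ⟨(i, k), ?_, ?_⟩)⟩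
  · intro p hp
    obtain ⟨hpV, hp0⟩ := mem_filter.1 hp
    refine mem_filter.2 ⟨hpV, ?_⟩
    have hp12 : p.1 ≠ p.2 := (mem_offDiag.1 hpV).2.2
    by_cases h1 : p.1 = v
    · rwa [h1, pairDefect_shear_self (by rw [← h1]; exact hp12.symm) τ h0, ← h1] at hp0
    by_cases h2 : p.2 = v
    · rwa [pairDefect_comm, h2, pairDefect_shear_self h1 τ h0, ← h2, pairDefect_comm] at hp0
    rw [pairDefect_shear h1 h2] at hp0
    by_cases hQ : pairDefect (shearPoly v b) p.1 p.2 = 0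
    · rw [← eval_zero_pairDefect_shearPoly (v := v), hQ, eval_zero]
    · exact absurd hp0 (hτ p (mem_filter.2 ⟨hpV, hQ⟩))
  · exact mem_filter.2 ⟨mem_offDiag.2 ⟨hiV, hkV, hik⟩, hb⟩
  · intro h
    have h' := (mem_filter.1 h).2
    rw [pairDefect_shear hi hk] at h'
    exact hτ (i, k) (mem_filter.2 ⟨mem_offDiag.2 ⟨hiV, hkV, hik⟩, hne⟩) h'

theorem coeff_two_pairDefect_shearPoly {n : ℕ} {j i k : Fin n} (b : Finset (Fin n) → ℝ) :
    (pairDefect (shearPoly j b) i k).coeff 2 = pairDefect b j i * pairDefect b j k := by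
  have : pairDefect (shearPoly j b) i k = C (pairDefect b j i * pairDefect b j k) * X ^ 2 +
      (C (b {i} * shearSlope j b {k} + b {k} * shearSlope j b {i} - shearSlope j b {i, k}) * X +
        C (b {i} * b {k} - b {i, k})) := by
    simp only [pairDefect, shearPoly, shearSlope, C_mul, C_add, C_sub]
    ring
  rw [this, coeff_add, coeff_C_mul_X_pow, if_pos rfl, coeff_eq_zero_of_natDegree_lt (n := 2),
    add_zero]
  exact natDegree_linear_le.trans_lt (by norm_num)

/-- A vector whose orbit satisfies the conditions is a vector of principal minors. -/
theorem isMinorVectorOn_of_orbitConditions {n : ℕ} (V : Finset (Fin n)) :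
    ∀ b : Finset (Fin n) → ℝ, b ∅ = 1 → OrbitConditions b → IsMinorVectorOn V b := by
  classical
  induction V using Finset.induction_on with
  | empty =>
    intro b h0 _
    refine ⟨0, Matrix.isHermitian_zero, fun S hS => ?_⟩
    rw [subset_empty.1 hS, pminor_empty, h0, Complex.ofReal_one]
  | insert w V hw ih =>
    intro b
    induction hm : zeroPairs V b using Nat.strong_induction_on generalizing b with
    | _ m ihm =>
    intro h0 hb
    -- If a shear can make some vanishing defect nonzero, the inner induction hypothesis applies to
    -- the sheared vector.
    have hshrink : ∀ v ∈ insert w V, ∀ i ∈ V, ∀ k ∈ V, i ≠ k → i ≠ v → k ≠ v →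
        pairDefect b i k = 0 → pairDefect (shearPoly v b) i k ≠ 0 →
        IsMinorVectorOn (insert w V) b := by
      intro v hv i hi k hk hik hiv hkv hq hQ
      obtain ⟨τ, hτ⟩ := exists_zeroPairs_lt hi hk hik hiv hkv h0 hq hQ
      exact (ihm _ (hm ▸ hτ) (shear v τ b) rfl (shear_empty v τ h0) (hb.shear v τ)).of_shear hv h0
    have hne : ∀ {x}, x ∈ V → x ≠ w := fun hx h => hw (h ▸ hx)
    by_cases hB : ∃ i ∈ V, ∃ k ∈ V, i ≠ k ∧ pairDefect b i k = 0 ∧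
        pairDefect (shearPoly w b) i k ≠ 0
    · obtain ⟨i, hi, k, hk, hik, hq, hQ⟩ := hB
      exact hshrink w (mem_insert_self w V) i hi k hk hik (hne hi) (hne hk) hq hQ
    by_cases hA : ∃ i ∈ V, ∃ j ∈ V, ∃ k ∈ V, i ≠ j ∧ j ≠ k ∧ i ≠ k ∧ pairDefect b i j ≠ 0 ∧
        pairDefect b j k ≠ 0 ∧ pairDefect b i k = 0
    · obtain ⟨i, hi, j, hj, k, hk, hij, hjk, hik, h1, h2, h3⟩ := hA
      -- A failure of transitivity at `j` is repaired by a shear at `j`: the defect of `(i, k)`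
      -- acquires the quadratic coefficient `pairDefect b j i * pairDefect b j k`.
      refine hshrink j (mem_insert_of_mem hj) i hi k hk hik hij hjk.symm h3 fun h => ?_
      have h4 := coeff_two_pairDefect_shearPoly (j := j) (i := i) (k := k) b
      rw [h, coeff_zero, pairDefect_comm b j i] at h4
      exact mul_ne_zero h1 h2 h4.symm
    push Not at hA hB
    -- Now defects vanishing at `t = 0` vanish identically along the shear at `w`, so transitivity
    -- for `b` passes to the defect polynomials.
    obtain ⟨β, hβ, hβm⟩ := exists_hermitian_polynomial (V := V) (α := shearPoly w b)
      (fun t => by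
        obtain ⟨B, hB, hBS⟩ := ih (shear w t b) (shear_empty w t h0) (hb.shear w t)
        exact ⟨B, hB, fun S hS => by rw [hBS S hS, eval_shearPoly t b fun h => hw (hS h)]⟩)
      (fun i hi j hj k hk hij hjk hik h1 h2 h => by
        refine hA i hi j hj k hk hij hjk hik (fun h' => h1 (hB i hi j hj hij h'))
          (fun h' => h2 (hB j hj k hk hjk h')) ?_
        rw [← eval_zero_pairDefect_shearPoly (v := w), h, eval_zero])
      (fun i hi j hj k hk hij hjk hik => hb.exists_sq h0 hij hjk hik (hne hi) (hne hj) (hne hk))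
    refine exists_bordered hw hβ (fun S hS => hβm S hS) fun j hj => ?_
    have := hb.pairDefect_nonneg h0 (hne hj).symm
    rw [pairDefect] at this
    linarith

end PrincipalMinors

/-! ### Hyperdeterminants of principal minors -/

namespace PrincipalMinors

open Finset Polynomial

theorem hyperdet_smul {R : Type*} [CommRing R] (c : R) (a : Finset (Fin 3) → R) :
    hyperdet (fun U => c * a U) = c ^ 4 * hyperdet a := by
  simp only [hyperdet]
  ring

/-- The square of the sum of the two oriented 3-cycle products minus four times their product. -/
theorem hyperdet_pminor {R : Type*} [CommRing R] (K : Matrix (Fin 3) (Fin 3) R) :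
    hyperdet (pminor K) = (K 0 1 * K 1 2 * K 2 0 - K 0 2 * K 2 1 * K 1 0) ^ 2 := by
  rw [hyperdet, pminor_singleton, pminor_singleton, pminor_singleton, pminor_empty,
    pminor_pair K (by decide), pminor_pair K (by decide), pminor_pair K (by decide),
    pminor_triple K (by decide) (by decide) (by decide)]
  ring

theorem det_fin_four {R : Type*} [CommRing R] (K : Matrix (Fin 4) (Fin 4) R) :
    K.det = K 0 0 *
        (K 1 1 * K 2 2 * K 3 3 - K 1 1 * K 2 3 * K 3 2 - K 1 2 * K 2 1 * K 3 3
          + K 1 2 * K 2 3 * K 3 1 + K 1 3 * K 2 1 * K 3 2 - K 1 3 * K 2 2 * K 3 1) - K 0 1 *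
        (K 1 0 * K 2 2 * K 3 3 - K 1 0 * K 2 3 * K 3 2 - K 1 2 * K 2 0 * K 3 3
          + K 1 2 * K 2 3 * K 3 0 + K 1 3 * K 2 0 * K 3 2 - K 1 3 * K 2 2 * K 3 0) + K 0 2 *
        (K 1 0 * K 2 1 * K 3 3 - K 1 0 * K 2 3 * K 3 1 - K 1 1 * K 2 0 * K 3 3
          + K 1 1 * K 2 3 * K 3 0 + K 1 3 * K 2 0 * K 3 1 - K 1 3 * K 2 1 * K 3 0) - K 0 3 *
        (K 1 0 * K 2 1 * K 3 2 - K 1 0 * K 2 2 * K 3 1 - K 1 1 * K 2 0 * K 3 2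
          + K 1 1 * K 2 2 * K 3 0 + K 1 2 * K 2 0 * K 3 1 - K 1 2 * K 2 1 * K 3 0) := by
  rw [Matrix.det_succ_row_zero, Fin.sum_univ_four, Matrix.det_fin_three, Matrix.det_fin_three,
    Matrix.det_fin_three, Matrix.det_fin_three]
  change (-1) ^ 0 * K 0 0 *
        (K 1 1 * K 2 2 * K 3 3 - K 1 1 * K 2 3 * K 3 2 - K 1 2 * K 2 1 * K 3 3
          + K 1 2 * K 2 3 * K 3 1 + K 1 3 * K 2 1 * K 3 2 - K 1 3 * K 2 2 * K 3 1)
    + (-1) ^ 1 * K 0 1 *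
        (K 1 0 * K 2 2 * K 3 3 - K 1 0 * K 2 3 * K 3 2 - K 1 2 * K 2 0 * K 3 3
          + K 1 2 * K 2 3 * K 3 0 + K 1 3 * K 2 0 * K 3 2 - K 1 3 * K 2 2 * K 3 0)
    + (-1) ^ 2 * K 0 2 *
        (K 1 0 * K 2 1 * K 3 3 - K 1 0 * K 2 3 * K 3 1 - K 1 1 * K 2 0 * K 3 3
          + K 1 1 * K 2 3 * K 3 0 + K 1 3 * K 2 0 * K 3 1 - K 1 3 * K 2 1 * K 3 0)
    + (-1) ^ 3 * K 0 3 *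
        (K 1 0 * K 2 1 * K 3 2 - K 1 0 * K 2 2 * K 3 1 - K 1 1 * K 2 0 * K 3 2
          + K 1 1 * K 2 2 * K 3 0 + K 1 2 * K 2 0 * K 3 1 - K 1 2 * K 2 1 * K 3 0) = _
  ring

/-- Minors containing the last index are `K 3 3` times minors of the Schur complement, which
suggests `K 3 3 ^ 4` times the square of a difference of 3-cycles. The terms with `K 3 3 ^ (-3)`
agree for both orientations and cancel, so the root is a polynomial, quadratic in `K 3 3`. -/
theorem hyperdet_pminor_insert {R : Type*} [CommRing R] (K : Matrix (Fin 4) (Fin 4) R) :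
    hyperdet (fun U => pminor K (insert 3 (U.map Fin.castSuccEmb))) =
      (K 3 3 ^ 2 * (K 0 1 * K 1 2 * K 2 0 - K 0 2 * K 2 1 * K 1 0)
        - K 3 3 * (K 0 3 * K 3 1 * K 1 2 * K 2 0 + K 0 1 * K 1 3 * K 3 2 * K 2 0
          + K 0 1 * K 1 2 * K 2 3 * K 3 0 - K 0 3 * K 3 2 * K 2 1 * K 1 0
          - K 0 2 * K 2 3 * K 3 1 * K 1 0 - K 0 2 * K 2 1 * K 1 3 * K 3 0)
        + (K 0 3 * K 3 1 * K 1 3 * K 3 2 * K 2 0 + K 0 3 * K 3 1 * K 1 2 * K 2 3 * K 3 0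
          + K 0 1 * K 1 3 * K 3 2 * K 2 3 * K 3 0 - K 0 3 * K 3 2 * K 2 3 * K 3 1 * K 1 0
          - K 0 3 * K 3 2 * K 2 1 * K 1 3 * K 3 0
            - K 0 2 * K 2 3 * K 3 1 * K 1 3 * K 3 0)) ^ 2 := by
  have h4 : pminor K {3, 0, 1, 2} = K.det := by
    rw [show ({3, 0, 1, 2} : Finset (Fin 4)) = univ.image id by decide,
      pminor_image _ _ Function.injective_id, Matrix.submatrix_id_id]
  rw [hyperdet]
  simp only [map_insert, map_singleton, map_empty, Fin.castSuccEmb_apply]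
  change (pminor K {3, 0} * pminor K {3, 1, 2} + pminor K {3, 1} * pminor K {3, 0, 2} -
    pminor K {3, 2} * pminor K {3, 0, 1} - pminor K {3} * pminor K {3, 0, 1, 2}) ^ 2 -
    4 * (pminor K {3, 0} * pminor K {3, 1} - pminor K {3} * pminor K {3, 0, 1}) *
    (pminor K {3, 0, 2} * pminor K {3, 1, 2} - pminor K {3, 2} * pminor K {3, 0, 1, 2}) = _
  rw [h4, pminor_singleton, pminor_pair K (by decide), pminor_pair K (by decide),
    pminor_pair K (by decide), pminor_triple K (by decide) (by decide) (by decide),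
    pminor_triple K (by decide) (by decide) (by decide),
    pminor_triple K (by decide) (by decide) (by decide), det_fin_four]
  ring

end PrincipalMinors

/-! ### The local conditions for principal minors -/

namespace PrincipalMinors

open Finset Polynomial

theorem pminor_submatrix {ι κ R : Type*} [DecidableEq ι] [DecidableEq κ] [CommRing R]
    (A : Matrix ι ι R) (f : κ ↪ ι) (U : Finset κ) :
    pminor (A.submatrix f f) U = pminor A (U.map f) := by
  rw [pminor_eq_det_of_equiv A (Equiv.ofBijective
    (fun i : U => (⟨f i, mem_map_of_mem f i.2⟩ : U.map f))
    ⟨fun i j h => Subtype.ext (f.injective (congrArg Subtype.val h)), fun ⟨x, hx⟩ => by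
      obtain ⟨i, hi, rfl⟩ := mem_map.1 hx
      exact ⟨⟨i, hi⟩, rfl⟩⟩)]
  rfl

theorem map_hyperdet {R R' : Type*} [CommRing R] [CommRing R'] (f : R →+* R')
    (a : Finset (Fin 3) → R) : f (hyperdet a) = hyperdet fun U => f (a U) := by
  simp [hyperdet, map_ofNat]

/-- Adding `X` to the corner entry of `K` produces the pencil, so the root in
`hyperdet_pminor_insert` becomes a quadratic in `X`. -/
theorem hyperdet_pencil_pminor (K : Matrix (Fin 4) (Fin 4) ℂ) :
    ∃ x y z : ℂ, (hyperdet fun U : Finset (Fin 3) =>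
      C (pminor K (U.map Fin.castSuccEmb)) * X + C (pminor K (insert 3 (U.map Fin.castSuccEmb)))) =
      (C x * X ^ 2 + C y * X + C z) ^ 2 := by
  set L : Matrix (Fin 4) (Fin 4) ℂ[X] := Matrix.of fun i j =>
    if i = 3 ∧ j = 3 then C (K 3 3) + X else C (K i j) with hL
  have h1 : ∀ U : Finset (Fin 3), C (pminor K (U.map Fin.castSuccEmb)) * X +
      C (pminor K (insert 3 (U.map Fin.castSuccEmb))) =
      pminor L (insert 3 (U.map Fin.castSuccEmb)) := by
    intro U
    have hU : (3 : Fin 4) ∉ U.map Fin.castSuccEmb := by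
      intro h
      obtain ⟨x, _, hx⟩ := mem_map.1 h
      exact (Fin.castSucc_lt_last x).ne hx
    have hne : ∀ j ∈ U.map Fin.castSuccEmb, j ≠ 3 := fun j hj h => hU (h ▸ hj)
    rw [map_pminor, map_pminor, pminor_insert L hU, pminor_insert _ hU]
    have e1 : pminor L (U.map Fin.castSuccEmb) =
        pminor (K.map C) (U.map Fin.castSuccEmb) :=
      pminor_congr fun j hj k hk => by simp [hL, hne j hj]
    have e2 : pminor (Matrix.of fun j k => L j k - L j 3 * L 3 k) (U.map Fin.castSuccEmb) =
        pminor (Matrix.of fun j k => K.map C j k - K.map C j 3 * K.map C 3 k)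
          (U.map Fin.castSuccEmb) :=
      pminor_congr fun j hj k hk => by simp [hL, hne j hj, hne k hk]
    have e3 : L 3 3 = C (K 3 3) + X := by simp [hL]
    rw [e1, e2, e3, Matrix.map_apply]
    ring
  simp_rw [h1]
  rw [hyperdet_pminor_insert]
  have hLe : ∀ i j : Fin 4, ¬(i = 3 ∧ j = 3) → L i j = C (K i j) := fun i j h => by simp [hL, h]
  have e3 : L 3 3 = C (K 3 3) + X := by simp [hL]
  rw [e3]
  generalize K 3 3 = d
  rw [hLe 0 1 (by decide), hLe 0 2 (by decide), hLe 0 3 (by decide), hLe 1 0 (by decide),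
    hLe 1 2 (by decide), hLe 1 3 (by decide), hLe 2 0 (by decide), hLe 2 1 (by decide),
    hLe 2 3 (by decide), hLe 3 0 (by decide), hLe 3 1 (by decide), hLe 3 2 (by decide)]
  simp only [← C_mul, ← C_add, ← C_sub]
  generalize K 0 1 * K 1 2 * K 2 0 - K 0 2 * K 2 1 * K 1 0 = u
  generalize K 0 3 * K 3 1 * K 1 2 * K 2 0 + _ + _ - _ - _ - _ = v
  generalize K 0 3 * K 3 1 * K 1 3 * K 3 2 * K 2 0 + _ + _ - _ - _ - _ = w
  refine ⟨u, 2 * d * u - v, d ^ 2 * u - d * v + w, ?_⟩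
  simp only [C_mul, C_add, C_sub, C_pow, map_ofNat]
  ring

theorem quartic_of_eq_mul_sq {p : ℂ[X]} {κ x y z : ℂ}
    (hp : p = C κ * (C x * X ^ 2 + C y * X + C z) ^ 2) :
    quarticB p = 0 ∧ quarticC p = 0 ∧ quarticD p = 0 := by
  have h : p = C (κ * x ^ 2) * X ^ 4 + C (κ * (2 * x * y)) * X ^ 3 +
      C (κ * (y ^ 2 + 2 * x * z)) * X ^ 2 + C (κ * (2 * y * z)) * X ^ 1 + C (κ * z ^ 2) := by
    rw [hp]
    simp only [C_mul, C_add, C_pow, map_ofNat]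
    ring
  have h0 : p.coeff 0 = κ * z ^ 2 := by
    rw [h]; simp only [coeff_add, coeff_C_mul_X_pow, coeff_C]; simp
  have h1 : p.coeff 1 = κ * (2 * y * z) := by
    rw [h]; simp only [coeff_add, coeff_C_mul_X_pow, coeff_C]; simp
  have h2 : p.coeff 2 = κ * (y ^ 2 + 2 * x * z) := by
    rw [h]; simp only [coeff_add, coeff_C_mul_X_pow, coeff_C]; simp
  have h3 : p.coeff 3 = κ * (2 * x * y) := by
    rw [h]; simp only [coeff_add, coeff_C_mul_X_pow, coeff_C]; simp
  have h4 : p.coeff 4 = κ * x ^ 2 := by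
    rw [h]; simp only [coeff_add, coeff_C_mul_X_pow, coeff_C]; simp
  rw [quarticB, quarticC, quarticD, h0, h1, h2, h3, h4]
  refine ⟨?_, ?_, ?_⟩ <;> ring

theorem localConditions_of_pminor {n : ℕ} {H : Matrix (Fin n) (Fin n) ℂ} (hH : H.IsHermitian)
    {b : Finset (Fin n) → ℝ} {c : ℝ} (hb : ∀ S, (b S : ℂ) = c * pminor H S) :
    LocalConditions b := by
  have hK : ∀ {k : ℕ} (h : k ≤ n) (U : Finset (Fin k)), ((firstCoords h b U : ℝ) : ℂ) =
      c * pminor (H.submatrix (Fin.castLEEmb h) (Fin.castLEEmb h)) U := fun h U => by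
    rw [firstCoords, hb, pminor_submatrix]
  have hconj : ∀ {k : ℕ} (h : k ≤ n) (i j : Fin k),
      H.submatrix (Fin.castLEEmb h) (Fin.castLEEmb h) j i =
      (starRingEnd ℂ) (H.submatrix (Fin.castLEEmb h) (Fin.castLEEmb h) i j) := fun h i j =>
    (hH.apply _ _).symm
  refine ⟨fun h => ?_, fun h => ?_, fun h => ?_⟩
  · set K := H.submatrix (Fin.castLEEmb h) (Fin.castLEEmb h) with hKdef
    have : ((minorQuadric (firstCoords h b) : ℝ) : ℂ) =
        ((c ^ 2 * Complex.normSq (K 0 1) : ℝ) : ℂ) := by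
      rw [minorQuadric]
      push_cast
      rw [hK, hK, hK, hK, ← hKdef, pminor_singleton, pminor_singleton, pminor_empty,
        pminor_pair K (by decide), ← Complex.mul_conj, ← hconj]
      ring
    rw [Complex.ofReal_injective this]
    exact mul_nonneg (sq_nonneg _) (Complex.normSq_nonneg _)
  · set K := H.submatrix (Fin.castLEEmb h) (Fin.castLEEmb h) with hKdef
    have : ((hypDet (firstCoords h b) : ℝ) : ℂ) =
        ((-(2 * c ^ 2 * (K 0 1 * K 1 2 * K 2 0).im) ^ 2 : ℝ) : ℂ) := by
      have e : ((hypDet (firstCoords h b) : ℝ) : ℂ) =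
          hyperdet (fun U => ((firstCoords h b U : ℝ) : ℂ)) :=
        map_hyperdet Complex.ofRealHom _
      -- Reversing a 3-cycle conjugates its product, so the difference is purely imaginary and its
      -- square is nonpositive.
      have e2 : K 0 2 * K 2 1 * K 1 0 = (starRingEnd ℂ) (K 0 1 * K 1 2 * K 2 0) := by
        rw [map_mul, map_mul, ← hconj, ← hconj, ← hconj]
        ring
      rw [e]
      simp_rw [hK]
      rw [hyperdet_smul, ← hKdef, hyperdet_pminor, e2, Complex.sub_conj]
      push_cast
      linear_combination (4 * (c : ℂ) ^ 4 * ((K 0 1 * K 1 2 * K 2 0).im : ℂ) ^ 2) * Complex.I_sq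
    rw [Complex.ofReal_injective this]
    nlinarith [sq_nonneg (2 * c ^ 2 * (K 0 1 * K 1 2 * K 2 0).im)]
  · obtain ⟨x, y, z, hxyz⟩ :=
      hyperdet_pencil_pminor (H.submatrix (Fin.castLEEmb h) (Fin.castLEEmb h))
    have hp : (hyperdet (pencil (firstCoords h b))).map Complex.ofRealHom =
        C ((c : ℂ) ^ 4) * (C x * X ^ 2 + C y * X + C z) ^ 2 := by
      have := map_hyperdet (mapRingHom Complex.ofRealHom) (pencil (firstCoords h b))
      rw [coe_mapRingHom] at this
      rw [this, ← hxyz, C_pow, ← hyperdet_smul]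
      congr 1
      funext U
      simp only [pencil, Polynomial.map_add, Polynomial.map_mul, map_C, map_X,
        Complex.ofRealHom_eq_coe, hK, C_mul]
      ring
    obtain ⟨h1, h2, h3⟩ := quartic_of_eq_mul_sq hp
    rw [quarticB_map, map_eq_zero] at h1
    rw [quarticC_map, map_eq_zero] at h2
    rw [quarticD_map, map_eq_zero] at h3
    exact ⟨h1, h2, h3⟩

end PrincipalMinors

/-! ### Necessity on the whole orbit by density -/

namespace PrincipalMinors

open Finset Polynomial

theorem continuous_coeff_mul {X : Type*} [TopologicalSpace X] {f g : X → ℝ[X]}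
    (hf : ∀ k, Continuous fun x => (f x).coeff k) (hg : ∀ k, Continuous fun x => (g x).coeff k)
    (k : ℕ) : Continuous fun x => (f x * g x).coeff k := by
  simp only [coeff_mul]
  exact continuous_finsetSum _ fun p _ => (hf _).mul (hg _)

theorem continuous_coeff_hyperdet {X : Type*} [TopologicalSpace X]
    {f : X → Finset (Fin 3) → ℝ[X]} (hf : ∀ U k, Continuous fun x => (f x U).coeff k) (k : ℕ) :
    Continuous fun x => (hyperdet (f x)).coeff k := by
  have hadd : ∀ {p q : X → ℝ[X]}, (∀ k, Continuous fun x => (p x).coeff k) →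
      (∀ k, Continuous fun x => (q x).coeff k) → ∀ k, Continuous fun x => (p x + q x).coeff k :=
    fun hp hq k => by simp only [coeff_add]; exact (hp k).add (hq k)
  have hsub : ∀ {p q : X → ℝ[X]}, (∀ k, Continuous fun x => (p x).coeff k) →
      (∀ k, Continuous fun x => (q x).coeff k) → ∀ k, Continuous fun x => (p x - q x).coeff k :=
    fun hp hq k => by simp only [coeff_sub]; exact (hp k).sub (hq k)
  have h2 : ∀ U V k, Continuous fun x => (f x U * f x V).coeff k := fun U V =>
    continuous_coeff_mul (hf U) (hf V)
  have h4 : ∀ k, Continuous fun _ : X => (4 : ℝ[X]).coeff k := fun _ => continuous_const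
  simp only [hyperdet, sq]
  have hlin := hsub (hsub (hadd (h2 {0} {1, 2}) (h2 {1} {0, 2})) (h2 {2} {0, 1}))
    (h2 ∅ {0, 1, 2})
  exact hsub (continuous_coeff_mul hlin hlin) (continuous_coeff_mul
    (continuous_coeff_mul h4 (hsub (h2 {0} {1}) (h2 ∅ {0, 1})))
    (hsub (h2 {0, 2} {1, 2}) (h2 {2} {0, 1, 2}))) k

theorem isClosed_localConditions (n : ℕ) :
    IsClosed {b : Finset (Fin n) → ℝ | LocalConditions b} := by
  have hc : ∀ {k : ℕ} (h : k ≤ n) (U : Finset (Fin k)),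
      Continuous fun b : Finset (Fin n) → ℝ => firstCoords h b U := fun h U =>
    continuous_apply _
  have hq : ∀ h : 4 ≤ n, ∀ k, Continuous fun b : Finset (Fin n) → ℝ =>
      (hyperdet (pencil (firstCoords h b))).coeff k := fun h k =>
    continuous_coeff_hyperdet (fun U j => by
      simp only [pencil, coeff_add, coeff_C_mul, coeff_C]
      refine ((hc h _).mul continuous_const).add ?_
      split_ifs
      · exact hc h _
      · exact continuous_const) k
  have h1 : {b : Finset (Fin n) → ℝ | LocalConditions b} =
      (⋂ h : 2 ≤ n, {b | 0 ≤ minorQuadric (firstCoords h b)}) ∩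
      ((⋂ h : 3 ≤ n, {b | hypDet (firstCoords h b) ≤ 0}) ∩
      ⋂ h : 4 ≤ n, ({b | quarticB (hyperdet (pencil (firstCoords h b))) = 0} ∩
        ({b | quarticC (hyperdet (pencil (firstCoords h b))) = 0} ∩
        {b | quarticD (hyperdet (pencil (firstCoords h b))) = 0}))) := by
    ext b
    simp only [Set.mem_ofPred_eq, Set.mem_inter_iff, Set.mem_iInter]
    exact ⟨fun hb => ⟨hb.1, hb.2, hb.3⟩, fun hb => ⟨hb.1, hb.2.1, hb.2.2⟩⟩
  rw [h1]
  refine (isClosed_iInter fun h => isClosed_le continuous_const ?_).inter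
    ((isClosed_iInter fun h => isClosed_le ?_ continuous_const).inter
    (isClosed_iInter fun h => (isClosed_eq ?_ continuous_const).inter
      ((isClosed_eq ?_ continuous_const).inter (isClosed_eq ?_ continuous_const))))
  · have := hc h
    unfold minorQuadric
    fun_prop
  · have := hc h
    unfold hypDet
    fun_prop
  all_goals
    have := hq h
    simp only [quarticB, quarticC, quarticD]
    fun_prop

/-- The element of `SL₂(ℝ)ⁿ` whose factors are lower triangular unipotent with entries `y`. -/
def lowerUnipotent {n : ℕ} (y : Fin n → ℝ) : SLPerm n :=
  SemidirectProduct.inl fun i => specialLinearOfEntries 1 0 (y i) 1 (by ring)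

theorem act_lowerUnipotent {n : ℕ} (y : Fin n → ℝ) (b : Finset (Fin n) → ℝ)
    (T : Finset (Fin n)) :
    act (lowerUnipotent y) b T = ∑ S, b S * ∏ i, if i ∈ S then (if i ∈ T then 1 else y i) else
      (if i ∈ T then 0 else 1) := by
  rw [act]
  refine sum_congr rfl fun S _ => ?_
  congr 1
  refine prod_congr rfl fun i _ => ?_
  change (!![1, 0; y i, 1] : Matrix (Fin 2) (Fin 2) ℝ) (if i ∈ S then 1 else 0)
    (if i ∈ T then 1 else 0) = _
  split_ifs <;> rfl

theorem continuous_act_lowerUnipotent {n : ℕ} (b : Finset (Fin n) → ℝ) :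
    Continuous fun y : Fin n → ℝ => act (lowerUnipotent y) b := by
  refine continuous_pi fun T => ?_
  simp only [act_lowerUnipotent]
  refine continuous_finsetSum _ fun S _ => continuous_const.mul
    (continuous_finsetProd _ fun i _ => ?_)
  split_ifs <;> fun_prop

theorem act_lowerUnipotent_zero {n : ℕ} (b : Finset (Fin n) → ℝ) :
    act (lowerUnipotent 0) b = b := by
  have : (lowerUnipotent 0 : SLPerm n) = 1 := by
    rw [lowerUnipotent, ← map_one SemidirectProduct.inl]
    congr 1
    funext i
    ext j k
    fin_cases j <;> fin_cases k <;> rfl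
  rw [this, act_one]

/-- Along some line of lower unipotent elements, the coordinate at `∅` of the image of a nonzero
vector is a nonzero polynomial. -/
theorem exists_polynomial_act_lowerUnipotent {n : ℕ} {b : Finset (Fin n) → ℝ} (hb : b ≠ 0) :
    ∃ (y : Fin n → ℝ) (P : ℝ[X]), P ≠ 0 ∧
      ∀ s : ℝ, act (lowerUnipotent (s • y)) b ∅ = P.eval s := by
  classical
  -- Along the indicator of a minimal set `S₀` of the support, subsets of `S₀` other than `S₀`
  -- contribute nothing, so the polynomial takes the value `b S₀` at `1`.
  obtain ⟨S₀, hS₀, hmin⟩ := WellFounded.has_min (wellFounded_lt (α := Finset (Fin n)))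
    {S | b S ≠ 0} (Function.ne_iff.1 hb)
  refine ⟨fun i => if i ∈ S₀ then 1 else 0,
    ∑ S, C (b S) * ∏ i, if i ∈ S then X * C (if i ∈ S₀ then 1 else 0) else 1, fun h => ?_,
    fun s => ?_⟩
  · have h1 := congrArg (eval 1) h
    rw [eval_finsetSum, sum_eq_single S₀] at h1
    · rw [eval_zero, eval_mul, eval_C, eval_prod, prod_eq_one, mul_one] at h1
      · exact hS₀ h1
      · intro i _
        split_ifs <;> simp
    · intro S _ hS
      by_cases hle : S ⊆ S₀
      · have : b S = 0 := by
          by_contra h'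
          exact hmin S h' (lt_of_le_of_ne hle hS)
        simp [this]
      · obtain ⟨i, hi, hi₀⟩ := not_subset.1 hle
        rw [eval_mul, eval_prod, prod_eq_zero (mem_univ i), mul_zero]
        simp [hi, hi₀]
    · simp
  · rw [act_lowerUnipotent, eval_finsetSum]
    refine sum_congr rfl fun S _ => ?_
    rw [eval_mul, eval_C, eval_prod]
    congr 1
    refine prod_congr rfl fun i _ => ?_
    split_ifs <;> simp_all

/-- The conditions hold for the principal minors of a Hermitian matrix. -/
theorem orbitConditions_of_pminor {n : ℕ} {A : Matrix (Fin n) (Fin n) ℂ} (hA : A.IsHermitian)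
    {a : Finset (Fin n) → ℝ} (ha : ∀ S, pminor A S = a S) (h0 : a ∅ = 1) :
    OrbitConditions a := by
  intro γ
  have hne : act γ a ≠ 0 := fun h => by
    have h1 := act_inv_act γ a
    rw [h] at h1
    have h2 := congrFun h1 ∅
    rw [h0, act] at h2
    simp at h2
  obtain ⟨y, P, hP, hy⟩ := exists_polynomial_act_lowerUnipotent hne
  have hclosed : IsClosed {s : ℝ | LocalConditions (act (lowerUnipotent (s • y)) (act γ a))} :=
    (isClosed_localConditions n).preimage
      ((continuous_act_lowerUnipotent _).comp (continuous_id.smul continuous_const))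
  have hdense : Dense {s : ℝ | P.eval s ≠ 0} := by
    have : {s : ℝ | P.eval s ≠ 0} = (P.roots.toFinset : Set ℝ)ᶜ := by
      ext s
      simp [hP]
    rw [this]
    exact (P.roots.toFinset.finite_toSet.countable).dense_compl ℝ
  have hsub : {s : ℝ | P.eval s ≠ 0} ⊆
      {s : ℝ | LocalConditions (act (lowerUnipotent (s • y)) (act γ a))} := by
    intro s hs
    rw [Set.mem_ofPred_eq, ← hy, act_act] at hs
    rw [Set.mem_ofPred_eq, act_act]
    obtain ⟨H, hH, hHS⟩ := hermitian_transform (c := 1) hA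
      (fun S => by rw [Complex.ofReal_one, one_mul, ha]) _ hs
    exact localConditions_of_pminor hH hHS
  -- The conditions hold for all but finitely many `s`, hence at `s = 0`, where the unipotent
  -- element is trivial.
  have h := hclosed.closure_subset_iff.2 hsub (hdense 0)
  rw [Set.mem_ofPred_eq, zero_smul, act_lowerUnipotent_zero] at h
  exact h

end PrincipalMinors

theorem corollary7p12 (n : ℕ) (a : Finset (Fin n) → ℝ) (ha : a ∅ = 1) :
    (∃ A : Matrix (Fin n) (Fin n) ℂ,
        A.IsHermitian ∧ ∀ S : Finset (Fin n), principalMinor A S = (a S : ℂ)) ↔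
      ∀ γ : SLPerm n,
        (∀ h : 2 ≤ n, 0 ≤ minorQuadric (firstCoords h (act γ a))) ∧
        (∀ h : 3 ≤ n, hypDet (firstCoords h (act γ a)) ≤ 0) ∧
        (∀ h : 4 ≤ n,
          restrictFour (quarticB (discrRayleigh h (act γ a))) = 0 ∧
          restrictFour (quarticC (discrRayleigh h (act γ a))) = 0 ∧
          restrictFour (quarticD (discrRayleigh h (act γ a))) = 0) := by
  rw [← orbitConditions_iff]
  constructor
  · rintro ⟨A, hA, hAS⟩
    exact orbitConditions_of_pminor hA hAS ha
  · intro h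
    obtain ⟨A, hA, hAS⟩ := isMinorVectorOn_of_orbitConditions Finset.univ a ha h
    exact ⟨A, hA, fun S => hAS S (Finset.subset_univ S)⟩
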